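/- Let $X$ be a smooth manifold with a smooth pseudo-Riemannian metric $g$ of signature $(p,q)$ and constant sectional curvature $c$ (for instance a pseudo-Riemannian space form), and let $M$ be a $p$-dimensional smooth manifold, immersed in $X$ by a smooth map such that the induced metric is positive definite ($M$ is spacelike) and the mean curvature vector, that is the trace of the second fundamental form $\mathrm{I\!I}(u,v)=(\nabla_u v)^{N}$, vanishes identically ($M$ is maximal). No completeness is needed. Norms are taken with respect to the induced metric on tangent vectors and the positive definite scalar product $-g$ on normal vectors, $\nabla\mathrm{I\!I}$ is the covariant derivative formed with the Levi-Civita connection of $M$ and the normal connection, $\Delta=\operatorname{trace}\nabla d$ is the Laplacian of $M$ on functions, and $R_{u,v}w=[\nabla_u,\nabla_v]w-\nabla_{[u,v]}w$, $\sec$, $\mathrm{Ric}$ and $\mathrm{Scal}$ are the curvature tensor, the sectional, the Ricci and the scalar curvature of $M$. Let $x\in M$, let $(e_i)_{1\le i\le p}$ be an orthonormal basis of $T_xM$ and $(\nu_\alpha)_{1\le\alpha\le q}$ an orthonormal basis of the normal space at $x$, so that $g(\nu_\alpha,\nu_\beta)=-\delta_{\alpha\beta}$. Write $\mathrm{I\!I}(e_i,e_j)=\sum_\alpha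 h^\alpha_{ij}\nu_\alpha$, $H^\alpha=(h^\alpha_{ij})_{i,j}$ and $R_{e_i,e_j}e_k=\sum_l R^l_{ijk}e_l$, and let $\|\cdot\|$ be the Frobenius norm on matrices. Then, at $x$, $$\tfrac12\Delta\|\mathrm{I\!I}\|^2=\|\nabla\mathrm{I\!I}\|^2+\tfrac12\sum_{\alpha,\beta=1}^{q}\|[H^\alpha,H^\beta]\|^2+\sum_{i\ne j}\sec(e_i,e_j)^2-c\,p\,\mathrm{Scal}+\sum_{i,j=1}^p\mathrm{Ric}(e_i,e_j)^2+\tfrac12\sum_{(i,j)\ne(l,k),\,(i,j)\ne(k,l)}\bigl(R^l_{ijk}\bigr)^2,$$ where the last sum is over all $i,j,k,l\in\{1,\dots,p\}$ with the two stated restrictions. In particular, if the basis $(e_i)$ diagonalizes the Ricci tensor at $x$, then the formula holds with $\sum_{i=1}^p\mathrm{Ric}(e_i,e_i)^2$ in place of $\sum_{i,j}\mathrm{Ric}(e_i,e_j)^2$. -/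

import Mathlib

open scoped Manifold ContDiff

noncomputable section

namespace PseudoRiemannian

/-! ## Tensor calculus in coordinates

All indices refer to the coordinate vector fields `∂_i`. -/

/-- The coordinate space `ℝⁿ`. -/
abbrev Euc (n : ℕ) : Type := EuclideanSpace ℝ (Fin n)

/-- The partial derivative `∂_i u`. -/
def pderiv {n : ℕ} (i : Fin n) (u : Euc n → ℝ) (y : Euc n) : ℝ :=
  fderiv ℝ u y (EuclideanSpace.single i 1)

/-- The value `∑ A_{ij} uⁱ vʲ` of the bilinear form with matrix `A`. -/
def pair {n : ℕ} (A : Matrix (Fin n) (Fin n) ℝ) (u v : Fin n → ℝ) : ℝ :=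
  ∑ i, ∑ j, A i j * u i * v j

section Metric

variable {n : ℕ} (G : Euc n → Matrix (Fin n) (Fin n) ℝ)

/-- The Christoffel symbol `Γᵏ_{ij}` of the Levi-Civita connection of the metric with coordinate
matrix `G`, so that `∇_{∂_i} ∂_j = ∑ₖ Γᵏ_{ij} ∂_k`. -/
def christoffel (k i j : Fin n) (y : Euc n) : ℝ :=
  (1 / 2) * ∑ l, (G y)⁻¹ k l *
    (pderiv i (fun z => G z j l) y + pderiv j (fun z => G z i l) y - pderiv l (fun z => G z i j) y)

/-- The component `Rˡ_{ijk}` of the curvature tensor `R_{u,v} w = [∇_u, ∇_v] w - ∇_{[u,v]} w`: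
`R_{∂_i,∂_j} ∂_k = ∑ₗ Rˡ_{ijk} ∂_l`. -/
def riemann (l i j k : Fin n) (y : Euc n) : ℝ :=
  pderiv i (christoffel G l j k) y - pderiv j (christoffel G l i k) y
    + ∑ m, (christoffel G l i m y * christoffel G m j k y
      - christoffel G l j m y * christoffel G m i k y)

/-- The components of the vector `R_{u,v} w`. -/
def curvatureVec (y : Euc n) (u v w : Fin n → ℝ) : Fin n → ℝ :=
  fun l => ∑ i, ∑ j, ∑ k, riemann G l i j k y * u i * v j * w k

/-- `g(R_{u,v} w, z)`. -/
def curvature (y : Euc n) (u v w z : Fin n → ℝ) : ℝ :=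
  pair (G y) (curvatureVec G y u v w) z

/-- The Gram determinant `g(u,u) g(v,v) - g(u,v)²`; the plane spanned by `u` and `v` is
nondegenerate if and only if it does not vanish. -/
def gram (y : Euc n) (u v : Fin n → ℝ) : ℝ :=
  pair (G y) u u * pair (G y) v v - pair (G y) u v ^ 2

/-- The sectional curvature of the plane spanned by `u` and `v`. -/
def sectional (y : Euc n) (u v : Fin n → ℝ) : ℝ :=
  curvature G y u v v u / gram G y u v

/-- The Ricci tensor `Ric(u,v)`, the trace of `w ↦ R_{w,u} v`. -/
def ricci (y : Euc n) (u v : Fin n → ℝ) : ℝ :=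
  ∑ j, ∑ k, (∑ i, riemann G i i j k y) * u j * v k

/-- The scalar curvature, the metric trace of the Ricci tensor. -/
def scalar (y : Euc n) : ℝ :=
  ∑ j, ∑ k, (G y)⁻¹ j k * ∑ i, riemann G i i j k y

/-- The Laplacian `Δu = trace ∇du` on functions. -/
def laplacian (u : Euc n → ℝ) (y : Euc n) : ℝ :=
  ∑ i, ∑ j, (G y)⁻¹ i j *
    (pderiv i (pderiv j u) y - ∑ k, christoffel G k i j y * pderiv k u y)

end Metric

section Immersion

/-! `G` is the coordinate matrix of the ambient metric, `γ` that of the induced metric and `F` the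
immersion in coordinates. Fields of ambient vectors along the immersion are given by their
components. -/

variable {p n : ℕ} (G : Euc n → Matrix (Fin n) (Fin n) ℝ)
  (γ : Euc p → Matrix (Fin p) (Fin p) ℝ) (F : Euc p → Euc n)

/-- The components of the tangent vector `∂_i F`. -/
def tangentVec (i : Fin p) (y : Euc p) : Fin n → ℝ :=
  fun a => pderiv i (fun z => F z a) y

/-- The ambient Levi-Civita covariant derivative `∇_{∂_i} V` of a vector field `V` along `F`. -/
def covDerivAlong (i : Fin p) (V : Euc p → Fin n → ℝ) (y : Euc p) : Fin n → ℝ :=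
  fun a => pderiv i (fun z => V z a) y
    + ∑ b, ∑ d, christoffel G a b d (F y) * tangentVec F i y b * V y d

/-- The normal component of an ambient vector `v` at the point with coordinates `y`. -/
def normalPart (y : Euc p) (v : Fin n → ℝ) : Fin n → ℝ :=
  v - ∑ k, ∑ l, ((γ y)⁻¹ k l * pair (G (F y)) v (tangentVec F l y)) • tangentVec F k y

/-- The second fundamental form `II(∂_i, ∂_j) = (∇_{∂_i} ∂_j)^N`. -/
def secondFF (i j : Fin p) (y : Euc p) : Fin n → ℝ :=
  normalPart G γ F y (covDerivAlong G F i (tangentVec F j) y)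

/-- The value `II(u, v)` on tangent vectors with components `u` and `v`. -/
def secondFFVec (y : Euc p) (u v : Fin p → ℝ) : Fin n → ℝ :=
  ∑ i, ∑ j, (u i * v j) • secondFF G γ F i j y

/-- The mean curvature vector, the metric trace of the second fundamental form. -/
def meanCurvature (y : Euc p) : Fin n → ℝ :=
  ∑ i, ∑ j, (γ y)⁻¹ i j • secondFF G γ F i j y

/-- The normal connection `∇^N_{∂_i} V = (∇_{∂_i} V)^N` on normal fields. -/
def normalDeriv (i : Fin p) (V : Euc p → Fin n → ℝ) (y : Euc p) : Fin n → ℝ :=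
  normalPart G γ F y (covDerivAlong G F i V y)

/-- The covariant derivative `(∇_{∂_k} II)(∂_i, ∂_j)
  = ∇^N_{∂_k} (II(∂_i, ∂_j)) - II(∇_{∂_k} ∂_i, ∂_j) - II(∂_i, ∇_{∂_k} ∂_j)`. -/
def nablaSecondFF (k i j : Fin p) (y : Euc p) : Fin n → ℝ :=
  normalDeriv G γ F k (secondFF G γ F i j) y
    - ∑ l, christoffel γ l k i y • secondFF G γ F l j y
    - ∑ l, christoffel γ l k j y • secondFF G γ F i l y

/-- `‖II‖²`, for the induced metric on tangent vectors and the positive definite scalar product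
`-g` on normal vectors. -/
def normSqSecondFF (y : Euc p) : ℝ :=
  ∑ i, ∑ j, ∑ i', ∑ j', (γ y)⁻¹ i i' * (γ y)⁻¹ j j' *
    (-pair (G (F y)) (secondFF G γ F i j y) (secondFF G γ F i' j' y))

/-- `‖∇II‖²`, for the same scalar products. -/
def normSqNablaSecondFF (y : Euc p) : ℝ :=
  ∑ k, ∑ i, ∑ j, ∑ k', ∑ i', ∑ j', (γ y)⁻¹ k k' * (γ y)⁻¹ i i' * (γ y)⁻¹ j j' *
    (-pair (G (F y)) (nablaSecondFF G γ F k i j y) (nablaSecondFF G γ F k' i' j' y))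

end Immersion

/-! ## Manifolds -/

section Manifold

variable {n : ℕ} {X : Type*} [TopologicalSpace X] [ChartedSpace (Euc n) X]

/-- The components of a tangent vector `v` at `x` in the chart `φ`. -/
def components (φ : OpenPartialHomeomorph X (Euc n)) (x : X) (v : TangentSpace (𝓡 n) x) :
    Fin n → ℝ :=
  fun a => (show Euc n from mfderiv (𝓡 n) (𝓡 n) φ x v) a

/-- The coordinate vector `∂_a` of the chart `φ` at the point with coordinates `y`. -/
def coordVec (φ : OpenPartialHomeomorph X (Euc n)) (y : Euc n) (a : Fin n) :
    TangentSpace (𝓡 n) (φ.symm y) :=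
  mfderiv (𝓡 n) (𝓡 n) φ.symm y (EuclideanSpace.single a (1 : ℝ) : Euc n)

/-- The matrix `h(∂_a, ∂_b)` of a field `h` of bilinear forms in the chart `φ`. -/
def coordMatrix
    (h : ∀ x : X, TangentSpace (𝓡 n) x → TangentSpace (𝓡 n) x → ℝ)
    (φ : OpenPartialHomeomorph X (Euc n)) (y : Euc n) : Matrix (Fin n) (Fin n) ℝ :=
  Matrix.of fun a b => h (φ.symm y) (coordVec φ y a) (coordVec φ y b)

end Manifold

/-- A smooth pseudo-Riemannian metric of signature `(p, q)` on a `(p+q)`-manifold. -/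
structure Metric (p q : ℕ) (X : Type*) [TopologicalSpace X] [ChartedSpace (Euc (p + q)) X]
    [IsManifold (𝓡 (p + q)) ∞ X] where
  /-- the scalar product on each tangent space -/
  val : ∀ x : X, TangentSpace (𝓡 (p + q)) x →L[ℝ] TangentSpace (𝓡 (p + q)) x →L[ℝ] ℝ
  symm : ∀ (x : X) (u v : TangentSpace (𝓡 (p + q)) x), val x u v = val x v u
  signature : ∀ x : X, ∃ b : Module.Basis (Fin p ⊕ Fin q) ℝ (TangentSpace (𝓡 (p + q)) x),
    ∀ s t, val x (b s) (b t) = if s = t then Sum.elim (fun _ => 1) (fun _ => -1) s else 0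
  contMDiff : ContMDiff (𝓡 (p + q))
    ((𝓡 (p + q)).prod 𝓘(ℝ, Euc (p + q) →L[ℝ] Euc (p + q) →L[ℝ] ℝ)) ∞
    (fun x => Bundle.TotalSpace.mk' (Euc (p + q) →L[ℝ] Euc (p + q) →L[ℝ] ℝ)
      (E := fun x : X => TangentSpace (𝓡 (p + q)) x →L[ℝ] TangentSpace (𝓡 (p + q)) x →L[ℝ] ℝ)
      x (val x))

namespace Metric

variable {p q : ℕ} {X : Type*} [TopologicalSpace X] [ChartedSpace (Euc (p + q)) X]
  [IsManifold (𝓡 (p + q)) ∞ X] (g : Metric p q X)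

/-- The metric as a field of bilinear forms. -/
def form (x : X) (u v : TangentSpace (𝓡 (p + q)) x) : ℝ := g.val x u v

/-- All nondegenerate tangent planes have sectional curvature `c`. (Sectional curvature does not
depend on the chart in which it is computed.) -/
def HasConstantCurvature (c : ℝ) : Prop :=
  ∀ ψ ∈ IsManifold.maximalAtlas (𝓡 (p + q)) ∞ X, ∀ y ∈ ψ.target, ∀ u v : Fin (p + q) → ℝ,
    gram (coordMatrix g.form ψ) y u v ≠ 0 → sectional (coordMatrix g.form ψ) y u v = c

variable {M : Type*} [TopologicalSpace M] [ChartedSpace (Euc p) M] (f : M → X)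

/-- The induced field `f^* g` of bilinear forms. -/
def induced (x : M) (u v : TangentSpace (𝓡 p) x) : ℝ :=
  g.val (f x) (mfderiv (𝓡 p) (𝓡 (p + q)) f x u) (mfderiv (𝓡 p) (𝓡 (p + q)) f x v)

/-- The induced bilinear forms are positive definite. (In particular `f` is an immersion.) -/
def IsSpacelike : Prop :=
  ∀ (x : M) (v : TangentSpace (𝓡 p) x), v ≠ 0 → 0 < g.induced f x v v

variable (φ : OpenPartialHomeomorph M (Euc p)) (ψ : OpenPartialHomeomorph X (Euc (p + q)))

/-- The map `f` in the charts `φ` and `ψ`. -/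
def inCharts (y : Euc p) : Euc (p + q) := ψ (f (φ.symm y))

/-- The function `‖II‖²` in the coordinates `φ`. -/
def normSqII (y : Euc p) : ℝ :=
  normSqSecondFF (coordMatrix g.form ψ) (coordMatrix (g.induced f) φ) (inCharts f φ ψ) y

/-- The value of `‖∇II‖²` at `x`. -/
def normSqNablaII (x : M) : ℝ :=
  normSqNablaSecondFF (coordMatrix g.form ψ) (coordMatrix (g.induced f) φ) (inCharts f φ ψ) (φ x)

/-- The value of `Δ‖II‖²` at `x`. -/
def laplacianNormSqII (x : M) : ℝ :=
  laplacian (coordMatrix (g.induced f) φ) (normSqII g f φ ψ) (φ x)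

/-- The mean curvature vanishes identically. (Its vanishing at a point does not depend on the
charts in which it is computed.) -/
def IsMaximal : Prop :=
  ∀ φ ∈ IsManifold.maximalAtlas (𝓡 p) ∞ M,
  ∀ ψ ∈ IsManifold.maximalAtlas (𝓡 (p + q)) ∞ X,
  ∀ x ∈ φ.source, f x ∈ ψ.source →
    meanCurvature (coordMatrix g.form ψ) (coordMatrix (g.induced f) φ) (inCharts f φ ψ) (φ x) = 0

/-- `e₁, …, e_p` is an orthonormal basis of the tangent space of `M` at `x`, and `ν₁, …, ν_q` is an
orthonormal basis of the (negative definite) normal space. -/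
structure IsAdaptedFrame (x : M) (e : Fin p → TangentSpace (𝓡 p) x)
    (ν : Fin q → TangentSpace (𝓡 (p + q)) (f x)) : Prop where
  tangent : ∀ i j, g.induced f x (e i) (e j) = if i = j then 1 else 0
  normal : ∀ α β, g.val (f x) (ν α) (ν β) = if α = β then -1 else 0
  orthogonal : ∀ i α, g.val (f x) (mfderiv (𝓡 p) (𝓡 (p + q)) f x (e i)) (ν α) = 0

/-- The matrix `H^α = (h^α_{ij})` with `II(e_i, e_j) = ∑ h^α_{ij} ν_α`, that is
`h^α_{ij} = -g(II(e_i, e_j), ν_α)`. -/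
def shapeMatrix (x : M) (e : Fin p → TangentSpace (𝓡 p) x)
    (ν : Fin q → TangentSpace (𝓡 (p + q)) (f x)) (α : Fin q) : Matrix (Fin p) (Fin p) ℝ :=
  Matrix.of fun i j => -pair (coordMatrix g.form ψ (ψ (f x)))
    (secondFFVec (coordMatrix g.form ψ) (coordMatrix (g.induced f) φ) (inCharts f φ ψ) (φ x)
      (components φ x (e i)) (components φ x (e j)))
    (components ψ (f x) (ν α))

/-- The squared Frobenius norm of a matrix. -/
def frobSq (A : Matrix (Fin p) (Fin p) ℝ) : ℝ := ∑ i, ∑ j, A i j ^ 2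

/-- The sectional curvature `sec(u, v)` of the induced metric at `x`. -/
def sec (x : M) (u v : TangentSpace (𝓡 p) x) : ℝ :=
  sectional (coordMatrix (g.induced f) φ) (φ x) (components φ x u) (components φ x v)

/-- The Ricci curvature `Ric(u, v)` of the induced metric at `x`. -/
def ric (x : M) (u v : TangentSpace (𝓡 p) x) : ℝ :=
  ricci (coordMatrix (g.induced f) φ) (φ x) (components φ x u) (components φ x v)

/-- The scalar curvature of the induced metric at `x`. -/
def scal (x : M) : ℝ := scalar (coordMatrix (g.induced f) φ) (φ x)

/-- `⟨R_{u,v} w, z⟩` for the induced metric at `x`. In an orthonormal basis `e` of the tangent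
space, `rm (e i) (e j) (e k) (e l)` is the component `Rˡ_{ijk}` of `R_{e_i,e_j} e_k` along
`e_l`. -/
def rm (x : M) (u v w z : TangentSpace (𝓡 p) x) : ℝ :=
  curvature (coordMatrix (g.induced f) φ) (φ x) (components φ x u) (components φ x v)
    (components φ x w) (components φ x z)

end Metric

end PseudoRiemannian

end

/-!
The second fundamental form is differentiated with the full connection of the ambient space rather
than with the normal one. Vector fields along the immersion form a module over the ring of smooth
functions of a coordinate domain of `M`, the ambient covariant derivatives `D i` act on it
compatibly with the metric, and constancy of the curvature gives `[D i, D j]` in closed form. In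
this module everything is commutative algebra over a ring with derivations (`ImmersionCalculus`),
and no projection to the normal bundle has to be differentiated: the only price is that `∇II` has a
tangential part, which by the orthogonality of `II` and the coordinate fields is again given by `II`
(`ip_C_T`).

The Laplacian of `‖II‖²` consists of a term `2⟨∇II, ∇II⟩` and a term `2⟨tr ∇²II, II⟩`
(`lap_normSq`). In the second derivatives `∇_k ∇_l II(∂_i, ∂_j)` the derivatives are reordered by
the Codazzi equation, the Ricci identity and the Codazzi equation once more (`ip_nab₃_C`), until the
trace over `k, l` falls on the arguments of `II`, where it vanishes because the immersion is
maximal. What remains after the Gauss equation is quadratic in the products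
`b i j k l = ⟨II(∂_i, ∂_j), II(∂_k, ∂_l)⟩` (`ip_L`), while removing the tangential part from the
first term contributes the sum of the squares of the `b i j k l` (`normSqNablaII_eq`).

In an orthonormal frame the Gauss equation expresses the curvature tensor of `M` in terms of `c` and
of `b`. The squared Ricci tensor, the scalar curvature and half of `∑ (Rˡ_{ijk})²` become
contractions of `b`, which account for the contractions already found (`frame_algebra`) up to
half the sum of the squared commutators of the matrices `H^α` (`half_sum_frobSq_commutator`).
Separating from `∑ (Rˡ_{ijk})²` the terms with `{i, j} = {k, l}` yields the sectional curvatures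
(`half_sum_riemann_sq`).

Two facts connect this with the geometric hypotheses. Constant sectional curvature on the
nondegenerate planes determines the curvature tensor, by polarization and because nondegenerate
planes are dense among all planes (`IsMetricOn.riemann_eq`). And in charts the immersion satisfies
the hypotheses of the algebraic calculus (`Metric.isImmersionOn`, `IsImmersionOn.toCalculus`).
-/

noncomputable section

namespace PseudoRiemannian

open TopologicalSpace

/-! ### Covariant differentiation of tensors with values in a module -/

section Nabla

variable {ι A E : Type*} [Fintype ι] [CommRing A] [AddCommGroup E] [Module A E]
  {Γ : ι → ι → ι → A} {s : ι → ι → A} {D : ι → E →+ E} {B : E →ₗ[A] E →ₗ[A] A}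

/-- The covariant derivative of `E`-valued covectors, `(∇_k P)_i = D_k (P_i) - ∑ Γˡ_{ki} P_l`.
Applied repeatedly it differentiates `E`-valued tensors of any rank. -/
def nab (Γ : ι → ι → ι → A) (D : ι → E →+ E) (k : ι) : (ι → E) →+ (ι → E) where
  toFun P i := D k (P i) - ∑ l, Γ l k i • P l
  map_zero' := by ext; simp
  map_add' P Q := by ext i; simp [Finset.sum_add_distrib]; abel

/-- The scalar product of `E`-valued covectors obtained by contracting with the inverse metric
`s`. -/
def ctr (s : ι → ι → A) (B : E →ₗ[A] E →ₗ[A] A) : (ι → E) →ₗ[A] (ι → E) →ₗ[A] A :=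
  LinearMap.mk₂ A (fun P Q => ∑ i, ∑ j, s i j * B (P i) (Q j))
    (by intros; simp [mul_add, Finset.sum_add_distrib])
    (by intros; simp [Finset.mul_sum, mul_left_comm])
    (by intros; simp [mul_add, Finset.sum_add_distrib])
    (by intros; simp [Finset.mul_sum, mul_left_comm])

theorem nab_apply (k : ι) (P : ι → E) (i : ι) :
    nab Γ D k P i = D k (P i) - ∑ l, Γ l k i • P l := rfl

theorem ctr_apply (P Q : ι → E) : ctr s B P Q = ∑ i, ∑ j, s i j * B (P i) (Q j) := rfl

theorem ctr_symm (hs : ∀ i j, s i j = s j i) (hB : ∀ V W, B V W = B W V) (P Q : ι → E) :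
    ctr s B P Q = ctr s B Q P := by
  rw [ctr_apply, ctr_apply, Finset.sum_comm]
  exact Finset.sum_congr rfl fun _ _ => Finset.sum_congr rfl fun _ _ => by rw [hs, hB]

variable [Algebra ℝ A] {d : ι → Derivation ℝ A A}

/-- The Leibniz rule `D_i (a V) = (d_i a) V + a D_i V` for the operators `D_i` along the
derivations `d_i`. -/
def IsConnection (d : ι → Derivation ℝ A A) (D : ι → E →+ E) : Prop :=
  ∀ i a V, D i (a • V) = d i a • V + a • D i V

/-- Compatibility `d_i B(V, W) = B(D_i V, W) + B(V, D_i W)` of a bilinear form with the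
operators `D_i`. -/
def IsMetricConnection (d : ι → Derivation ℝ A A) (D : ι → E →+ E) (B : E →ₗ[A] E →ₗ[A] A) :
    Prop :=
  ∀ i V W, d i (B V W) = B (D i V) W + B V (D i W)

/-- The components `Rˡ_{ijk}` of the curvature of the connection with coefficients `Γ`. -/
def riem (d : ι → Derivation ℝ A A) (Γ : ι → ι → ι → A) (l i j k : ι) : A :=
  d i (Γ l j k) - d j (Γ l i k) + ∑ m, (Γ l i m * Γ m j k - Γ l j m * Γ m i k)

/-- The Laplacian `∑ s^{ij} (∂_i ∂_j u - Γᵏ_{ij} ∂_k u)` of the scalar `u`. -/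
def lap (d : ι → Derivation ℝ A A) (s : ι → ι → A) (Γ : ι → ι → ι → A) (u : A) : A :=
  ∑ i, ∑ j, s i j * (d i (d j u) - ∑ k, Γ k i j * d k u)

theorem isConnection_nab (hD : IsConnection d D) : IsConnection d (nab Γ D) := by
  intro k a P
  ext i
  simp only [nab_apply, Pi.smul_apply, Pi.add_apply, hD k a, smul_sub, Finset.smul_sum,
    smul_comm a]
  abel

/-- Metric compatibility passes to covectors; the hypothesis `hs` says that the inverse metric `s`
is parallel. -/
theorem isMetricConnection_ctr (hD : IsMetricConnection d D B)
    (hs : ∀ k i j, d k (s i j) = -∑ l, Γ i k l * s l j - ∑ l, Γ j k l * s i l) :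
    IsMetricConnection d (nab Γ D) (ctr s B) := by
  intro k P Q
  simp only [ctr_apply, map_sum, Derivation.leibniz, smul_eq_mul, hD k, hs, nab_apply, map_sub,
    LinearMap.sub_apply, LinearMap.sum_apply, map_smul, LinearMap.smul_apply]
  have e1 : ∑ i, ∑ j, B (P i) (Q j) * ∑ l, Γ i k l * s l j
      = ∑ i, ∑ j, s i j * ∑ l, Γ l k i * B (P l) (Q j) := by
    simp only [Finset.mul_sum]
    rw [Finset.sum_comm' (t' := Finset.univ) (s' := fun _ => Finset.univ) (by simp)]
    conv_rhs => rw [Finset.sum_comm' (t' := Finset.univ) (s' := fun _ => Finset.univ) (by simp)]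
    refine Finset.sum_congr rfl fun j _ => ?_
    rw [Finset.sum_comm]
    exact Finset.sum_congr rfl fun _ _ => Finset.sum_congr rfl fun _ _ => by ring
  have e2 : ∑ i, ∑ j, B (P i) (Q j) * ∑ l, Γ j k l * s i l
      = ∑ i, ∑ j, s i j * ∑ l, Γ l k j * B (P i) (Q l) := by
    simp only [Finset.mul_sum]
    refine Finset.sum_congr rfl fun j _ => ?_
    rw [Finset.sum_comm]
    exact Finset.sum_congr rfl fun _ _ => Finset.sum_congr rfl fun _ _ => by ring
  simp only [mul_sub, mul_add, mul_neg, Finset.sum_add_distrib, Finset.sum_sub_distrib, e1, e2,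
    Finset.sum_neg_distrib]
  ring

/-- The Ricci identity. -/
theorem nab_nab_sub (hD : IsConnection d D) (k i : ι)
    (P : ι → E) (l : ι) :
    nab Γ D k (nab Γ D i P) l - nab Γ D i (nab Γ D k P) l
      = D k (D i (P l)) - D i (D k (P l)) - ∑ m, riem d Γ m k i l • P m := by
  simp only [nab_apply, map_sub, map_sum, hD _ _, riem, smul_sub, Finset.sum_sub_distrib,
    Finset.sum_add_distrib, add_smul, sub_smul, Finset.smul_sum, Finset.sum_smul, smul_smul]
  have e : ∀ a b : ι, ∑ x, ∑ y, (Γ y a x * Γ x b l) • P y = ∑ x, ∑ y, (Γ x b l * Γ y a x) • P y :=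
    fun a b => by simp only [mul_comm]
  have e1 : ∀ a b : ι, ∑ x, ∑ y, (Γ x a y * Γ y b l) • P x
      = ∑ x, ∑ y, (Γ x b l * Γ y a x) • P y := by
    intro a b
    rw [Finset.sum_comm, e]
  rw [e1, e1]
  abel

/-- The Laplacian of the squared length `B(V, V)`. -/
theorem lap_self (hD : IsMetricConnection d D B)
    (hB : ∀ V W, B V W = B W V) (V : E) :
    lap d s Γ (B V V) = 2 * ∑ k, ∑ l, s k l * B (D k V) (D l V)
      + 2 * ∑ k, ∑ l, s k l * B (nab Γ D k (fun m => D m V) l) V := by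
  have h1 : ∀ j, d j (B V V) = 2 * B (D j V) V := fun j => by
    rw [hD, hB V, two_mul]
  have h2 : ∀ i j, d i (d j (B V V)) = 2 * B (D i (D j V)) V + 2 * B (D i V) (D j V) :=
    fun i j => by
      rw [h1, two_mul, map_add, hD, hB (D j V)]; ring
  simp only [lap, h2]
  simp only [h1, nab_apply, map_sub, map_sum, LinearMap.sub_apply, LinearMap.sum_apply,
    map_smul, LinearMap.smul_apply, smul_eq_mul, Finset.mul_sum, ← Finset.sum_add_distrib]
  refine Finset.sum_congr rfl fun _ _ => Finset.sum_congr rfl fun _ _ => ?_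
  simp only [mul_sub, mul_add, Finset.mul_sum, mul_left_comm _ (2 : A)]
  ring

/-- The contraction with the inverse metric commutes with covariant differentiation. -/
theorem connection_trace (hD : IsConnection d D)
    (hs : ∀ k i j, d k (s i j) = -∑ l, Γ i k l * s l j - ∑ l, Γ j k l * s i l) (k : ι)
    (P : ι → ι → E) :
    D k (∑ i, ∑ j, s i j • P i j) = ∑ i, ∑ j, s i j • nab Γ (nab Γ D) k P i j := by
  simp only [map_sum, hD _ _, hs, nab_apply, Pi.sub_apply, Finset.sum_apply, Pi.smul_apply,
    smul_sub, sub_smul, neg_smul, Finset.sum_smul, Finset.smul_sum, smul_smul,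
    Finset.sum_add_distrib, Finset.sum_sub_distrib, Finset.sum_neg_distrib]
  have e1 : ∑ i, ∑ j, ∑ l, (Γ i k l * s l j) • P i j
      = ∑ i, ∑ j, ∑ l, (s i j * Γ l k i) • P l j := by
    rw [Finset.sum_comm]
    conv_rhs => rw [Finset.sum_comm]
    refine Finset.sum_congr rfl fun j _ => ?_
    rw [Finset.sum_comm]
    exact Finset.sum_congr rfl fun _ _ => Finset.sum_congr rfl fun _ _ => by rw [mul_comm]
  have e2 : ∑ i, ∑ j, ∑ l, (Γ j k l * s i l) • P i j
      = ∑ i, ∑ j, ∑ l, (s i j * Γ l k j) • P i l := by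
    refine Finset.sum_congr rfl fun j _ => ?_
    rw [Finset.sum_comm]
    exact Finset.sum_congr rfl fun _ _ => Finset.sum_congr rfl fun _ _ => by rw [mul_comm]
  rw [e1, e2]
  abel

end Nabla

/-! ### The equations of Gauss and Codazzi -/

/-- The calculus of vector fields along a nondegenerate immersion into a space of constant
curvature `c`. In the application `A` is the ring of smooth functions on a coordinate domain,
`E` the module of ambient vector fields along the immersion with its scalar product `ip` and
covariant derivatives `D i` along the partial derivatives `d i` of functions, `T i` are the
coordinate vector fields, `s` is the inverse of the induced metric and `Γ k i j` are its Christoffel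
symbols. -/
structure ImmersionCalculus (ι A E : Type*) [Fintype ι] [DecidableEq ι] [CommRing A] [Algebra ℝ A]
    [AddCommGroup E] [Module A E] where
  d : ι → Derivation ℝ A A
  D : ι → E →+ E
  ip : E →ₗ[A] E →ₗ[A] A
  T : ι → E
  s : ι → ι → A
  Γ : ι → ι → ι → A
  c : A
  conn : IsConnection d D
  metric : IsMetricConnection d D ip
  ip_symm : ∀ V W, ip V W = ip W V
  torsion : ∀ i j, D i (T j) = D j (T i)
  curv : ∀ i j V, D i (D j V) - D j (D i V) = (c * ip (T j) V) • T i - (c * ip (T i) V) • T j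
  Γ_symm : ∀ k i j, Γ k i j = Γ k j i
  Γ_metric : ∀ k i j, d k (ip (T i) (T j))
    = ∑ l, Γ l k i * ip (T l) (T j) + ∑ l, Γ l k j * ip (T i) (T l)
  s_symm : ∀ i j, s i j = s j i
  s_inv : ∀ i j, ∑ k, s i k * ip (T k) (T j) = if i = j then 1 else 0

theorem eq_zero_of_add_self {A : Type*} [CommRing A] [Algebra ℝ A] {z : A} (h : z + z = 0) :
    z = 0 := by
  have : (2 : ℝ) • z = 0 := by rw [two_smul, h]
  have := congrArg ((1 / 2 : ℝ) • ·) this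
  simpa [smul_smul] using this

namespace ImmersionCalculus

variable {ι A E : Type*} [Fintype ι] [DecidableEq ι] [CommRing A] [Algebra ℝ A]
    [AddCommGroup E] [Module A E] (S : ImmersionCalculus ι A E)

/-- The second fundamental form: the normal field `∇T`. -/
def II (i j : ι) : E := nab S.Γ S.D i S.T j

/-- The mean curvature vector. -/
def mean : E := ∑ i, ∑ j, S.s i j • S.II i j

/-- The derivative of the second fundamental form for the full ambient connection. -/
def C (k i j : ι) : E := nab S.Γ (nab S.Γ S.D) k S.II i j

/-- The rough Laplacian of the second fundamental form for the full ambient connection. -/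
def L (i j : ι) : E := ∑ k, ∑ l, S.s k l • nab S.Γ (nab S.Γ (nab S.Γ S.D)) k S.C l i j

/-- The scalar products `⟨II(∂_i, ∂_j), II(∂_k, ∂_l)⟩`. -/
def b (i j k l : ι) : A := S.ip (S.II i j) (S.II k l)

theorem II_eq (i j : ι) : S.II i j = S.D i (S.T j) - ∑ k, S.Γ k i j • S.T k := rfl

theorem II_symm (i j : ι) : S.II i j = S.II j i := by
  simp only [II_eq, S.torsion i j, S.Γ_symm _ i j]

theorem D_T (i j : ι) : S.D i (S.T j) = S.II i j + ∑ k, S.Γ k i j • S.T k := by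
  rw [II_eq]; abel

/-- The second fundamental form is normal. Since `Γ` is metric, `⟨II(∂_k, ∂_i), ∂_j⟩` is skew in
`i, j`, and it is symmetric in `k, i`. -/
theorem ip_II_T (i j k : ι) : S.ip (S.II i j) (S.T k) = 0 := by
  have hd : ∀ k i j, S.ip (S.II k i) (S.T j) = - S.ip (S.II k j) (S.T i) := by
    intro k i j
    have h := S.metric k (S.T i) (S.T j)
    rw [S.Γ_metric, D_T, D_T, map_add, map_add, LinearMap.add_apply] at h
    simp only [map_sum, LinearMap.sum_apply, map_smul, LinearMap.smul_apply, smul_eq_mul] at h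
    rw [S.ip_symm (S.T i)] at h
    linear_combination -h
  apply eq_zero_of_add_self
  have h1 := hd i j k
  have h2 := hd k i j
  have h3 := hd j k i
  rw [S.II_symm k i] at h2
  rw [S.II_symm k j] at h2
  rw [S.II_symm j i] at h3
  linear_combination h1 - h2 + h3

theorem ip_T_II (i j k : ι) : S.ip (S.T k) (S.II i j) = 0 := by
  rw [S.ip_symm, ip_II_T]

/-- For a maximal immersion the contraction of `b` in its first two indices vanishes. -/
theorem trace_b (hS : S.mean = 0) (k l : ι) : ∑ i, ∑ j, S.s i j * S.b i j k l = 0 := by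
  have := congrArg (fun V => S.ip V (S.II k l)) hS
  simpa [b, mean] using this

/-- The tangential part of the full derivative of the second fundamental form. -/
theorem ip_C_T (l i j m : ι) : S.ip (S.C l i j) (S.T m) = - S.b i j l m := by
  have h := S.metric l (S.II i j) (S.T m)
  rw [ip_II_T, map_zero, D_T] at h
  simp only [map_sum, map_smul, smul_eq_mul, ip_II_T, mul_zero, Finset.sum_const_zero, map_add,
    add_zero] at h
  simp only [C, nab_apply, Pi.sub_apply, Finset.sum_apply, Pi.smul_apply, map_sub,
    LinearMap.sub_apply, map_sum, LinearMap.sum_apply, map_smul, LinearMap.smul_apply, ip_II_T,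
    smul_zero, Finset.sum_const_zero, sub_zero, b]
  linear_combination -h

theorem ip_D_normal (i m : ι) {N : E} (hN : ∀ m, S.ip (S.T m) N = 0) :
    S.ip (S.D i (S.T m)) N = S.ip (S.II i m) N := by
  simp [D_T, hN]

theorem s_mul_contract (i : ι) (x : ι → A) :
    ∑ k, S.s i k * ∑ m, x m * S.ip (S.T m) (S.T k) = x i := by
  have h : ∀ k, S.s i k * ∑ m, x m * S.ip (S.T m) (S.T k)
      = ∑ m, x m * (S.s i k * S.ip (S.T k) (S.T m)) := fun k => by
    rw [Finset.mul_sum]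
    exact Finset.sum_congr rfl fun m _ => by rw [S.ip_symm (S.T m)]; ring
  simp only [h]
  rw [Finset.sum_comm]
  simp [← Finset.mul_sum, S.s_inv]

/-- A tangential vector is recovered from its scalar products with the `T k`. -/
theorem tangential_eq (x y : ι → A) (h : ∀ k, ∑ m, x m * S.ip (S.T m) (S.T k) = y k) (i : ι) :
    x i = ∑ k, S.s i k * y k := by
  rw [← S.s_mul_contract i x]
  simp only [h]

/-- The inverse of the induced metric is parallel. -/
theorem d_s (k i j : ι) : S.d k (S.s i j)
    = -∑ l, S.Γ i k l * S.s l j - ∑ l, S.Γ j k l * S.s i l := by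
  have h : ∀ j, ∑ m, (S.d k (S.s i m) + ∑ l, S.Γ i k l * S.s l m + ∑ l, S.Γ m k l * S.s i l)
      * S.ip (S.T m) (S.T j) = 0 := by
    intro j
    have h0 := congrArg (S.d k) (S.s_inv i j)
    have h1 : S.d k (if i = j then 1 else 0) = 0 := by split_ifs <;> simp
    rw [h1, map_sum] at h0
    simp only [Derivation.leibniz, S.Γ_metric, smul_eq_mul, mul_add, Finset.sum_add_distrib] at h0
    have e1 : ∑ m, S.s i m * ∑ l, S.Γ l k j * S.ip (S.T m) (S.T l) = S.Γ i k j := by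
      rw [← S.s_mul_contract i fun l => S.Γ l k j]
      exact Finset.sum_congr rfl fun m _ => by simp only [S.ip_symm (S.T m)]
    have e2 : ∑ m, (∑ l, S.Γ i k l * S.s l m) * S.ip (S.T m) (S.T j) = S.Γ i k j := by
      simp only [Finset.sum_mul]
      rw [Finset.sum_comm]
      simp only [mul_assoc, ← Finset.mul_sum, S.s_inv]
      simp
    have e3 : ∑ m, S.s i m * ∑ l, S.Γ l k m * S.ip (S.T l) (S.T j)
        = ∑ m, (∑ l, S.Γ m k l * S.s i l) * S.ip (S.T m) (S.T j) := by
      simp only [Finset.mul_sum, Finset.sum_mul]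
      rw [Finset.sum_comm]
      exact Finset.sum_congr rfl fun _ _ => Finset.sum_congr rfl fun _ _ => by ring
    have e4 : ∑ m, S.ip (S.T m) (S.T j) * S.d k (S.s i m)
        = ∑ m, S.d k (S.s i m) * S.ip (S.T m) (S.T j) := by simp only [mul_comm]
    rw [e1, e3, e4] at h0
    simp only [add_mul, Finset.sum_add_distrib, e2]
    linear_combination h0
  have h1 := S.tangential_eq _ _ h j
  simp only [mul_zero, Finset.sum_const_zero] at h1
  linear_combination h1

/-- The Ricci identity for the coordinate fields `T`. Its tangential part is the Gauss equation and
its normal part the Codazzi equation. -/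
theorem C_sub_C (k i j : ι) : S.C k i j - S.C i k j
    = (S.c * S.ip (S.T i) (S.T j)) • S.T k - (S.c * S.ip (S.T k) (S.T j)) • S.T i
      - ∑ m, riem S.d S.Γ m k i j • S.T m := by
  have h := nab_nab_sub (Γ := S.Γ) S.conn k i S.T j
  rw [S.curv] at h
  rw [← h]
  simp only [C, nab_apply (D := nab S.Γ S.D), Pi.sub_apply, Finset.sum_apply, Pi.smul_apply,
    S.Γ_symm _ i k]
  exact sub_sub_sub_cancel_right _ _ _

/-- The Gauss equation, in lowered form. -/
theorem gauss_lowered (k i j l : ι) : ∑ m, riem S.d S.Γ m k i j * S.ip (S.T m) (S.T l)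
    = S.c * S.ip (S.T i) (S.T j) * S.ip (S.T k) (S.T l)
      - S.c * S.ip (S.T k) (S.T j) * S.ip (S.T i) (S.T l)
      + S.b i j k l - S.b k j i l := by
  have h := congrArg (fun V => S.ip V (S.T l)) (S.C_sub_C k i j)
  simp only [map_sub, LinearMap.sub_apply, map_smul, LinearMap.smul_apply, map_sum,
    LinearMap.sum_apply, ip_C_T, smul_eq_mul] at h
  linear_combination h

/-- The Gauss equation. -/
theorem gauss (m k i j : ι) : riem S.d S.Γ m k i j
    = S.c * S.ip (S.T i) (S.T j) * (if m = k then 1 else 0)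
      - S.c * S.ip (S.T k) (S.T j) * (if m = i then 1 else 0)
      + ∑ n, S.s m n * (S.b i j k n - S.b k j i n) := by
  rw [S.tangential_eq _ _ (S.gauss_lowered k i j) m, ← S.s_inv m k, ← S.s_inv m i]
  simp only [Finset.mul_sum, ← Finset.sum_sub_distrib, ← Finset.sum_add_distrib]
  exact Finset.sum_congr rfl fun n _ => by rw [S.ip_symm (S.T k), S.ip_symm (S.T i) (S.T n)]; ring

/-- The coefficients of the tangential field by which the full derivative of the second
fundamental form fails to be symmetric. -/
def t (m k i j : ι) : A := ∑ n, S.s m n * (S.b k j i n - S.b i j k n)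

/-- The Codazzi equation: for the full ambient connection, `∇II` is symmetric up to a tangential
field. -/
theorem codazzi (k i j : ι) : S.C k i j = S.C i k j + ∑ m, S.t m k i j • S.T m := by
  have h : ∀ m, S.t m k i j
    = S.c * S.ip (S.T i) (S.T j) * (if m = k then 1 else 0)
      - S.c * S.ip (S.T k) (S.T j) * (if m = i then 1 else 0) - riem S.d S.Γ m k i j := fun m => by
    rw [gauss, t]
    simp only [mul_sub, Finset.sum_sub_distrib]
    ring
  rw [← sub_eq_iff_eq_add', C_sub_C]
  simp [h, sub_smul, Finset.sum_sub_distrib]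

end ImmersionCalculus

namespace ImmersionCalculus

variable {ι A E : Type*} [Fintype ι] [DecidableEq ι] [CommRing A] [Algebra ℝ A]
    [AddCommGroup E] [Module A E] (S : ImmersionCalculus ι A E)

/-! ### The rough Laplacian of the second fundamental form -/

/-- Covariant differentiation of `E`-valued tensors of rank three. -/
abbrev nab₃ : ι → (ι → ι → ι → E) →+ (ι → ι → ι → E) := nab S.Γ (nab S.Γ (nab S.Γ S.D))

theorem nab₃_apply (k : ι) (P : ι → ι → ι → E) (l i j : ι) :
    S.nab₃ k P l i j = S.D k (P l i j) - ∑ m, S.Γ m k j • P l i m - ∑ m, S.Γ m k i • P l m j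
      - ∑ m, S.Γ m k l • P m i j := by
  simp [nab₃, nab_apply]

/-- The normal part of the derivative of a tangential tensor. -/
theorem ip_nab₃_tangential {N : E} (hN : ∀ m, S.ip (S.T m) N = 0) (x : ι → ι → ι → ι → A)
    (k l i j : ι) :
    S.ip (S.nab₃ k (fun l i j => ∑ m, x m l i j • S.T m) l i j) N
      = ∑ m, x m l i j * S.ip (S.II k m) N := by
  simp [nab₃_apply, map_sum, S.conn _ _ _, hN, S.ip_D_normal _ _ hN]

/-- The Ricci identity for the second derivatives of the second fundamental form. -/
theorem nab₃_C_swap (k i l j : ι) : S.nab₃ k S.C i l j = S.nab₃ i S.C k l j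
    + (S.D k (S.D i (S.II l j)) - S.D i (S.D k (S.II l j)))
    - ∑ m, riem S.d S.Γ m k i j • S.II l m - ∑ m, riem S.d S.Γ m k i l • S.II m j := by
  have h1 : S.nab₃ k S.C i l j - S.nab₃ i S.C k l j
      = (nab S.Γ (nab S.Γ S.D) k (nab S.Γ (nab S.Γ S.D) i S.II) l
        - nab S.Γ (nab S.Γ S.D) i (nab S.Γ (nab S.Γ S.D) k S.II) l) j := by
    have : S.C = fun i => nab S.Γ (nab S.Γ S.D) i S.II := rfl
    simp only [nab₃, this]
    have h : ∀ m, S.Γ m i k = S.Γ m k i := fun m => S.Γ_symm m i k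
    simp only [nab_apply (D := nab S.Γ (nab S.Γ S.D)), h]
    simp only [Pi.sub_apply]
    abel
  have h2 := nab_nab_sub (Γ := S.Γ) S.conn k i (S.II l) j
  rw [nab_nab_sub (isConnection_nab S.conn)] at h1
  simp only [Pi.sub_apply, Finset.sum_apply, Pi.smul_apply] at h1 h2
  rw [h2] at h1
  rw [sub_eq_iff_eq_add] at h1
  rw [h1]
  abel

theorem C_symm (k i j : ι) : S.C k i j = S.C k j i := by
  simp only [C, nab_apply, Pi.sub_apply, Finset.sum_apply, Pi.smul_apply, S.II_symm i j,
    S.II_symm _ j, S.II_symm i _]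
  abel

/-- For a maximal immersion the trace of `II` vanishes, and so do the traces of its derivatives. -/
theorem trace_C (hS : S.mean = 0) (j : ι) : ∑ k, ∑ l, S.s k l • S.C j k l = 0 := by
  have := connection_trace S.conn S.d_s j S.II
  rw [show ∑ i, ∑ j, S.s i j • S.II i j = 0 from hS, map_zero] at this
  exact this.symm

theorem trace_nab₃_C (hS : S.mean = 0) (i j : ι) : ∑ k, ∑ l, S.s k l • S.nab₃ i S.C j k l = 0 := by
  have h := connection_trace S.conn S.d_s i (S.C j)
  rw [S.trace_C hS, map_zero] at h
  simp only [nab₃]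
  simp only [nab_apply i S.C, Pi.sub_apply, Finset.sum_apply, Pi.smul_apply, smul_sub,
    Finset.sum_sub_distrib, ← h, Finset.smul_sum, zero_sub, neg_eq_zero]
  simp only [smul_comm (S.s _ _)]
  have : ∀ k, ∑ l, ∑ m, S.Γ m i j • S.s k l • S.C m k l
      = ∑ m, S.Γ m i j • ∑ l, S.s k l • S.C m k l := fun k => by
    rw [Finset.sum_comm]; simp only [Finset.smul_sum]
  simp only [this]
  rw [Finset.sum_comm]
  simp only [← Finset.smul_sum, S.trace_C hS, smul_zero, Finset.sum_const_zero]

/-- Second derivatives of the second fundamental form, reordered by the Codazzi equation, the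
Ricci identity and the Codazzi equation again; the normal field `N` removes the tangential
terms. -/
theorem ip_nab₃_C {N : E} (hN : ∀ m, S.ip (S.T m) N = 0) (k l i j : ι) :
    S.ip (S.nab₃ k S.C l i j) N = S.ip (S.nab₃ i S.C j k l) N
      + ∑ m, S.t m l i j * S.ip (S.II k m) N
      + ∑ m, S.t m k j l * S.ip (S.II i m) N
      - ∑ m, riem S.d S.Γ m k i j * S.ip (S.II l m) N
      - ∑ m, riem S.d S.Γ m k i l * S.ip (S.II m j) N := by
  have h1 : S.nab₃ k S.C l i j = S.nab₃ k S.C i l j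
      + S.nab₃ k (fun l i j => ∑ m, S.t m l i j • S.T m) l i j := by
    have : S.C = (fun l i j => S.C i l j) + fun l i j => ∑ m, S.t m l i j • S.T m := by
      funext l i j; exact S.codazzi l i j
    conv_lhs => rw [this, map_add]
    simp only [Pi.add_apply, nab₃_apply]
    abel
  have h2 : S.nab₃ i S.C k l j = S.nab₃ i S.C j k l
      + S.nab₃ i (fun k l j => ∑ m, S.t m k j l • S.T m) k l j := by
    have : S.C = (fun k l j => S.C j k l) + fun k l j => ∑ m, S.t m k j l • S.T m := by
      funext k l j; rw [S.C_symm]; exact S.codazzi k j l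
    conv_lhs => rw [this, map_add]
    simp only [Pi.add_apply, nab₃_apply]
    abel
  rw [h1, nab₃_C_swap, h2, S.curv]
  simp only [map_add, LinearMap.add_apply, map_sub, LinearMap.sub_apply, ip_T_II, map_sum,
    LinearMap.sum_apply, map_smul, LinearMap.smul_apply, smul_eq_mul, mul_zero, zero_mul,
    S.ip_nab₃_tangential hN]
  ring

/-- The contraction of a tensor of rank four in its first two and in its last two indices. -/
def quad (f : ι → ι → ι → ι → A) : A := ∑ k, ∑ l, S.s k l * ∑ m, ∑ n, S.s m n * f k l m n

theorem quad_sub (f g : ι → ι → ι → ι → A) :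
    S.quad (fun k l m n => f k l m n - g k l m n) = S.quad f - S.quad g := by
  simp only [quad, mul_sub, Finset.sum_sub_distrib]

theorem quad_swap_left (f : ι → ι → ι → ι → A) :
    S.quad (fun k l m n => f l k m n) = S.quad f := by
  rw [quad, quad, Finset.sum_comm]
  simp only [S.s_symm]

theorem quad_swap_right (f : ι → ι → ι → ι → A) :
    S.quad (fun k l m n => f k l n m) = S.quad f := by
  rw [quad, quad]
  refine Finset.sum_congr rfl fun k _ => Finset.sum_congr rfl fun l _ => ?_
  rw [Finset.sum_comm]
  simp only [S.s_symm]

/-- Contractions in which the trace falls on the arguments of `II` vanish. -/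
theorem quad_trace_eq_zero (hS : S.mean = 0) (f : ι → ι → A) (i : ι) :
    S.quad (fun k l m n => S.b k l i n * f m n) = 0 := by
  have : S.quad (fun k l m n => S.b k l i n * f m n)
     
          = ∑ x : ι × ι, ∑ y : ι × ι,
        S.s x.1 x.2 * (S.s y.1 y.2 * (S.b x.1 x.2 i y.2 * f y.1 y.2)) := by
    simp only [quad, Finset.mul_sum, Fintype.sum_prod_type]
  rw [this, Finset.sum_comm]
  refine Finset.sum_eq_zero fun y _ => ?_
  have : ∑ x : ι × ι, S.s x.1 x.2 * (S.s y.1 y.2 * (S.b x.1 x.2 i y.2 * f y.1 y.2))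
      = S.s y.1 y.2 * f y.1 y.2 * ∑ x : ι × ι, S.s x.1 x.2 * S.b x.1 x.2 i y.2 := by
    rw [Finset.mul_sum]
    exact Finset.sum_congr rfl fun _ _ => by ring
  rw [this, Fintype.sum_prod_type, S.trace_b hS, mul_zero]

/-- The normal part of the rough Laplacian of the second fundamental form, that is the trace over
`k, l` of `ip_nab₃_C` with the curvature replaced by means of the Gauss equation. -/
theorem ip_L (hS : S.mean = 0) {N : E} (hN : ∀ m, S.ip (S.T m) N = 0) (i j : ι) :
    S.ip (S.L i j) N = S.c * Fintype.card ι * S.ip (S.II i j) N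
      - (2 * S.quad (fun k l m n => S.b i j k m * S.ip (S.II l n) N)
        - 2 * S.quad (fun k l m n => S.b l j i n * S.ip (S.II k m) N)
        + S.quad (fun k l m n => S.b i l k n * S.ip (S.II m j) N)
        + S.quad (fun k l m n => S.b j l k n * S.ip (S.II i m) N)) := by
  set β : ι → ι → A := fun i j => S.ip (S.II i j) N with hβ
  have β_symm : ∀ i j, β i j = β j i := fun i j => by simp only [hβ, S.II_symm i j]
  have trace_β : ∑ k, ∑ l, S.s k l * β k l = 0 := by
    have := congrArg (fun V => S.ip V N) hS
    simpa [hβ, mean] using this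
  -- `T0` to `T4` are the traces of the five terms of `ip_nab₃_C`.
  have T0 : ∑ k, ∑ l, S.s k l * S.ip (S.nab₃ i S.C j k l) N = 0 := by
    have := congrArg (fun V => S.ip V N) (S.trace_nab₃_C hS i j)
    simpa using this
  have c1 : ∑ k, ∑ l, S.s k l * β l k = 0 := by
    simpa only [β_symm] using trace_β
  have c2 : ∀ a b, ∑ k, ∑ l, S.s k l * (S.ip (S.T k) (S.T a) * β l b) = β a b := fun a b => by
    rw [Finset.sum_comm]
    simp only [← mul_assoc, ← Finset.sum_mul, S.s_symm _]
    simp [S.s_inv]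
  have c2' : ∑ k, ∑ l, S.s k l * (S.ip (S.T l) (S.T i) * β k j) = β i j := by
    have h : ∀ k, ∑ l, S.s k l * (S.ip (S.T l) (S.T i) * β k j)
        = (if k = i then 1 else 0) * β k j :=
      fun k => by rw [← S.s_inv, Finset.sum_mul]; simp only [mul_assoc]
    simp [h]
  have c3 : ∑ k, ∑ l, S.s k l * S.ip (S.T k) (S.T l) = Fintype.card ι := by
    have h : ∀ k l, S.s k l * S.ip (S.T k) (S.T l) = S.s k l * S.ip (S.T l) (S.T k) :=
      fun k l => by rw [S.ip_symm]
    rw [Finset.sum_congr rfl fun k _ =>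
      (Finset.sum_congr rfl fun l _ => h k l).trans (S.s_inv k k)]
    simp
  have T1 : ∑ k, ∑ l, S.s k l * ∑ m, S.t m l i j * β k m
      = S.quad (fun k l m n => S.b l j i n * β k m)
        - S.quad (fun k l m n => S.b i j k m * β l n) := by
    rw [← S.quad_swap_left (fun k l m n => S.b i j k m * β l n),
      ← S.quad_swap_right (fun k l m n => S.b i j l m * β k n), ← S.quad_sub]
    simp only [quad, t, Finset.sum_mul, mul_sub, sub_mul, mul_assoc]
  have T2 : ∑ k, ∑ l, S.s k l * ∑ m, S.t m k j l * β i m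
      = - S.quad (fun k l m n => S.b j l k n * β i m) := by
    rw [← zero_sub, ← S.quad_trace_eq_zero hS (fun m _ => β i m) j, ← S.quad_sub]
    simp only [quad, t, Finset.sum_mul, mul_sub, sub_mul, mul_assoc]
  have T3 : ∑ k, ∑ l, S.s k l * ∑ m, riem S.d S.Γ m k i j * β l m
      = - (S.c * β i j) + S.quad (fun k l m n => S.b i j k m * β l n)
        - S.quad (fun k l m n => S.b l j i n * β k m) := by
    rw [← S.quad_swap_left (fun k l m n => S.b l j i n * β k m),
      ← S.quad_swap_right (fun k l m n => S.b i j k m * β l n), add_sub_assoc, ← S.quad_sub]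
    have h : ∀ k l, S.s k l * ∑ m, riem S.d S.Γ m k i j * β l m
        = S.c * S.ip (S.T i) (S.T j) * (S.s k l * β l k)
          - S.c * (S.s k l * (S.ip (S.T k) (S.T j) * β l i))
          + S.s k l * ∑ m, ∑ n, S.s m n * (S.b i j k n * β l m - S.b k j i n * β l m) := by
      intro k l
      simp only [gauss, add_mul, sub_mul, Finset.sum_add_distrib, Finset.sum_sub_distrib,
        Finset.sum_mul, mul_assoc, ite_mul, one_mul, zero_mul, mul_ite, mul_zero]
      simp
      ring
    simp only [h, Finset.sum_add_distrib, Finset.sum_sub_distrib, ← Finset.mul_sum, c1, c2, quad]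
    rw [β_symm j i]
    ring
  have T4 : ∑ k, ∑ l, S.s k l * ∑ m, riem S.d S.Γ m k i l * β m j
      = S.c * β i j - S.c * Fintype.card ι * β i j
        + S.quad (fun k l m n => S.b i l k n * β m j) := by
    rw [← sub_zero (S.quad (fun k l m n => S.b i l k n * β m j)),
      ← S.quad_trace_eq_zero hS (fun m _ => β m j) i, ← S.quad_sub]
    have h : ∀ k l, S.s k l * ∑ m, riem S.d S.Γ m k i l * β m j
        = S.c * (S.s k l * (S.ip (S.T l) (S.T i) * β k j))
          - S.c * (S.s k l * (S.ip (S.T k) (S.T l))) * β i j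
          + S.s k l * ∑ m, ∑ n, S.s m n * (S.b i l k n * β m j - S.b k l i n * β m j) := by
      intro k l
      simp only [gauss, add_mul, sub_mul, Finset.sum_add_distrib, Finset.sum_sub_distrib,
        Finset.sum_mul, mul_assoc, ite_mul, one_mul, zero_mul, mul_ite, mul_zero]
      simp
      rw [S.ip_symm (S.T i)]
      ring
    simp only [h, Finset.sum_add_distrib, Finset.sum_sub_distrib, ← Finset.mul_sum, c3,
      ← Finset.sum_mul, quad]
    rw [c2']
  have h0 : S.ip (S.L i j) N = ∑ k, ∑ l, S.s k l * S.ip (S.nab₃ k S.C l i j) N := by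
    simp [L, nab₃]
  have h1 : ∀ k l, S.ip (S.nab₃ k S.C l i j) N = _ := fun k l => S.ip_nab₃_C hN k l i j
  rw [h0]
  simp only [h1, mul_add, mul_sub, Finset.sum_add_distrib, Finset.sum_sub_distrib]
  rw [T0, T1, T2, T3, T4]
  ring

/-- The Laplacian of the squared length of the second fundamental form. -/
theorem lap_normSq :
    lap S.d S.s S.Γ (∑ i, ∑ i', S.s i i' * ∑ j, ∑ j', S.s j j' * S.b i j i' j')
      = 2 * ∑ k, ∑ l, S.s k l * ∑ i, ∑ i', S.s i i' * ∑ j, ∑ j', S.s j j'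
          * S.ip (S.C k i j) (S.C l i' j')
        + 2 * ∑ i, ∑ i', S.s i i' * ∑ j, ∑ j', S.s j j' * S.ip (S.L i j) (S.II i' j') := by
  have h : lap S.d S.s S.Γ (ctr S.s (ctr S.s S.ip) S.II S.II)
      = 2 * ∑ k, ∑ l, S.s k l * ctr S.s (ctr S.s S.ip) (S.C k) (S.C l)
        + 2 * ∑ k, ∑ l, S.s k l * ctr S.s (ctr S.s S.ip)
          (nab S.Γ (nab S.Γ (nab S.Γ S.D)) k S.C l) S.II :=
    lap_self (Γ := S.Γ) (s := S.s)
      (isMetricConnection_ctr (isMetricConnection_ctr S.metric S.d_s) S.d_s)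
      (ctr_symm S.s_symm (ctr_symm S.s_symm S.ip_symm)) S.II
  have hL : ∑ k, ∑ l, S.s k l * ctr S.s (ctr S.s S.ip)
      (nab S.Γ (nab S.Γ (nab S.Γ S.D)) k S.C l) S.II = ctr S.s (ctr S.s S.ip) S.L S.II := by
    have : S.L = ∑ k, ∑ l, S.s k l • nab S.Γ (nab S.Γ (nab S.Γ S.D)) k S.C l := by
      funext i j
      simp [L]
    rw [this]
    simp
  rw [hL] at h
  exact h

end ImmersionCalculus

/-! ### Algebra in an orthonormal frame -/

section Frame

variable {ι κ : Type*} [Fintype ι] [Fintype κ]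

/-- The components, in the frame `e`, of the tensor with coordinate components `b`. -/
def frameComp (e : κ → ι → ℝ) (b : ι → ι → ι → ι → ℝ) (a₁ a₂ a₃ a₄ : κ) : ℝ :=
  ∑ x : ι × ι × ι × ι, e a₁ x.1 * e a₂ x.2.1 * e a₃ x.2.2.1 * e a₄ x.2.2.2
    * b x.1 x.2.1 x.2.2.1 x.2.2.2

/-- Contraction with the inverse metric `s` is summation over a frame `e` with `s = ∑ e_a ⊗ e_a`.
The following lemmas are its versions for repeated contractions. -/
theorem sum_inverse_metric {s : ι → ι → ℝ} {e : κ → ι → ℝ} (hs : ∀ i j, s i j = ∑ a, e a i * e a j)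
    (f : ι → ι → ℝ) :
    ∑ i, ∑ j, s i j * f i j = ∑ a, ∑ i, ∑ j, e a i * e a j * f i j := by
  simp only [hs, Finset.sum_mul]
  conv_rhs => rw [Finset.sum_comm]
  exact Finset.sum_congr rfl fun i _ => Finset.sum_comm

theorem sum_inverse_metric_sum {s : ι → ι → ℝ} {e : κ → ι → ℝ}
    (hs : ∀ i j, s i j = ∑ a, e a i * e a j) (f : ι → ι → ι → ι → ℝ) :
    ∑ i, ∑ i', s i i' * ∑ j, ∑ j', s j j' * f i i' j j' = ∑ a, ∑ c, ∑ x : ι × ι, ∑ y : ι × ι,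
      (e a x.1 * e a y.1) * (e c x.2 * e c y.2) * f x.1 y.1 x.2 y.2 := by
  simp only [sum_inverse_metric hs]
  simp only [Finset.mul_sum]
  simp only [← Fintype.sum_prod_type']
  refine Fintype.sum_equiv ⟨fun ⟨a, i, i', c, j, j'⟩ => (a, c, (i, j), (i', j')),
    fun ⟨a, c, (i, j), (i', j')⟩ => (a, i, i', c, j, j'), fun _ => rfl, fun _ => rfl⟩ _ _
        fun x => ?_
  simp only [Equiv.coe_fn_mk]
  ring

theorem sum_inverse_metric_two {s : ι → ι → ℝ} {e : κ → ι → ℝ}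
    (hs : ∀ i j, s i j = ∑ a, e a i * e a j) (b : ι → ι → ι → ι → ℝ) :
    ∑ i, ∑ i', s i i' * ∑ j, ∑ j', s j j' * b i j i' j' = ∑ a, ∑ c, frameComp e b a c a c := by
  rw [sum_inverse_metric_sum hs]
  simp only [frameComp, Fintype.sum_prod_type]
  refine Finset.sum_congr rfl fun a _ => Finset.sum_congr rfl fun c _ =>
    Finset.sum_congr rfl fun i _ => Finset.sum_congr rfl fun j _ =>
    Finset.sum_congr rfl fun i' _ => Finset.sum_congr rfl fun j' _ => by ring

theorem sum_inverse_metric_four {s : ι → ι → ℝ} {e : κ → ι → ℝ}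
    (hs : ∀ i j, s i j = ∑ a, e a i * e a j) (f : ι → ι → ι → ι → ι → ι → ι → ι → ℝ) :
    ∑ i, ∑ i', s i i' * ∑ j, ∑ j', s j j' * ∑ k, ∑ l, s k l * ∑ m, ∑ n, s m n * f i i' j j' k l m n
      = ∑ a₁, ∑ a₂, ∑ a₃, ∑ a₄, ∑ x : ι × ι × ι × ι, ∑ y : ι × ι × ι × ι,
        (e a₁ x.1 * e a₁ y.1) * (e a₂ x.2.1 * e a₂ y.2.1) * (e a₃ x.2.2.1 * e a₃ y.2.2.1)
          * (e a₄ x.2.2.2 * e a₄ y.2.2.2)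
          * f x.1 y.1 x.2.1 y.2.1 x.2.2.1 y.2.2.1 x.2.2.2 y.2.2.2 := by
  simp only [sum_inverse_metric_sum hs (fun k l m n => f _ _ _ _ k l m n)]
  rw [sum_inverse_metric_sum hs]
  refine Finset.sum_congr rfl fun a₁ _ => Finset.sum_congr rfl fun a₂ _ => ?_
  simp only [Finset.mul_sum]
  simp only [← Fintype.sum_prod_type']
  refine Fintype.sum_equiv ⟨fun ⟨(i, j), (i', j'), c, d, (k, m), (l, n)⟩ =>
      (c, d, (i, j, k, m), (i', j', l, n)),
    fun ⟨c, d, (i, j, k, m), (i', j', l, n)⟩ => ((i, j), (i', j'), c, d, (k, m), (l, n)),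
    fun _ => rfl, fun _ => rfl⟩ _ _ fun x => ?_
  simp only [Equiv.coe_fn_mk]
  ring

variable {s : ι → ι → ℝ} {e : κ → ι → ℝ}

/-- The first of the four quadratic contractions that occur in the product of the rough Laplacian of
the second fundamental form with the second fundamental form. -/
theorem sum_contract_one (hs : ∀ i j, s i j = ∑ a, e a i * e a j) (b b' : ι → ι → ι → ι → ℝ) :
    ∑ i, ∑ i', s i i' * ∑ j, ∑ j', s j j' * ∑ k, ∑ l, s k l * ∑ m, ∑ n, s m n *
      (b i j k m * b' l n i' j')
      = ∑ a₁, ∑ a₂, ∑ a₃, ∑ a₄, frameComp e b a₁ a₂ a₃ a₄ * frameComp e b' a₃ a₄ a₁ a₂ := by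
  rw [sum_inverse_metric_four hs]
  refine Finset.sum_congr rfl fun a₁ _ => Finset.sum_congr rfl fun a₂ _ =>
    Finset.sum_congr rfl fun a₃ _ => Finset.sum_congr rfl fun a₄ _ => ?_
  simp only [frameComp, Finset.sum_mul_sum]
  simp only [← Fintype.sum_prod_type']
  refine Fintype.sum_equiv ⟨fun ⟨⟨i, j, k, m⟩, (i', j', l, n)⟩ => ((i, j, k, m), (l, n, i', j')),
    fun ⟨⟨i, j, k, m⟩, (l, n, i', j')⟩ => ((i, j, k, m), (i', j', l, n)),
    fun _ => rfl, fun _ => rfl⟩ _ _ fun x => ?_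
  simp only [Equiv.coe_fn_mk]
  ring

theorem sum_contract_two (hs : ∀ i j, s i j = ∑ a, e a i * e a j) (b b' : ι → ι → ι → ι → ℝ) :
    ∑ i, ∑ i', s i i' * ∑ j, ∑ j', s j j' * ∑ k, ∑ l, s k l * ∑ m, ∑ n, s m n *
      (b l j i n * b' k m i' j')
      = ∑ a₁, ∑ a₂, ∑ a₃, ∑ a₄, frameComp e b a₃ a₂ a₁ a₄ * frameComp e b' a₃ a₄ a₁ a₂ := by
  rw [sum_inverse_metric_four hs]
  refine Finset.sum_congr rfl fun a₁ _ => Finset.sum_congr rfl fun a₂ _ =>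
    Finset.sum_congr rfl fun a₃ _ => Finset.sum_congr rfl fun a₄ _ => ?_
  simp only [frameComp, Finset.sum_mul_sum]
  simp only [← Fintype.sum_prod_type']
  refine Fintype.sum_equiv ⟨fun ⟨⟨i, j, k, m⟩, (i', j', l, n)⟩ => ((l, j, i, n), (k, m, i', j')),
    fun ⟨(l, j, i, n), (k, m, i', j')⟩ => ((i, j, k, m), (i', j', l, n)),
    fun _ => rfl, fun _ => rfl⟩ _ _ fun x => ?_
  simp only [Equiv.coe_fn_mk]
  ring

theorem sum_contract_three (hs : ∀ i j, s i j = ∑ a, e a i * e a j) (b b' : ι → ι → ι → ι → ℝ) :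
    ∑ i, ∑ i', s i i' * ∑ j, ∑ j', s j j' * ∑ k, ∑ l, s k l * ∑ m, ∑ n, s m n *
      (b i l k n * b' m j i' j')
      = ∑ a₁, ∑ a₂, ∑ a₃, ∑ a₄, frameComp e b a₁ a₃ a₃ a₄ * frameComp e b' a₄ a₂ a₁ a₂ := by
  rw [sum_inverse_metric_four hs]
  refine Finset.sum_congr rfl fun a₁ _ => Finset.sum_congr rfl fun a₂ _ =>
    Finset.sum_congr rfl fun a₃ _ => Finset.sum_congr rfl fun a₄ _ => ?_
  simp only [frameComp, Finset.sum_mul_sum]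
  simp only [← Fintype.sum_prod_type']
  refine Fintype.sum_equiv ⟨fun ⟨⟨i, j, k, m⟩, (i', j', l, n)⟩ => ((i, l, k, n), (m, j, i', j')),
    fun ⟨(i, l, k, n), (m, j, i', j')⟩ => ((i, j, k, m), (i', j', l, n)),
    fun _ => rfl, fun _ => rfl⟩ _ _ fun x => ?_
  simp only [Equiv.coe_fn_mk]
  ring

theorem sum_contract_four (hs : ∀ i j, s i j = ∑ a, e a i * e a j) (b b' : ι → ι → ι → ι → ℝ) :
    ∑ i, ∑ i', s i i' * ∑ j, ∑ j', s j j' * ∑ k, ∑ l, s k l * ∑ m, ∑ n, s m n *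
      (b j l k n * b' i m i' j')
      = ∑ a₁, ∑ a₂, ∑ a₃, ∑ a₄, frameComp e b a₂ a₃ a₃ a₄ * frameComp e b' a₁ a₄ a₁ a₂ := by
  rw [sum_inverse_metric_four hs]
  refine Finset.sum_congr rfl fun a₁ _ => Finset.sum_congr rfl fun a₂ _ =>
    Finset.sum_congr rfl fun a₃ _ => Finset.sum_congr rfl fun a₄ _ => ?_
  simp only [frameComp, Finset.sum_mul_sum]
  simp only [← Fintype.sum_prod_type']
  refine Fintype.sum_equiv ⟨fun ⟨⟨i, j, k, m⟩, (i', j', l, n)⟩ => ((j, l, k, n), (i, m, i', j')),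
    fun ⟨(j, l, k, n), (i, m, i', j')⟩ => ((i, j, k, m), (i', j', l, n)),
    fun _ => rfl, fun _ => rfl⟩ _ _ fun x => ?_
  simp only [Equiv.coe_fn_mk]
  ring

end Frame

section FrameAlgebra

variable {ι α : Type*} [Fintype ι] [DecidableEq ι] [Fintype α]

/-- The algebra behind the formula, for the products `b i j k l = ⟨II(e_i, e_j), II(e_k, e_l)⟩` in
an orthonormal frame and for `R i j k l = Rˡ_{ijk}` given by the Gauss equation. The left side is
what `⟨tr ∇²II, II⟩` and the tangential part of `∇II` contribute, the first two sums on the right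
side are half the sum of the squared commutators of the matrices of `II`. -/
theorem frame_algebra (c : ℝ) (b R : ι → ι → ι → ι → ℝ) (hl : ∀ i j k l, b i j k l = b j i k l)
    (hsw : ∀ i j k l, b i j k l = b k l i j) (htr : ∀ i j, ∑ k, b k k i j = 0)
    (hR : ∀ i j k l, R i j k l = c * ((if j = k then 1 else 0) * (if i = l then 1 else 0)
      - (if i = k then 1 else 0) * (if j = l then 1 else 0)) + b j k i l - b i k j l) :
    ∑ i, ∑ j, ∑ k, ∑ l, b i j k l ^ 2 - c * Fintype.card ι * ∑ i, ∑ j, b i j i j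
      - 2 * ∑ i, ∑ j, ∑ k, ∑ l, b k j i l * b k l i j
      + ∑ i, ∑ j, ∑ k, ∑ l, b i k k l * b l j i j + ∑ i, ∑ j, ∑ k, ∑ l, b j k k l * b i l i j
      = (∑ i, ∑ j, ∑ k, ∑ l, b i k k j * b j l l i - ∑ i, ∑ j, ∑ k, ∑ l, b k j i l * b k l i j)
        - c * Fintype.card ι * ∑ i, ∑ j, R i j j i
        + ∑ j, ∑ k, (∑ i, R i j k i) ^ 2
        + 1 / 2 * ∑ i, ∑ j, ∑ k, ∑ l, R i j k l ^ 2 := by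
  have hr : ∀ i j k l, b i j k l = b i j l k := fun i j k l => by rw [hsw, hl, hsw]
  -- Every term is a combination of `c`, the trace `u`, the full contractions `B` and `Q`, and the
  -- square `P` of the partial contraction `ρ`.
  set u := ∑ i, ∑ j, b i j i j with hu
  set Q := ∑ i, ∑ j, ∑ k, ∑ l, b k j i l * b k l i j with hQ
  set B := ∑ i, ∑ j, ∑ k, ∑ l, b i j k l ^ 2 with hB
  set ρ : ι → ι → ℝ := fun i j => ∑ k, b i k k j with hρ
  have ρ_symm : ∀ i j, ρ i j = ρ j i := fun i j => Finset.sum_congr rfl fun k _ => by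
    rw [hsw i k k j, hr, hl]
  set P := ∑ i, ∑ j, ρ i j ^ 2 with hP
  have e3 : ∑ i, ∑ j, ∑ k, ∑ l, b i k k l * b l j i j = P := by
    refine Finset.sum_congr rfl fun i _ => ?_
    have : ∀ l, ρ i l ^ 2 = ∑ j, ∑ k, b i k k l * b l j i j := fun l => by
      rw [Finset.sum_comm, ← Finset.sum_mul_sum, sq]
      congr 1
      rw [ρ_symm]
      exact Finset.sum_congr rfl fun j _ => by rw [hr l j j i]
    simp only [this]
    rw [Finset.sum_comm (s := Finset.univ (α := ι)) (t := Finset.univ (α := ι))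
      (f := fun l j => ∑ k, b i k k l * b l j i j)]
    exact Finset.sum_congr rfl fun j _ => Finset.sum_comm
  have e4 : ∑ i, ∑ j, ∑ k, ∑ l, b j k k l * b i l i j = P := by
    rw [← e3, Finset.sum_comm]
    exact Finset.sum_congr rfl fun i _ => Finset.sum_congr rfl fun j _ =>
      Finset.sum_congr rfl fun k _ => Finset.sum_congr rfl fun l _ => by rw [hl l j, hr j l i j]
  have e5 : ∑ i, ∑ j, ∑ k, ∑ l, b i k k j * b j l l i = P := by
    refine Finset.sum_congr rfl fun i _ => Finset.sum_congr rfl fun j _ => ?_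
    rw [← Finset.sum_mul_sum, sq]
    congr 1
    exact ρ_symm j i
  have hric : ∀ j k, ∑ i, R i j k i
      = c * ((Fintype.card ι - 1) * (if j = k then 1 else 0)) - ρ j k := by
    intro j k
    have h : ∑ i, b i k j i = ρ j k := by
      rw [ρ_symm]
      exact Finset.sum_congr rfl fun i _ => by rw [hl, hr k i, hsw]
    have h' : ∑ i, b j k i i = 0 := by simp only [hsw j k, htr]
    simp only [hR, Finset.sum_sub_distrib, Finset.sum_add_distrib, h, h', ← Finset.mul_sum]
    simp only [Finset.sum_ite_eq, Finset.mem_univ, Finset.sum_const, Finset.card_univ, mul_ite,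
      ite_mul, mul_one, one_mul, mul_zero, nsmul_eq_mul, if_true]
    split_ifs <;> simp
  have htrρ : ∑ j, ρ j j = u := by
    refine Finset.sum_congr rfl fun i _ => Finset.sum_congr rfl fun j _ => ?_
    rw [hr]
  have hscal : ∑ i, ∑ j, R i j j i = c * (Fintype.card ι * (Fintype.card ι - 1)) - u := by
    rw [Finset.sum_comm]
    simp only [hric, Finset.sum_sub_distrib, htrρ]
    simp
    ring
  have hric2 : ∑ j, ∑ k, (∑ i, R i j k i) ^ 2
      = c ^ 2 * (Fintype.card ι * (Fintype.card ι - 1) ^ 2) - 2 * c * (Fintype.card ι - 1) * u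
        + P := by
    have h : ∀ j k, (∑ i, R i j k i) ^ 2 = (c * (Fintype.card ι - 1)) ^ 2 * (if j = k then 1 else 0)
        - 2 * (c * (Fintype.card ι - 1)) * (if j = k then ρ j k else 0) + ρ j k ^ 2 := by
      intro j k
      rw [hric]
      split_ifs <;> ring
    simp only [h, Finset.sum_sub_distrib, Finset.sum_add_distrib, ← Finset.mul_sum]
    simp [htrρ]
    ring
  have hR2 : ∑ i, ∑ j, ∑ k, ∑ l, R i j k l ^ 2
      = 2 * c ^ 2 * (Fintype.card ι * (Fintype.card ι - 1)) - 4 * c * u + 2 * B - 2 * Q := by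
    have hδ : ∀ i j k l : ι, R i j k l ^ 2
        = c ^ 2 * ((if j = k then if i = l then 1 else 0 else 0)
            + (if i = k then if j = l then 1 else 0 else 0)
            - 2 * (if j = k then if i = l then if i = k then if j = l then 1 else 0 else 0 else 0
              else 0))
          + 2 * c * ((if j = k then if i = l then b j k i l - b i k j l else 0 else 0)
            - (if i = k then if j = l then b j k i l - b i k j l else 0 else 0))
          + (b j k i l ^ 2 + b i k j l ^ 2 - 2 * (b j k i l * b i k j l)) := by
      intro i j k l
      rw [hR]
      split_ifs <;> ring
    have q1 : ∑ i, ∑ j, ∑ k, ∑ l, b j k i l ^ 2 = B := by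
      simp only [hB, ← Fintype.sum_prod_type']
      exact Fintype.sum_equiv ⟨fun ⟨i, j, k, l⟩ => (j, k, i, l), fun ⟨j, k, i, l⟩ => (i, j, k, l),
        fun _ => rfl, fun _ => rfl⟩ _ _ fun x => rfl
    have q2 : ∑ i, ∑ j, ∑ k, ∑ l, b i k j l ^ 2 = B := by
      simp only [hB, ← Fintype.sum_prod_type']
      exact Fintype.sum_equiv ⟨fun ⟨i, j, k, l⟩ => (i, k, j, l), fun ⟨i, k, j, l⟩ => (i, j, k, l),
        fun _ => rfl, fun _ => rfl⟩ _ _ fun x => rfl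
    have q3 : ∑ i, ∑ j, ∑ k, ∑ l, b j k i l * b i k j l = Q := by
      simp only [hQ, ← Fintype.sum_prod_type']
      refine Fintype.sum_equiv ⟨fun ⟨i, j, k, l⟩ => (l, j, k, i), fun ⟨l, j, k, i⟩ => (i, j, k, l),
        fun _ => rfl, fun _ => rfl⟩ _ _ fun x => ?_
      simp only [Equiv.coe_fn_mk]
      rw [hl x.2.1, hr x.2.2.1 x.2.1, hl x.1, hr x.2.2.1 x.1, hl x.2.2.1 x.2.1, hl x.2.2.1 x.1]
    simp only [hδ, Finset.sum_sub_distrib, Finset.sum_add_distrib, ← Finset.mul_sum, q1, q2, q3]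
    have u1 : ∑ i, ∑ j, b j j i i = 0 := by simp only [htr, Finset.sum_const_zero]
    have u2 : ∑ i, ∑ j, b i i j j = 0 := by rw [Finset.sum_comm]; exact u1
    have u3 : ∑ i, ∑ j, b i j j i = u := by simp only [hr _ _ _, hu]
    have u4 : ∑ i, ∑ j, b j i i j = u := by rw [Finset.sum_comm]; exact u3
    simp
    rw [u1, u2, u3, u4]
    ring
  rw [e3, e4, e5, hscal, hric2, hR2]
  ring

/-- The components with `(i, j) = (l, k)` and those with `(i, j) = (k, l)` each contribute half of
the sum of the squared sectional curvatures. -/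
theorem half_sum_riemann_sq (R : ι → ι → ι → ι → ℝ) (h1 : ∀ i j k l, R i j k l = - R j i k l)
    (h2 : ∀ i j k l, R i j k l = - R i j l k) :
    1 / 2 * ∑ i, ∑ j, ∑ k, ∑ l, R i j k l ^ 2
      = ∑ i, ∑ j, (if i ≠ j then R i j j i ^ 2 else 0)
        + 1 / 2 * ∑ i, ∑ j, ∑ k, ∑ l,
          (if (i, j) ≠ (l, k) ∧ (i, j) ≠ (k, l) then R i j k l ^ 2 else 0) := by
  have hd : ∀ i j, R i i j = 0 := fun i j => by
    funext l
    have := h1 i i j l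
    simp only [Pi.zero_apply]
    linarith
  have h : ∀ i j k l, R i j k l ^ 2
      = (if i = l then if j = k then R i j j i ^ 2 else 0 else 0)
        + (if i = k then if j = l then R i j j i ^ 2 else 0 else 0)
        + (if (i, j) ≠ (l, k) ∧ (i, j) ≠ (k, l) then R i j k l ^ 2 else 0) := by
    intro i j k l
    simp only [ne_eq, Prod.mk.injEq]
    by_cases h3 : i = l ∧ j = k
    · obtain ⟨rfl, rfl⟩ := h3
      by_cases h4 : i = j
      · subst h4; simp [hd]
      · simp [h4]
    · by_cases h4 : i = k ∧ j = l
      · obtain ⟨rfl, rfl⟩ := h4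
        rw [h2 i j j i]
        by_cases h5 : i = j
        · subst h5; simp [hd]
        · simp [h5]
      · simp only [← ite_and, h3, h4, not_false_eq_true, and_self, if_true, if_false]
        ring
  have hij : ∀ i j, (if i ≠ j then R i j j i ^ 2 else 0) = R i j j i ^ 2 := fun i j => by
    by_cases h5 : i = j
    · subst h5; simp [hd]
    · simp [h5]
  simp only [hij]
  rw [Finset.sum_congr rfl fun i _ => Finset.sum_congr rfl fun j _ =>
      Finset.sum_congr rfl fun k _ =>
    Finset.sum_congr rfl fun l _ => h i j k l]
  simp only [Finset.sum_add_distrib, Finset.sum_ite_eq, Finset.mem_univ, if_true,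
    Finset.sum_ite_irrel, Finset.sum_const_zero]
  ring

/-- The squared commutators in terms of the products of `II`; the sign in `hb` is that of the normal
space. -/
theorem half_sum_frobSq_commutator {p : ℕ} (H : α → Matrix (Fin p) (Fin p) ℝ)
    (hH : ∀ a i j, H a i j = H a j i) (b : Fin p → Fin p → Fin p → Fin p → ℝ)
    (hb : ∀ i j k l, b i j k l = -∑ a, H a i j * H a k l) :
    1 / 2 * ∑ a, ∑ a', Metric.frobSq ⁅H a, H a'⁆
      = ∑ i, ∑ j, ∑ k, ∑ l, b i k k j * b j l l i - ∑ i, ∑ j, ∑ k, ∑ l, b k j i l * b k l i j := by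
  set M : α → α → Fin p → Fin p → ℝ := fun a a' i j => ∑ k, H a i k * H a' k j with hM
  have hcomm : ∀ a a', Metric.frobSq ⁅H a, H a'⁆
      = 2 * ∑ i, ∑ j, M a a' i j * M a a' i j - 2 * ∑ i, ∑ j, M a a' i j * M a a' j i := by
    intro a a'
    have h : ∀ i j, ⁅H a, H a'⁆ i j = M a a' i j - M a a' j i := fun i j => by
      simp only [Ring.lie_def, Matrix.sub_apply, Matrix.mul_apply, hM]
      congr 1
      exact Finset.sum_congr rfl fun k _ => by rw [hH a' i k, hH a k j, mul_comm]
    have h' : ∑ i, ∑ j, M a a' j i * M a a' j i = ∑ i, ∑ j, M a a' i j * M a a' i j :=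
      Finset.sum_comm
    have h2 : ∀ i j, (M a a' i j - M a a' j i) ^ 2 = M a a' i j * M a a' i j
      + M a a' j i * M a a' j i - 2 * (M a a' i j * M a a' j i) := fun i j => by ring
    simp only [Metric.frobSq, h, h2, Finset.sum_sub_distrib, Finset.sum_add_distrib, h',
      ← Finset.mul_sum]
    ring
  have s1 : ∑ a, ∑ a', ∑ i, ∑ j, M a a' i j * M a a' i j
      = ∑ i, ∑ j, ∑ k, ∑ l, b i k k j * b j l l i := by
    simp only [hM, hb, neg_mul_neg, Finset.sum_mul_sum]
    simp only [← Fintype.sum_prod_type']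
    refine Fintype.sum_equiv ⟨fun ⟨a, a', i, j, k, l⟩ => (k, l, i, j, a, a'),
      fun ⟨k, l, i, j, a, a'⟩ => (a, a', i, j, k, l), fun _ => rfl, fun _ => rfl⟩ _ _ fun x => ?_
    simp only [Equiv.coe_fn_mk]
    rw [hH x.1 x.2.2.1, hH x.2.1 x.2.2.2.2.1]
    ring
  have s2 : ∑ a, ∑ a', ∑ i, ∑ j, M a a' i j * M a a' j i
      = ∑ i, ∑ j, ∑ k, ∑ l, b k j i l * b k l i j := by
    simp only [hM, hb, neg_mul_neg, Finset.sum_mul_sum]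
    simp only [← Fintype.sum_prod_type']
    refine Fintype.sum_equiv ⟨fun ⟨a, a', i, j, k, l⟩ => (l, i, k, j, a, a'),
      fun ⟨l, i, k, j, a, a'⟩ => (a, a', i, j, k, l), fun _ => rfl, fun _ => rfl⟩ _ _ fun x => ?_
    simp only [Equiv.coe_fn_mk]
    rw [hH x.1 x.2.2.1, hH x.1 x.2.2.2.1]
    ring
  simp only [hcomm, Finset.sum_sub_distrib, ← Finset.mul_sum, s1, s2]
  ring

end FrameAlgebra

/-! ### The ring of smooth functions on an open set -/

section SmoothRing

variable {m n : ℕ}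

theorem euc_eq_sum (w : Euc n) : w = ∑ b, w b • (EuclideanSpace.single b (1 : ℝ) : Euc n) := by
  ext c
  simp [Pi.single_apply]

open Classical in
/-- The extension by zero of a function on an open set. -/
def extendZero (U : Opens (Euc m)) (u : U → ℝ) (y : Euc m) : ℝ :=
  if h : y ∈ U then u ⟨y, h⟩ else 0

theorem extendZero_apply {U : Opens (Euc m)} (u : U → ℝ) (y : U) : extendZero U u y = u y := by
  simp [extendZero]

theorem contDiffOn_extendZero_congr {U : Opens (Euc m)} {u : U → ℝ} {v : Euc m → ℝ}
    (hv : ContDiffOn ℝ ∞ v U) (h : ∀ y : U, u y = v y) : ContDiffOn ℝ ∞ (extendZero U u) U :=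
  hv.congr fun y hy => (extendZero_apply u ⟨y, hy⟩).trans (h ⟨y, hy⟩)

/-- The algebra of smooth functions on the open set `U`. They are functions on the subtype `U`, so
that equality of elements is equality on `U`; smoothness and derivatives refer to the extension by
zero, of which only the germs at points of `U` matter. -/
def smoothRing (U : Opens (Euc m)) : Subalgebra ℝ (U → ℝ) where
  carrier := {u | ContDiffOn ℝ ∞ (extendZero U u) U}
  mul_mem' {u v} hu hv := contDiffOn_extendZero_congr (ContDiffOn.mul hu hv) fun y => by
    simp [extendZero_apply]
  add_mem' {u v} hu hv := contDiffOn_extendZero_congr (ContDiffOn.add hu hv) fun y => by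
    simp [extendZero_apply]
  algebraMap_mem' r := contDiffOn_extendZero_congr (contDiffOn_const (c := r)) fun y => by simp

variable {U : Opens (Euc m)} {V : Opens (Euc n)}

namespace smoothRing

instance : CoeFun (smoothRing U) fun _ => U → ℝ := ⟨Subtype.val⟩

/-- The restriction to `U` of a function smooth on `U`. -/
def of (v : Euc m → ℝ) (hv : ContDiffOn ℝ ∞ v U) : smoothRing U :=
  ⟨fun y => v y, contDiffOn_extendZero_congr hv fun _ => rfl⟩

theorem of_apply (v : Euc m → ℝ) (hv : ContDiffOn ℝ ∞ v U) (y : U) : of v hv y = v y := rfl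

theorem ext {a b : smoothRing U} (h : ∀ y, a y = b y) : a = b := Subtype.ext (funext h)

theorem sum_coe {ι : Type*} (s : Finset ι) (f : ι → smoothRing U) (y : U) :
    (∑ i ∈ s, f i) y = ∑ i ∈ s, f i y := by
  simp

/-- Evaluation at a point. -/
def eval (y : U) : smoothRing U →+* ℝ :=
  (Pi.evalRingHom (fun _ => ℝ) y).comp (smoothRing U).val.toRingHom

theorem eval_apply (y : U) (a : smoothRing U) : eval y a = a y := rfl

theorem contDiffOn_of_eq {v : Euc m → ℝ} (a : smoothRing U) (h : ∀ y : U, v y = a y) :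
    ContDiffOn ℝ ∞ v U :=
  ContDiffOn.congr a.2 fun y hy => (h ⟨y, hy⟩).trans (extendZero_apply a.1 ⟨y, hy⟩).symm

theorem isUnit_of_ne_zero {a : smoothRing U} (h : ∀ y, a y ≠ 0) : IsUnit a := by
  refine IsUnit.of_mul_eq_one (of (fun y => (extendZero U a y)⁻¹) (ContDiffOn.inv a.2 ?_)) ?_
  · intro y hy
    rw [extendZero_apply _ ⟨y, hy⟩]
    exact h _
  · refine ext fun y => ?_
    change a y * (extendZero U a y)⁻¹ = 1
    rw [extendZero_apply, mul_inv_cancel₀ (h y)]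

theorem eventuallyEq_extendZero {v : Euc m → ℝ} {a : smoothRing U} (h : ∀ y : U, v y = a y)
    (y : U) : v =ᶠ[nhds (y : Euc m)] extendZero U a := by
  filter_upwards [U.isOpen.mem_nhds y.2] with z hz
  rw [extendZero_apply _ ⟨z, hz⟩, ← h]

theorem contDiffAt_extendZero (a : smoothRing U) (y : U) :
    ContDiffAt ℝ ∞ (extendZero U a) y := a.2.contDiffAt (U.isOpen.mem_nhds y.2)

theorem differentiableAt_extendZero (a : smoothRing U) (y : U) :
    DifferentiableAt ℝ (extendZero U a) y :=
  (contDiffAt_extendZero a y).differentiableAt (by simp)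

theorem contDiffOn_pderiv {v : Euc m → ℝ} (hv : ContDiffOn ℝ ∞ v U) (i : Fin m) :
    ContDiffOn ℝ ∞ (pderiv i v) U :=
  (hv.fderiv_of_isOpen U.isOpen (by simp)).clm_apply contDiffOn_const

theorem pderiv_congr {v w : Euc m → ℝ} {y : Euc m} (h : v =ᶠ[nhds y] w) (i : Fin m) :
    pderiv i v y = pderiv i w y := by
  rw [pderiv, pderiv, h.fderiv_eq]

/-- The partial derivative `∂_i` as a derivation of the ring of smooth functions. -/
def partialD (i : Fin m) : Derivation ℝ (smoothRing U) (smoothRing U) :=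
  Derivation.mk'
    { toFun a := of (pderiv i (extendZero U a)) (contDiffOn_pderiv a.2 i)
      map_add' a b := ext fun y => by
        have h : extendZero U a + extendZero U b =ᶠ[nhds (y : Euc m)] extendZero U (a + b) :=
          eventuallyEq_extendZero (a := a + b) (fun y => by simp [extendZero_apply]) y
        change pderiv i (extendZero U (a + b)) y
          = pderiv i (extendZero U a) y + pderiv i (extendZero U b) y
        rw [← pderiv_congr h, pderiv, fderiv_add (differentiableAt_extendZero a y)
          (differentiableAt_extendZero b y)]
        rfl
      map_smul' r a := ext fun y => by
        have h : r • extendZero U a =ᶠ[nhds (y : Euc m)] extendZero U (r • a) :=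
          eventuallyEq_extendZero (a := r • a) (fun y => by simp [extendZero_apply]) y
        change pderiv i (extendZero U (r • a)) y = r • pderiv i (extendZero U a) y
        rw [← pderiv_congr h, pderiv, fderiv_const_smul (differentiableAt_extendZero a y)]
        rfl }
    fun a b => ext fun y => by
      have h : extendZero U a * extendZero U b =ᶠ[nhds (y : Euc m)] extendZero U (a * b) :=
        eventuallyEq_extendZero (a := a * b) (fun y => by simp [extendZero_apply]) y
      change pderiv i (extendZero U (a * b)) y
        = a y * pderiv i (extendZero U b) y + b y * pderiv i (extendZero U a) y
      rw [← pderiv_congr h, pderiv, fderiv_mul (differentiableAt_extendZero a y)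
        (differentiableAt_extendZero b y), extendZero_apply, extendZero_apply]
      rfl

theorem partialD_apply {v : Euc m → ℝ} {a : smoothRing U} (h : ∀ y : U, v y = a y) (i : Fin m)
    (y : U) : partialD i a y = pderiv i v y :=
  (pderiv_congr (eventuallyEq_extendZero h y) i).symm

theorem pderiv_pderiv {v : Euc m → ℝ} {y : Euc m} (hv : ContDiffAt ℝ ∞ v y) (i j : Fin m) :
    pderiv i (pderiv j v) y
      = fderiv ℝ (fderiv ℝ v) y (EuclideanSpace.single i 1) (EuclideanSpace.single j 1) := by
  have h : DifferentiableAt ℝ (fderiv ℝ v) y :=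
    (hv.fderiv_right (m := ∞) (by simp)).differentiableAt (by simp)
  change fderiv ℝ (fun z => fderiv ℝ v z (EuclideanSpace.single j 1)) y _ = _
  rw [fderiv_clm_apply h (differentiableAt_const _)]
  simp

theorem partialD_comm (i j : Fin m) (a : smoothRing U) :
    partialD i (partialD j a) = partialD j (partialD i a) := by
  refine ext fun y => ?_
  have h := fun j : Fin m => partialD_apply (v := pderiv j (extendZero U a)) (a := partialD j a)
    (fun y => rfl)
  rw [h j i y, h i j y, pderiv_pderiv (contDiffAt_extendZero a y),
    pderiv_pderiv (contDiffAt_extendZero a y)]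
  exact ((contDiffAt_extendZero a y).isSymmSndFDerivAt (by
    simpa using (WithTop.coe_le_coe.2 le_top : ((2 : ℕ∞) : WithTop ℕ∞) ≤ ∞))).eq _ _

/-- The pullback of smooth functions by a smooth map `F` from `U` to `V`. -/
def pullback (F : Euc m → Euc n) (hF : ContDiffOn ℝ ∞ F U) (hUV : Set.MapsTo F U V) :
    smoothRing V →+* smoothRing U where
  toFun a := of (fun y => extendZero V a (F y)) (ContDiffOn.comp a.2 hF hUV)
  map_one' := ext fun y => extendZero_apply (U := V) 1 ⟨F y, hUV y.2⟩
  map_zero' := ext fun y => extendZero_apply (U := V) 0 ⟨F y, hUV y.2⟩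
  map_mul' a b := ext fun y => by
    have := fun a : V → ℝ => extendZero_apply (U := V) a ⟨F y, hUV y.2⟩
    simp_all [of_apply]
  map_add' a b := ext fun y => by
    have := fun a : V → ℝ => extendZero_apply (U := V) a ⟨F y, hUV y.2⟩
    simp_all [of_apply]

variable {F : Euc m → Euc n} (hF : ContDiffOn ℝ ∞ F U) (hUV : Set.MapsTo F U V)

theorem pullback_apply (a : smoothRing V) (y : U) :
    pullback F hF hUV a y = a ⟨F y, hUV y.2⟩ := extendZero_apply (U := V) a ⟨F y, hUV y.2⟩

/-- The components of a smooth map. -/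
def component (F : Euc m → Euc n) (hF : ContDiffOn ℝ ∞ F U) (b : Fin n) : smoothRing U :=
  of (fun y => F y b) ((contDiff_euclidean.1 contDiff_id b).comp_contDiffOn hF)

/-- The chain rule. -/
theorem partialD_pullback (i : Fin m) (a : smoothRing V) :
    partialD i (pullback F hF hUV a)
      = ∑ b, partialD i (component F hF b) * pullback F hF hUV (partialD b a) := by
  refine ext fun y => ?_
  have hFy : DifferentiableAt ℝ F y :=
    (hF.contDiffAt (U.isOpen.mem_nhds y.2)).differentiableAt (by simp)
  have ha : DifferentiableAt ℝ (extendZero V a) (F y) :=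
    differentiableAt_extendZero a ⟨F y, hUV y.2⟩
  have hsum : (∑ b, partialD i (component F hF b) * pullback F hF hUV (partialD b a) :
      smoothRing U) y
      = ∑ b, partialD i (component F hF b) y * pullback F hF hUV (partialD b a) y :=
    sum_coe _ _ _
  rw [hsum]
  have h1 : ∀ b, partialD i (component F hF b) y
      = fderiv ℝ F y (EuclideanSpace.single i 1) b := fun b => by
    rw [partialD_apply (v := fun y => F y b) (fun _ => rfl), pderiv]
    have := ((EuclideanSpace.proj b : Euc n →L[ℝ] ℝ).hasFDerivAt.comp (y : Euc m)
      hFy.hasFDerivAt).fderiv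
    exact congrArg (fun L : Euc m →L[ℝ] ℝ => L (EuclideanSpace.single i 1)) this
  have h2 : ∀ b, pullback F hF hUV (partialD b a) y = pderiv b (extendZero V a) (F y) := fun b => by
    rw [pullback_apply]; rfl
  simp only [h1, h2]
  rw [partialD_apply (v := fun y => extendZero V a (F y)) (fun _ => rfl)]
  change fderiv ℝ (extendZero V a ∘ F) y _ = _
  rw [fderiv_comp _ ha hFy, ContinuousLinearMap.comp_apply]
  set w := fderiv ℝ F y (EuclideanSpace.single i 1)
  conv_lhs => rw [euc_eq_sum w]
  rw [map_sum]
  exact Finset.sum_congr rfl fun b _ => by rw [map_smul]; rfl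

end smoothRing

end SmoothRing

/-! ### The Levi-Civita connection of a metric in coordinates -/

/-- The curvature of a metric connection is skew with respect to the metric. -/
theorem riem_lowered_skew {ι A : Type*} [Fintype ι] [CommRing A] [Algebra ℝ A]
    {d : ι → Derivation ℝ A A} (hd : ∀ i j a, d i (d j a) = d j (d i a)) {g : ι → ι → A}
    (hg : ∀ i j, g i j = g j i) {Γ : ι → ι → ι → A}
    (hΓ : ∀ k i j, d k (g i j) = ∑ l, Γ l k i * g l j + ∑ l, Γ l k j * g i l) (i j k l : ι) :
    ∑ m, riem d Γ m i j k * g m l = - ∑ m, riem d Γ m i j l * g m k := by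
  have h1 : ∀ i j k l, ∑ m, riem d Γ m i j k * g m l
      = ∑ m, d i (Γ m j k) * g m l - ∑ m, d j (Γ m i k) * g m l
        + (∑ m, ∑ r, Γ m j k * (Γ r i m * g r l) - ∑ m, ∑ r, Γ m i k * (Γ r j m * g r l)) := by
    intro i j k l
    have e : ∀ i j, ∑ m, ∑ r, Γ m j k * (Γ r i m * g r l)
        = ∑ m, (∑ r, Γ m i r * Γ r j k) * g m l := by
      intro i j
      rw [Finset.sum_comm]
      simp only [Finset.sum_mul]
      exact Finset.sum_congr rfl fun _ _ => Finset.sum_congr rfl fun _ _ => by ring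
    rw [e, e]
    simp only [riem, add_mul, sub_mul, Finset.sum_add_distrib, Finset.sum_sub_distrib]
  have h2 : ∀ i j, d i (d j (g k l))
      = (∑ m, d i (Γ m j k) * g m l + ∑ m, ∑ r, Γ m j k * (Γ r i m * g r l)
        + ∑ m, ∑ r, Γ m j k * (Γ r i l * g m r))
      + (∑ m, d i (Γ m j l) * g m k + ∑ m, ∑ r, Γ m j l * (Γ r i m * g r k)
        + ∑ m, ∑ r, Γ m j l * (Γ r i k * g m r)) := by
    intro i j
    rw [hΓ]
    simp only [hg k]
    simp only [map_add, map_sum, Derivation.leibniz, hΓ, smul_eq_mul, Finset.sum_add_distrib,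
      mul_add, Finset.mul_sum]
    simp only [mul_comm (g _ _) (d _ _)]
    ring
  have h3 : ∀ i j k l, ∑ m, ∑ r, Γ m j k * (Γ r i l * g m r)
      = ∑ m, ∑ r, Γ m i l * (Γ r j k * g m r) := by
    intro i j k l
    rw [Finset.sum_comm]
    exact Finset.sum_congr rfl fun _ _ => Finset.sum_congr rfl fun _ _ => by rw [hg]; ring
  have h4 := hd i j (g k l)
  rw [h2, h2, h3 i j k l, h3 i j l k] at h4
  rw [h1, h1]
  linear_combination h4

section Christoffel

variable {n : ℕ} {G : Euc n → Matrix (Fin n) (Fin n) ℝ} {y : Euc n}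

theorem christoffel_symm (hG : ∀ y i j, G y i j = G y j i) (k i j : Fin n) :
    christoffel G k i j = christoffel G k j i := by
  funext y
  simp only [christoffel, hG _ i j]
  congr 1
  exact Finset.sum_congr rfl fun l _ => by ring

theorem sum_christoffel_mul (hG : ∀ y i j, G y i j = G y j i) (hdet : IsUnit (G y).det)
    (i j l : Fin n) : ∑ k, christoffel G k i j y * G y k l
      = 1 / 2 * (pderiv i (fun z => G z j l) y + pderiv j (fun z => G z i l) y
        - pderiv l (fun z => G z i j) y) := by
  have h : ∀ m, ∑ k, G y l k * (G y)⁻¹ k m = if l = m then 1 else 0 := fun m => by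
    rw [← Matrix.mul_apply, Matrix.mul_nonsing_inv _ hdet, Matrix.one_apply]
  have h' : ∀ k, christoffel G k i j y * G y k l = ∑ m, G y l k * (G y)⁻¹ k m *
      (1 / 2 * (pderiv i (fun z => G z j m) y + pderiv j (fun z => G z i m) y
        - pderiv m (fun z => G z i j) y)) := fun k => by
    rw [christoffel, hG y k l, Finset.mul_sum, Finset.sum_mul]
    exact Finset.sum_congr rfl fun m _ => by ring
  simp only [h']
  rw [Finset.sum_comm]
  simp only [← Finset.sum_mul, h]
  simp

/-- The Levi-Civita connection is compatible with the metric. -/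
theorem pderiv_metric (hG : ∀ y i j, G y i j = G y j i) (hdet : IsUnit (G y).det)
    (k i j : Fin n) : pderiv k (fun z => G z i j) y
      = ∑ l, christoffel G l k i y * G y l j + ∑ l, christoffel G l k j y * G y i l := by
  have h : ∑ l, christoffel G l k j y * G y i l = ∑ l, christoffel G l k j y * G y l i :=
    Finset.sum_congr rfl fun l _ => by rw [hG y i l]
  rw [h, sum_christoffel_mul hG hdet, sum_christoffel_mul hG hdet]
  simp only [hG _ j i]
  ring

theorem riemann_skew (l i j k : Fin n) : riemann G l i j k y = - riemann G l j i k y := by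
  have h : ∑ m, (christoffel G l i m y * christoffel G m j k y
      - christoffel G l j m y * christoffel G m i k y)
      = - ∑ m, (christoffel G l j m y * christoffel G m i k y
      - christoffel G l i m y * christoffel G m j k y) := by
    rw [← Finset.sum_neg_distrib]
    exact Finset.sum_congr rfl fun _ _ => by ring
  rw [riemann, riemann, h]
  ring

/-- The first Bianchi identity. -/
theorem riemann_bianchi (hG : ∀ y i j, G y i j = G y j i) (l i j k : Fin n) :
    riemann G l i j k y + riemann G l j k i y + riemann G l k i j y = 0 := by
  simp only [riemann, Finset.sum_sub_distrib]
  rw [christoffel_symm hG l k j, christoffel_symm hG l k i, christoffel_symm hG l j i]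
  have h : ∀ i j k, ∑ m, christoffel G l i m y * christoffel G m j k y
    = ∑ m, christoffel G l i m y * christoffel G m k j y := fun i j k =>
    Finset.sum_congr rfl fun m _ => by rw [christoffel_symm hG m j k]
  rw [h i k j, h j k i, h k j i]
  ring

end Christoffel

/-- A matrix function which is on the open set `U` the coordinate matrix of a smooth
pseudo-Riemannian metric. Symmetry is required everywhere, since the matrix of a symmetric field of
bilinear forms in a chart is symmetric outside the target of the chart as well. -/
structure IsMetricOn {n : ℕ} (U : Opens (Euc n)) (G : Euc n → Matrix (Fin n) (Fin n) ℝ) :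
    Prop where
  smooth : ∀ i j, ContDiffOn ℝ ∞ (fun y => G y i j) U
  symm : ∀ y i j, G y i j = G y j i
  isUnit_det : ∀ y ∈ U, IsUnit (G y).det

namespace IsMetricOn

open smoothRing

variable {n : ℕ} {U : Opens (Euc n)} {G : Euc n → Matrix (Fin n) (Fin n) ℝ} (hG : IsMetricOn U G)

/-- The coefficients of the metric as smooth functions. -/
def coeff (i j : Fin n) : smoothRing U := of _ (hG.smooth i j)

include hG in
/-- The inverse metric is smooth. The matrix of the metric is inverted over the ring of smooth
functions, where its determinant is a unit. -/
theorem contDiffOn_inv (i j : Fin n) : ContDiffOn ℝ ∞ (fun y => (G y)⁻¹ i j) U := by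
  set A : Matrix (Fin n) (Fin n) (smoothRing U) := Matrix.of hG.coeff
  have hA : ∀ y : U, A.map (eval y) = G y := fun y => rfl
  have hdet : IsUnit A.det := isUnit_of_ne_zero fun y => by
    rw [← eval_apply, RingHom.map_det]
    exact (hG.isUnit_det y y.2).ne_zero
  refine contDiffOn_of_eq (A⁻¹ i j) fun y => ?_
  have h := congrArg (fun B => B.map (eval y)) (Matrix.mul_nonsing_inv A hdet)
  rw [Matrix.map_mul, hA, Matrix.map_one _ (map_zero _) (map_one _)] at h
  rw [Matrix.inv_eq_right_inv h]
  rfl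

/-- The coefficients of the inverse metric as smooth functions. -/
def inv (i j : Fin n) : smoothRing U := of _ (hG.contDiffOn_inv i j)

include hG in
theorem contDiffOn_christoffel (k i j : Fin n) : ContDiffOn ℝ ∞ (christoffel G k i j) U := by
  refine contDiffOn_const.mul (ContDiffOn.sum fun l _ => (hG.contDiffOn_inv k l).mul ?_)
  exact ((contDiffOn_pderiv (hG.smooth j l) i).add (contDiffOn_pderiv (hG.smooth i l) j)).sub
    (contDiffOn_pderiv (hG.smooth i j) l)

/-- The Christoffel symbols as smooth functions. -/
def chr (k i j : Fin n) : smoothRing U := of _ (hG.contDiffOn_christoffel k i j)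

theorem coeff_symm (i j : Fin n) : hG.coeff i j = hG.coeff j i :=
  smoothRing.ext fun y => hG.symm y i j

theorem chr_symm (k i j : Fin n) : hG.chr k i j = hG.chr k j i :=
  smoothRing.ext fun y => congrFun (christoffel_symm hG.symm k i j) y

theorem partialD_coeff (k i j : Fin n) : partialD k (hG.coeff i j)
    = ∑ l, hG.chr l k i * hG.coeff l j + ∑ l, hG.chr l k j * hG.coeff i l := by
  refine smoothRing.ext fun y => ?_
  rw [partialD_apply (v := fun z => G z i j) (fun _ => rfl),
    pderiv_metric hG.symm (hG.isUnit_det y y.2)]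
  change _ = (∑ l, hG.chr l k i * hG.coeff l j) y + (∑ l, hG.chr l k j * hG.coeff i l) y
  rw [sum_coe, sum_coe]
  rfl

theorem riem_apply (l i j k : Fin n) (y : U) :
    riem partialD hG.chr l i j k y = riemann G l i j k y := by
  have h : ∀ j k, ∀ y : U, christoffel G l j k y = hG.chr l j k y := fun _ _ _ => rfl
  rw [riemann, ← partialD_apply (h j k), ← partialD_apply (h i k)]
  change partialD i (hG.chr l j k) y - partialD j (hG.chr l i k) y
    + (∑ m, (hG.chr l i m * hG.chr m j k - hG.chr l j m * hG.chr m i k)) y = _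
  rw [sum_coe]
  rfl

include hG in
theorem riemann_lowered_skew {y : Euc n} (hy : y ∈ U) (i j k l : Fin n) :
    ∑ m, riemann G m i j k y * G y m l = - ∑ m, riemann G m i j l y * G y m k := by
  have h0 := riem_lowered_skew (d := partialD (U := U)) (g := hG.coeff) (Γ := hG.chr)
    partialD_comm hG.coeff_symm hG.partialD_coeff i j k l
  have h := congrArg (eval ⟨y, hy⟩) h0
  simp only [map_sum, map_neg, map_mul, eval_apply, riem_apply] at h
  exact h

end IsMetricOn

/-! ### Constant sectional curvature determines the curvature tensor -/

/-- A curvature-like multiadditive function whose sectional values vanish is zero. -/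
theorem eq_zero_of_sectional_eq_zero {V : Type*} [AddCommGroup V] {K : V → V → V → V → ℝ}
    (a1 : ∀ u u' v w z, K (u + u') v w z = K u v w z + K u' v w z)
    (a2 : ∀ u v v' w z, K u (v + v') w z = K u v w z + K u v' w z)
    (a3 : ∀ u v w w' z, K u v (w + w') z = K u v w z + K u v w' z)
    (a4 : ∀ u v w z z', K u v w (z + z') = K u v w z + K u v w z')
    (h12 : ∀ u v w z, K u v w z = - K v u w z) (h34 : ∀ u v w z, K u v w z = - K u v z w)
    (hB : ∀ u v w z, K u v w z + K v w u z + K w u v z = 0) (h0 : ∀ u v, K u v v u = 0)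
    (u v w z : V) : K u v w z = 0 := by
  have pair_symm : ∀ u v w z, K u v w z = K w z u v := fun u v w z => by
    linarith [hB u v w z, hB v w z u, hB w z u v, hB z u v w, h12 u v w z, h34 u v w z,
      h12 v w u z, h34 v w u z, h12 w u v z, h34 w u v z, h12 v w z u, h34 v w z u, h12 w z v u,
      h34 w z v u, h12 z v w u, h34 z v w u, h12 w z u v, h34 w z u v, h12 z u w v, h34 z u w v,
      h12 u w z v, h34 u w z v, h12 z u v w, h34 z u v w, h12 u v z w, h34 u v z w, h12 v z u w,
      h34 v z u w]
  have h1 : ∀ u v w, K u v v w = 0 := fun u v w => by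
    have h := h0 (u + w) v
    rw [a1, a4, a4, h0, h0] at h
    linarith [pair_symm w v v u, h12 v u w v, h34 u v w v]
  have h2 : ∀ u v w z, K u v w z = - K u w v z := fun u v w z => by
    have h := h1 u (v + w) z
    rw [a2, a3, a3, h1, h1] at h
    linarith
  linarith [hB u v w z, h2 v w u z, h12 v u w z, h2 w u v z, h12 w u v z, h2 u w v z]

/-- Functions given by a polynomial. -/
def IsPoly (f : ℝ → ℝ) : Prop := ∃ P : Polynomial ℝ, ∀ t, f t = P.eval t

namespace IsPoly

theorem const (r : ℝ) : IsPoly fun _ => r := ⟨Polynomial.C r, fun t => by simp⟩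

theorem mul {f g : ℝ → ℝ} (hf : IsPoly f) (hg : IsPoly g) : IsPoly fun t => f t * g t := by
  obtain ⟨P, hP⟩ := hf
  obtain ⟨Q, hQ⟩ := hg
  exact ⟨P * Q, fun t => by simp [hP, hQ]⟩

theorem sub {f g : ℝ → ℝ} (hf : IsPoly f) (hg : IsPoly g) : IsPoly fun t => f t - g t := by
  obtain ⟨P, hP⟩ := hf
  obtain ⟨Q, hQ⟩ := hg
  exact ⟨P - Q, fun t => by simp [hP, hQ]⟩

theorem sum {ι : Type*} {s : Finset ι} {f : ι → ℝ → ℝ} (hf : ∀ i, IsPoly (f i)) :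
    IsPoly fun t => ∑ i ∈ s, f i t := by
  choose P hP using hf
  exact ⟨∑ i ∈ s, P i, fun t => by simp [hP, Polynomial.eval_finsetSum]⟩

theorem affine (a b : ℝ) : IsPoly fun t => a + t * b :=
  ⟨Polynomial.C a + Polynomial.X * Polynomial.C b, fun t => by simp; ring⟩

theorem eq_zero_of_mul_eq_zero {f g : ℝ → ℝ} (hf : IsPoly f) (hg : IsPoly g)
    (h : ∀ t, f t * g t = 0) {t₀ : ℝ} (h₀ : f t₀ ≠ 0) (t : ℝ) : g t = 0 := by
  obtain ⟨P, hP⟩ := hf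
  obtain ⟨Q, hQ⟩ := hg
  have hPQ : P * Q = 0 := Polynomial.funext fun t => by
    rw [Polynomial.eval_mul, ← hP, ← hQ, h, Polynomial.eval_zero]
  rcases mul_eq_zero.1 hPQ with h1 | h1
  · exact absurd (by rw [hP, h1, Polynomial.eval_zero]) h₀
  · rw [hQ, h1, Polynomial.eval_zero]

end IsPoly

section

variable {n : ℕ} {G : Euc n → Matrix (Fin n) (Fin n) ℝ} {y : Euc n}

theorem curvature_eq_sum (u v w z : Fin n → ℝ) : curvature G y u v w z
    = ∑ i, ∑ j, ∑ k, ∑ l, (∑ m, riemann G m i j k y * G y m l) * u i * v j * w k * z l := by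
  simp only [curvature, pair, curvatureVec, Finset.mul_sum, Finset.sum_mul]
  simp only [← Fintype.sum_prod_type']
  refine Fintype.sum_equiv ⟨fun ⟨m, l, i, j, k⟩ => (i, j, k, l, m),
    fun ⟨i, j, k, l, m⟩ => (m, l, i, j, k), fun _ => rfl, fun _ => rfl⟩ _ _ fun x => ?_
  simp only [Equiv.coe_fn_mk]
  ring

/-- Density of the nondegenerate planes: the identity between the curvature and the Gram
determinant extends from them to all pairs of vectors, since on a line of pairs both sides are
polynomials. -/
theorem curvature_eq_mul_gram {c : ℝ} (hne : ∃ u v, gram G y u v ≠ 0)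
    (h : ∀ u v, gram G y u v ≠ 0 → sectional G y u v = c) (u v : Fin n → ℝ) :
    curvature G y u v v u = c * gram G y u v := by
  obtain ⟨u₀, v₀, h₀⟩ := hne
  have hp : ∀ a b : ℝ, IsPoly fun t => a + t * b := IsPoly.affine
  have hpair : ∀ u u' v v' : Fin n → ℝ, IsPoly fun t => pair (G y) (u + t • u') (v + t • v') :=
    fun u u' v v' => IsPoly.sum fun i => IsPoly.sum fun j =>
      ((IsPoly.const _).mul (hp (u i) (u' i))).mul (hp (v j) (v' j))
  have hgram : IsPoly fun t => gram G y (u₀ + t • (u - u₀)) (v₀ + t • (v - v₀)) := by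
    simp only [gram, sq]
    exact ((hpair _ _ _ _).mul (hpair _ _ _ _)).sub ((hpair _ _ _ _).mul (hpair _ _ _ _))
  have hcurv : IsPoly fun t => curvature G y (u₀ + t • (u - u₀)) (v₀ + t • (v - v₀))
      (v₀ + t • (v - v₀)) (u₀ + t • (u - u₀)) := by
    simp only [curvature_eq_sum]
    exact IsPoly.sum fun i => IsPoly.sum fun j => IsPoly.sum fun k => IsPoly.sum fun l =>
      ((((IsPoly.const _).mul (hp (u₀ i) _)).mul (hp (v₀ j) _)).mul (hp (v₀ k) _)).mul
        (hp (u₀ l) _)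
  have h1 := hgram.eq_zero_of_mul_eq_zero (hcurv.sub ((IsPoly.const c).mul hgram)) (fun t => by
    by_cases ht : gram G y (u₀ + t • (u - u₀)) (v₀ + t • (v - v₀)) = 0
    · rw [ht, zero_mul]
    · have := h _ _ ht
      rw [sectional, div_eq_iff ht] at this
      rw [this, sub_self, mul_zero]) (t₀ := 0) (by simpa using h₀) 1
  simp only [one_smul, add_sub_cancel] at h1
  linarith

/-- The curvature tensor of a metric of constant sectional curvature. The case of dimension at most
one, where there are no planes, is included. -/
theorem IsMetricOn.riemann_eq {U : Opens (Euc n)} (hG : IsMetricOn U G) (hy : y ∈ U) {c : ℝ}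
    (hne : Subsingleton (Fin n) ∨ ∃ u v, gram G y u v ≠ 0)
    (h : ∀ u v, gram G y u v ≠ 0 → sectional G y u v = c) (l i j k : Fin n) :
    riemann G l i j k y
      = c * (G y j k * (if l = i then 1 else 0) - G y i k * (if l = j then 1 else 0)) := by
  rcases hne with hn | hne
  · have h1 := riemann_skew (G := G) (y := y) l i j k
    obtain rfl := Subsingleton.elim i j
    rw [sub_self, mul_zero]
    linarith
  -- `κ` is the difference of the two sides with the index lowered, `K` the multilinear form with
  -- these components.
  set κ : Fin n → Fin n → Fin n → Fin n → ℝ := fun i j k l =>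
    ∑ m, riemann G m i j k y * G y m l - c * (G y j k * G y i l - G y i k * G y j l) with hκ
  set K : (Fin n → ℝ) → (Fin n → ℝ) → (Fin n → ℝ) → (Fin n → ℝ) → ℝ := fun u v w z =>
    ∑ i, ∑ j, ∑ k, ∑ l, κ i j k l * u i * v j * w k * z l with hK
  have κ12 : ∀ i j k l, κ i j k l = - κ j i k l := fun i j k l => by
    simp only [hκ]
    rw [Finset.sum_congr rfl fun m _ => by rw [riemann_skew m i j k, neg_mul],
      Finset.sum_neg_distrib]
    ring
  have κ34 : ∀ i j k l, κ i j k l = - κ i j l k := fun i j k l => by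
    simp only [hκ]
    rw [hG.riemann_lowered_skew hy i j k l]
    ring
  have κB : ∀ i j k l, κ i j k l + κ j k i l + κ k i j l = 0 := fun i j k l => by
    have hb : ∑ m, riemann G m i j k y * G y m l + ∑ m, riemann G m j k i y * G y m l
        + ∑ m, riemann G m k i j y * G y m l = 0 := by
      rw [← Finset.sum_add_distrib, ← Finset.sum_add_distrib]
      exact Finset.sum_eq_zero fun m _ => by
        rw [← add_mul, ← add_mul, riemann_bianchi hG.symm, zero_mul]
    simp only [hκ]
    rw [hG.symm y k i, hG.symm y j i, hG.symm y k j]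
    linear_combination hb
  have hK0 : ∀ u v w z, K u v w z = 0 := by
    refine eq_zero_of_sectional_eq_zero ?_ ?_ ?_ ?_ ?_ ?_ ?_ ?_
    · intros; simp only [hK, Pi.add_apply, mul_add, add_mul, Finset.sum_add_distrib]
    · intros; simp only [hK, Pi.add_apply, mul_add, add_mul, Finset.sum_add_distrib]
    · intros; simp only [hK, Pi.add_apply, mul_add, add_mul, Finset.sum_add_distrib]
    · intros; simp only [hK, Pi.add_apply, mul_add, Finset.sum_add_distrib]
    · intro u v w z
      simp only [hK, ← Finset.sum_neg_distrib]
      rw [Finset.sum_comm]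
      exact Finset.sum_congr rfl fun i _ => Finset.sum_congr rfl fun j _ =>
        Finset.sum_congr rfl fun k _ => Finset.sum_congr rfl fun l _ => by rw [κ12]; ring
    · intro u v w z
      simp only [hK, ← Finset.sum_neg_distrib]
      refine Finset.sum_congr rfl fun i _ => Finset.sum_congr rfl fun j _ => ?_
      rw [Finset.sum_comm]
      exact Finset.sum_congr rfl fun k _ => Finset.sum_congr rfl fun l _ => by rw [κ34]; ring
    · intro u v w z
      have e1 : K v w u z = ∑ i, ∑ j, ∑ k, ∑ l, κ j k i l * u i * v j * w k * z l := by
        simp only [hK, ← Fintype.sum_prod_type']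
        refine Fintype.sum_equiv ⟨fun ⟨j, k, i, l⟩ => (i, j, k, l),
            fun ⟨i, j, k, l⟩ => (j, k, i, l),
          fun _ => rfl, fun _ => rfl⟩ _ _ fun x => ?_
        simp only [Equiv.coe_fn_mk]
        ring
      have e2 : K w u v z = ∑ i, ∑ j, ∑ k, ∑ l, κ k i j l * u i * v j * w k * z l := by
        simp only [hK, ← Fintype.sum_prod_type']
        refine Fintype.sum_equiv ⟨fun ⟨k, i, j, l⟩ => (i, j, k, l),
            fun ⟨i, j, k, l⟩ => (k, i, j, l),
          fun _ => rfl, fun _ => rfl⟩ _ _ fun x => ?_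
        simp only [Equiv.coe_fn_mk]
        ring
      rw [e1, e2]
      simp only [hK, ← Finset.sum_add_distrib, ← add_mul, κB, zero_mul, Finset.sum_const_zero]
    · intro u v
      have hg : ∑ i, ∑ j, ∑ k, ∑ l, c * (G y j k * G y i l - G y i k * G y j l)
          * u i * v j * v k * u l = c * gram G y u v := by
        have g1 : pair (G y) u u * pair (G y) v v
            = ∑ i, ∑ j, ∑ k, ∑ l, G y j k * G y i l * u i * v j * v k * u l := by
          simp only [pair, Finset.sum_mul_sum]
          simp only [← Fintype.sum_prod_type']
          refine Fintype.sum_equiv ⟨fun ⟨i, j, l, k⟩ => (i, j, k, l),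
              fun ⟨i, j, k, l⟩ => (i, j, l, k),
            fun _ => rfl, fun _ => rfl⟩ _ _ fun x => ?_
          simp only [Equiv.coe_fn_mk]
          ring
        have g2 : pair (G y) u v * pair (G y) u v
            = ∑ i, ∑ j, ∑ k, ∑ l, G y i k * G y j l * u i * v j * v k * u l := by
          simp only [pair, Finset.sum_mul_sum]
          simp only [← Fintype.sum_prod_type']
          refine Fintype.sum_equiv ⟨fun ⟨i, l, k, j⟩ => (i, j, k, l),
              fun ⟨i, j, k, l⟩ => (i, l, k, j),
            fun _ => rfl, fun _ => rfl⟩ _ _ fun x => ?_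
          simp only [Equiv.coe_fn_mk]
          rw [hG.symm y x.2.1]
          ring
        rw [gram, sq, g1, g2]
        simp only [← Finset.sum_sub_distrib, Finset.mul_sum]
        exact Finset.sum_congr rfl fun _ _ => Finset.sum_congr rfl fun _ _ =>
          Finset.sum_congr rfl fun _ _ => Finset.sum_congr rfl fun _ _ => by ring
      have := curvature_eq_mul_gram hne h u v
      rw [curvature_eq_sum, ← hg] at this
      simp only [hK, hκ, sub_mul, Finset.sum_sub_distrib]
      linarith
  have hκ0 : ∀ i j k l, κ i j k l = 0 := fun i j k l => by
    have := hK0 (Pi.single i 1) (Pi.single j 1) (Pi.single k 1) (Pi.single l 1)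
    simpa [hK, Pi.single_apply] using this
  have hinv : ∀ m m', ∑ l, G y m l * (G y)⁻¹ l m' = if m = m' then 1 else 0 := fun m m' => by
    rw [← Matrix.mul_apply, Matrix.mul_nonsing_inv _ (hG.isUnit_det y hy), Matrix.one_apply]
  have h1 : ∑ l', (∑ m, riemann G m i j k y * G y m l') * (G y)⁻¹ l' l = riemann G l i j k y := by
    simp only [Finset.sum_mul, mul_assoc]
    rw [Finset.sum_comm]
    simp only [← Finset.mul_sum, hinv]
    simp
  have h2 : ∀ l', ∑ m, riemann G m i j k y * G y m l'
      = c * (G y j k * G y i l' - G y i k * G y j l') := fun l' => sub_eq_zero.1 (hκ0 i j k l')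
  rw [← h1]
  simp only [h2, mul_assoc, sub_mul, ← Finset.mul_sum, Finset.sum_sub_distrib,
      hinv, eq_comm (a := l)]

end

/-! ### The connection pulled back along a map -/

section Pullback

variable {ι κ A : Type*} [Fintype κ] [CommRing A]
  {g : κ → κ → A} {Γ : κ → κ → κ → A} {T : ι → κ → A} {c : A}

/-- The matrix `Γᵃ_{bd} T_iᵇ` of the connection with coefficients `Γ`, pulled back along a map with
derivative `T`. -/
def connForm (Γ : κ → κ → κ → A) (T : ι → κ → A) (i : ι) (a d : κ) : A := ∑ b, Γ a b d * T i b

/-- The bilinear form with coefficients `g`. -/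
def bilin (g : κ → κ → A) : (κ → A) →ₗ[A] (κ → A) →ₗ[A] A :=
  LinearMap.mk₂ _ (fun W W' => ∑ a, ∑ b, g a b * W a * W' b)
    (by intros; simp [mul_add, add_mul, Finset.sum_add_distrib])
    (by intros; simp [Finset.mul_sum, mul_left_comm, mul_assoc])
    (by intros; simp [mul_add, Finset.sum_add_distrib])
    (by intros; simp [Finset.mul_sum, mul_left_comm])

theorem bilin_apply (W W' : κ → A) : bilin g W W' = ∑ a, ∑ b, g a b * W a * W' b := rfl

theorem bilin_symm (hg : ∀ a b, g a b = g b a) (W W' : κ → A) : bilin g W W' = bilin g W' W := by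
  rw [bilin_apply, bilin_apply, Finset.sum_comm]
  exact Finset.sum_congr rfl fun a _ => Finset.sum_congr rfl fun b _ => by rw [hg]; ring

variable [Algebra ℝ A] {d : ι → Derivation ℝ A A}

/-- The covariant derivative of vector fields along a map. -/
def pullD (d : ι → Derivation ℝ A A) (Γ : κ → κ → κ → A) (T : ι → κ → A) (i : ι) :
    (κ → A) →+ (κ → A) where
  toFun W a := d i (W a) + ∑ e, connForm Γ T i a e * W e
  map_zero' := by ext; simp
  map_add' W W' := by
    funext a
    simp only [Pi.add_apply, map_add, mul_add, Finset.sum_add_distrib]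
    ring

theorem pullD_apply (i : ι) (W : κ → A) (a : κ) :
    pullD d Γ T i W a = d i (W a) + ∑ e, connForm Γ T i a e * W e := rfl

theorem isConnection_pullD : IsConnection d (pullD d Γ T) := by
  intro i a W
  funext x
  simp only [pullD_apply, Pi.smul_apply, Pi.add_apply, smul_eq_mul, Derivation.leibniz, mul_add,
    Finset.mul_sum, mul_left_comm a]
  ring

theorem isMetricConnection_pullD (hg : ∀ i a b, d i (g a b)
      = ∑ e, T i e * (∑ l, Γ l e a * g l b + ∑ l, Γ l e b * g a l)) :
    IsMetricConnection d (pullD d Γ T) (bilin g) := by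
  have hg' : ∀ i a b, d i (g a b)
      = ∑ l, connForm Γ T i l a * g l b + ∑ l, connForm Γ T i l b * g a l := fun i a b => by
    rw [hg]
    simp only [connForm, mul_add, Finset.mul_sum, Finset.sum_mul, Finset.sum_add_distrib]
    congr 1
    all_goals
      rw [Finset.sum_comm]
      exact Finset.sum_congr rfl fun _ _ => Finset.sum_congr rfl fun _ _ => by ring
  intro i W W'
  simp only [bilin_apply, map_sum, Derivation.leibniz, smul_eq_mul, hg', pullD_apply]
  have e1 : ∑ a, ∑ b, W' b * (W a * ∑ l, connForm Γ T i l a * g l b)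
      = ∑ a, ∑ b, g a b * (∑ e, connForm Γ T i a e * W e) * W' b := by
    simp only [Finset.mul_sum, Finset.sum_mul]
    simp only [← Fintype.sum_prod_type']
    refine Fintype.sum_equiv ⟨fun ⟨a, b, l⟩ => (l, b, a), fun ⟨l, b, a⟩ => (a, b, l),
      fun _ => rfl, fun _ => rfl⟩ _ _ fun x => ?_
    simp only [Equiv.coe_fn_mk]
    ring
  have e2 : ∑ a, ∑ b, W' b * (W a * ∑ l, connForm Γ T i l b * g a l)
      = ∑ a, ∑ b, g a b * W a * (∑ e, connForm Γ T i b e * W' e) := by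
    simp only [Finset.mul_sum]
    simp only [← Fintype.sum_prod_type']
    refine Fintype.sum_equiv ⟨fun ⟨a, b, l⟩ => (a, l, b), fun ⟨a, l, b⟩ => (a, b, l),
      fun _ => rfl, fun _ => rfl⟩ _ _ fun x => ?_
    simp only [Equiv.coe_fn_mk]
    ring
  simp only [mul_add, add_mul, Finset.sum_add_distrib, e1, e2]
  have e3 : ∑ a, ∑ b, W' b * (g a b * d i (W a)) = ∑ a, ∑ b, g a b * d i (W a) * W' b :=
    Finset.sum_congr rfl fun _ _ => Finset.sum_congr rfl fun _ _ => by ring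
  rw [e3]
  ring

/-- The pulled back connection is torsion-free. -/
theorem pullD_torsion (hΓ : ∀ a b e, Γ a b e = Γ a e b) (hT : ∀ i j a, d i (T j a) = d j (T i a))
    (i j : ι) : pullD d Γ T i (T j) = pullD d Γ T j (T i) := by
  funext a
  simp only [pullD_apply, hT i j]
  congr 1
  simp only [connForm, Finset.sum_mul]
  rw [Finset.sum_comm]
  exact Finset.sum_congr rfl fun e _ => Finset.sum_congr rfl fun b _ => by rw [hΓ]; ring

/-- The curvature of the pulled back connection is the pullback of the curvature; `Γ'` stands for
the partial derivatives of `Γ`. -/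
theorem curvature_connForm {Γ' : κ → κ → κ → κ → A}
    (hΓ' : ∀ i a f e, d i (Γ a f e) = ∑ b, T i b * Γ' b a f e)
    (hT : ∀ i j a, d i (T j a) = d j (T i a)) (i j : ι) (a x : κ) :
    d i (connForm Γ T j a x) - d j (connForm Γ T i a x)
      + ∑ m, (connForm Γ T i a m * connForm Γ T j m x - connForm Γ T j a m * connForm Γ T i m x)
      = ∑ e, ∑ f, T i e * T j f * (Γ' e a f x - Γ' f a e x
          + ∑ m, (Γ a e m * Γ m f x - Γ a f m * Γ m e x)) := by
  have hω : ∀ i j, d i (connForm Γ T j a x)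
      = ∑ e, ∑ f, T i e * T j f * Γ' e a f x + ∑ f, Γ a f x * d i (T j f) := fun i j => by
    simp only [connForm, map_sum, Derivation.leibniz, smul_eq_mul, Finset.sum_add_distrib, hΓ',
      Finset.mul_sum]
    rw [add_comm]
    congr 1
    rw [Finset.sum_comm]
    exact Finset.sum_congr rfl fun _ _ => Finset.sum_congr rfl fun _ _ => by ring
  have hq : ∀ i j, ∑ m, connForm Γ T i a m * connForm Γ T j m x
      = ∑ e, ∑ f, T i e * T j f * ∑ m, Γ a e m * Γ m f x :=
    fun i j => by
      simp only [connForm, Finset.sum_mul_sum]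
      simp only [Finset.mul_sum]
      simp only [← Fintype.sum_prod_type']
      refine Fintype.sum_equiv ⟨fun ⟨m, e, f⟩ => (e, f, m), fun ⟨e, f, m⟩ => (m, e, f),
        fun _ => rfl, fun _ => rfl⟩ _ _ fun x => ?_
      simp only [Equiv.coe_fn_mk]
      ring
  have hs : ∀ X : κ → κ → A, ∑ e, ∑ f, T j e * T i f * X e f = ∑ e, ∑ f, T i e * T j f * X f e :=
    fun X => by
      rw [Finset.sum_comm]
      exact Finset.sum_congr rfl fun _ _ => Finset.sum_congr rfl fun _ _ => by ring
  rw [hω, hω, Finset.sum_sub_distrib, hq, hq, hs, hs]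
  simp only [hT j i, mul_add, mul_sub, Finset.sum_add_distrib, Finset.sum_sub_distrib]
  ring

/-- The curvature of the pulled back connection, for an ambient space of constant curvature `c`;
again `Γ'` stands for the partial derivatives of `Γ`. -/
theorem pullD_curvature [DecidableEq κ] (hd : ∀ i j a, d i (d j a) = d j (d i a))
    {Γ' : κ → κ → κ → κ → A} (hΓ' : ∀ i a f e, d i (Γ a f e) = ∑ b, T i b * Γ' b a f e)
    (hT : ∀ i j a, d i (T j a) = d j (T i a))
    (hR : ∀ a e f x, Γ' e a f x - Γ' f a e x + ∑ m, (Γ a e m * Γ m f x - Γ a f m * Γ m e x)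
      = c * (g f x * (if a = e then 1 else 0) - g e x * (if a = f then 1 else 0)))
    (i j : ι) (W : κ → A) : pullD d Γ T i (pullD d Γ T j W) - pullD d Γ T j (pullD d Γ T i W)
      = (c * bilin g (T j) W) • T i - (c * bilin g (T i) W) • T j := by
  funext a
  have h1 : ∀ i j, pullD d Γ T i (pullD d Γ T j W) a = d i (d j (W a))
      + ∑ e, connForm Γ T j a e * d i (W e) + ∑ e, connForm Γ T i a e * d j (W e)
      + ∑ e, (d i (connForm Γ T j a e) + ∑ m, connForm Γ T i a m * connForm Γ T j m e) * W e := by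
    intro i j
    simp only [pullD_apply, map_add, map_sum, Derivation.leibniz, smul_eq_mul, mul_add, add_mul,
      Finset.sum_add_distrib, Finset.mul_sum, Finset.sum_mul]
    rw [Finset.sum_comm (f := fun e m => connForm Γ T i a m * connForm Γ T j m e * W e)]
    simp only [mul_comm (W _), mul_assoc]
    ring
  have h2 : pullD d Γ T i (pullD d Γ T j W) a - pullD d Γ T j (pullD d Γ T i W) a
      = ∑ e, (d i (connForm Γ T j a e) - d j (connForm Γ T i a e)
        + ∑ m, (connForm Γ T i a m * connForm Γ T j m e
          - connForm Γ T j a m * connForm Γ T i m e)) * W e := by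
    rw [h1, h1, hd i j]
    simp only [Finset.sum_sub_distrib, add_mul, sub_mul, Finset.sum_add_distrib]
    ring
  have h3 : ∀ x, ∑ e, ∑ f, T i e * T j f *
      (c * (g f x * (if a = e then 1 else 0) - g e x * (if a = f then 1 else 0)))
      = c * (∑ f, g f x * T j f) * T i a - c * (∑ f, g f x * T i f) * T j a := by
    intro x
    have e1 : ∑ e, ∑ f, T i e * T j f * (c * (g f x * (if a = e then 1 else 0)))
        = c * (∑ f, g f x * T j f) * T i a := by
      simp only [mul_ite, mul_one, mul_zero, Finset.sum_ite_irrel, Finset.sum_const_zero,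
        Finset.sum_ite_eq, Finset.mem_univ, if_true, Finset.mul_sum, Finset.sum_mul]
      exact Finset.sum_congr rfl fun _ _ => by ring
    have e2 : ∑ e, ∑ f, T i e * T j f * (c * (g e x * (if a = f then 1 else 0)))
        = c * (∑ f, g f x * T i f) * T j a := by
      simp only [mul_ite, mul_one, mul_zero, Finset.sum_ite_eq, Finset.mem_univ, if_true,
        Finset.mul_sum, Finset.sum_mul]
      exact Finset.sum_congr rfl fun _ _ => by ring
    simp only [mul_sub, Finset.sum_sub_distrib, e1, e2]
  have h4 : ∀ i, ∑ x, (∑ f, g f x * T i f) * W x = bilin g (T i) W := fun i => by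
    rw [bilin_apply, Finset.sum_comm]
    simp only [Finset.sum_mul]
  rw [Pi.sub_apply, h2]
  simp only [curvature_connForm hΓ' hT, hR, h3]
  simp only [Pi.sub_apply, Pi.smul_apply, smul_eq_mul, ← h4,
    sub_mul, Finset.sum_sub_distrib, Finset.mul_sum, Finset.sum_mul]
  congr 1
  all_goals
    exact Finset.sum_congr rfl fun _ _ => Finset.sum_congr rfl fun _ _ => by ring

end Pullback

/-! ### The calculus of an immersion in coordinates -/

/-- A smooth map `F` between coordinate domains, with ambient metric `G` of constant curvature `c`
and nondegenerate induced metric `γ`. The tensor of an ambient metric of constant curvature is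
prescribed, which also covers an ambient space without tangent planes. -/
structure IsImmersionOn {p n : ℕ} (U : Opens (Euc p)) (V : Opens (Euc n))
    (G : Euc n → Matrix (Fin n) (Fin n) ℝ) (γ : Euc p → Matrix (Fin p) (Fin p) ℝ)
    (F : Euc p → Euc n) (c : ℝ) : Prop where
  ambient : IsMetricOn V G
  metric : IsMetricOn U γ
  smooth : ContDiffOn ℝ ∞ F U
  mapsTo : Set.MapsTo F U V
  induced : ∀ y ∈ U, ∀ i j, γ y i j = pair (G (F y)) (tangentVec F i y) (tangentVec F j y)
  curvature : ∀ z ∈ V, ∀ l i j k, riemann G l i j k z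
    = c * (G z j k * (if l = i then 1 else 0) - G z i k * (if l = j then 1 else 0))

namespace IsImmersionOn

open smoothRing

variable {p n : ℕ} {U : Opens (Euc p)} {V : Opens (Euc n)}
  {G : Euc n → Matrix (Fin n) (Fin n) ℝ} {γ : Euc p → Matrix (Fin p) (Fin p) ℝ}
  {F : Euc p → Euc n} {c : ℝ} (h : IsImmersionOn U V G γ F c)

/-- The coordinate vector field `∂_i F`. -/
def T (i : Fin p) (a : Fin n) : smoothRing U := partialD i (component F h.smooth a)

/-- The ambient metric along the immersion. -/
def coeffAlong (a b : Fin n) : smoothRing U := pullback F h.smooth h.mapsTo (h.ambient.coeff a b)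

/-- The ambient Christoffel symbols along the immersion. -/
def chrAlong (a b e : Fin n) : smoothRing U :=
  pullback F h.smooth h.mapsTo (h.ambient.chr a b e)

theorem partialD_T (i j : Fin p) (a : Fin n) : partialD i (h.T j a) = partialD j (h.T i a) :=
  partialD_comm i j _

theorem coeffAlong_symm (a b : Fin n) : h.coeffAlong a b = h.coeffAlong b a := by
  rw [coeffAlong, coeffAlong, h.ambient.coeff_symm]

theorem chrAlong_symm (a b e : Fin n) : h.chrAlong a b e = h.chrAlong a e b := by
  rw [chrAlong, chrAlong, h.ambient.chr_symm]

theorem partialD_coeffAlong (i : Fin p) (a b : Fin n) : partialD i (h.coeffAlong a b)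
    = ∑ e, h.T i e * (∑ l, h.chrAlong l e a * h.coeffAlong l b
      + ∑ l, h.chrAlong l e b * h.coeffAlong a l) := by
  rw [coeffAlong, partialD_pullback]
  refine Finset.sum_congr rfl fun e _ => ?_
  rw [h.ambient.partialD_coeff, map_add, map_sum, map_sum]
  simp only [map_mul]
  rfl

theorem partialD_chrAlong (i : Fin p) (a f e : Fin n) : partialD i (h.chrAlong a f e)
    = ∑ b, h.T i b * pullback F h.smooth h.mapsTo (partialD b (h.ambient.chr a f e)) :=
  partialD_pullback h.smooth h.mapsTo i _

/-- A real constant as a smooth function. -/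
def const (U : Opens (Euc p)) (c : ℝ) : smoothRing U := algebraMap ℝ _ c

theorem curvature_along (a e f x : Fin n) :
    pullback F h.smooth h.mapsTo (partialD e (h.ambient.chr a f x))
      - pullback F h.smooth h.mapsTo (partialD f (h.ambient.chr a e x))
      + ∑ m, (h.chrAlong a e m * h.chrAlong m f x - h.chrAlong a f m * h.chrAlong m e x)
      = const U c * (h.coeffAlong f x * (if a = e then 1 else 0)
        - h.coeffAlong e x * (if a = f then 1 else 0)) := by
  have h1 : riem partialD h.ambient.chr a e f x = const V c *
      (h.ambient.coeff f x * (if a = e then 1 else 0)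
        - h.ambient.coeff e x * (if a = f then 1 else 0)) := by
    refine smoothRing.ext fun z => ?_
    rw [IsMetricOn.riem_apply, h.curvature z z.2]
    split_ifs <;> rfl
  have h2 : pullback F h.smooth h.mapsTo (const V c) = const U c :=
    smoothRing.ext fun y => by rw [pullback_apply]; rfl
  have h3 := congrArg (pullback F h.smooth h.mapsTo) h1
  rw [riem, map_mul, h2, map_add, map_sub, map_sub, map_mul, map_mul, map_sum] at h3
  simp only [map_sub, map_mul] at h3
  refine h3.trans ?_
  split_ifs <;> simp only [map_one, map_zero] <;> rfl

theorem bilin_apply_apply (W W' : Fin n → smoothRing U) (y : U) :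
    bilin h.coeffAlong W W' y = pair (G (F y)) (fun a => W a y) (fun a => W' a y) := by
  rw [bilin_apply, sum_coe]
  refine Finset.sum_congr rfl fun a _ => ?_
  rw [sum_coe]
  refine Finset.sum_congr rfl fun b _ => ?_
  change h.coeffAlong a b y * W a y * W' b y = _
  rw [coeffAlong, pullback_apply]
  rfl

theorem T_apply (i : Fin p) (y : U) : (fun a => h.T i a y) = tangentVec F i y := by
  funext a
  exact partialD_apply (fun _ => rfl) i y

theorem bilin_T (i j : Fin p) : bilin h.coeffAlong (h.T i) (h.T j) = h.metric.coeff i j := by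
  refine smoothRing.ext fun y => ?_
  rw [bilin_apply_apply, T_apply, T_apply]
  exact (h.induced y y.2 i j).symm

/-- The calculus of vector fields along the immersion. -/
def toCalculus : ImmersionCalculus (Fin p) (smoothRing U) (Fin n → smoothRing U) where
  d := partialD
  D := pullD partialD h.chrAlong h.T
  ip := bilin h.coeffAlong
  T := h.T
  s := h.metric.inv
  Γ := h.metric.chr
  c := const U c
  conn := isConnection_pullD
  metric := isMetricConnection_pullD h.partialD_coeffAlong
  ip_symm := bilin_symm h.coeffAlong_symm
  torsion := pullD_torsion h.chrAlong_symm h.partialD_T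
  curv := pullD_curvature partialD_comm h.partialD_chrAlong h.partialD_T h.curvature_along
  Γ_symm := h.metric.chr_symm
  Γ_metric k i j := by simp only [bilin_T]; exact h.metric.partialD_coeff k i j
  s_symm i j := smoothRing.ext fun y => by
    change (γ y)⁻¹ i j = (γ y)⁻¹ j i
    have : (γ y).transpose = γ y := Matrix.ext fun i j => h.metric.symm y j i
    conv_lhs => rw [← this, ← Matrix.transpose_nonsing_inv]
    rfl
  s_inv i j := smoothRing.ext fun y => by
    simp only [bilin_T]
    rw [sum_coe]
    change ∑ k, (γ y)⁻¹ i k * γ y k j = _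
    rw [← Matrix.mul_apply, Matrix.nonsing_inv_mul _ (h.metric.isUnit_det y y.2), Matrix.one_apply]
    split_ifs <;> rfl

end IsImmersionOn

/-! ### Geometric quantities in terms of the calculus -/

namespace ImmersionCalculus

variable {ι A E : Type*} [Fintype ι] [DecidableEq ι] [CommRing A] [Algebra ℝ A]
    [AddCommGroup E] [Module A E] (S : ImmersionCalculus ι A E)

/-- The normal component of an ambient field. -/
def proj (W : E) : E := W - ∑ k, ∑ l, (S.s k l * S.ip W (S.T l)) • S.T k

theorem ip_proj_T (W : E) (m : ι) : S.ip (S.proj W) (S.T m) = 0 := by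
  have h : ∑ k, (∑ l, S.s k l * S.ip W (S.T l)) * S.ip (S.T k) (S.T m) = S.ip W (S.T m) := by
    simp only [Finset.sum_mul]
    rw [Finset.sum_comm]
    have : ∀ l, ∑ k, S.s k l * S.ip W (S.T l) * S.ip (S.T k) (S.T m)
        = S.ip W (S.T l) * (if l = m then 1 else 0) := fun l => by
      rw [← S.s_inv, Finset.mul_sum]
      exact Finset.sum_congr rfl fun k _ => by rw [S.s_symm k l]; ring
    simp [this]
  simp only [proj, map_sub, LinearMap.sub_apply, map_sum, LinearMap.sum_apply, map_smul,
    LinearMap.smul_apply, smul_eq_mul, ← Finset.sum_mul]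
  rw [h, sub_self]

theorem ip_proj_proj (W W' : E) : S.ip (S.proj W) (S.proj W')
    = S.ip W W' - ∑ k, ∑ l, S.s k l * (S.ip W (S.T k) * S.ip W' (S.T l)) := by
  have h1 : S.ip (S.proj W) (S.proj W') = S.ip (S.proj W) W' := by
    conv_lhs => rw [proj.eq_def S W']
    simp [ip_proj_T]
  rw [h1, proj]
  simp only [map_sub, LinearMap.sub_apply, map_sum, LinearMap.sum_apply, map_smul,
    LinearMap.smul_apply, smul_eq_mul]
  rw [Finset.sum_comm]
  congr 1
  exact Finset.sum_congr rfl fun k _ => Finset.sum_congr rfl fun l _ => by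
    rw [S.s_symm, S.ip_symm (S.T l)]; ring

theorem proj_add_tangential {N : E} (hN : ∀ m, S.ip N (S.T m) = 0) (x : ι → A) :
    S.proj (N + ∑ k, x k • S.T k) = N := by
  have h : ∀ k, ∑ l, S.s k l * S.ip (N + ∑ m, x m • S.T m) (S.T l) = x k := fun k => by
    rw [← S.s_mul_contract k x]
    simp [hN]
  simp only [proj, ← Finset.sum_smul, h]
  abel

theorem proj_normal {N : E} (hN : ∀ m, S.ip N (S.T m) = 0) : S.proj N = N := by
  simpa using S.proj_add_tangential hN 0

theorem proj_sub (W W' : E) : S.proj (W - W') = S.proj W - S.proj W' := by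
  simp only [proj, map_sub, LinearMap.sub_apply, mul_sub, sub_smul, Finset.sum_sub_distrib]
  abel

/-- The normal part of the full derivative of `II` is its derivative for the normal connection. -/
theorem proj_C (k i j : ι) : S.proj (S.C k i j) = S.proj (S.D k (S.II i j))
    - ∑ l, S.Γ l k i • S.II l j - ∑ l, S.Γ l k j • S.II i l := by
  have h : ∀ (x : ι → A) (N : ι → E), (∀ l m, S.ip (N l) (S.T m) = 0) →
      S.proj (∑ l, x l • N l) = ∑ l, x l • N l := fun x N hN => by
    refine S.proj_normal fun m => ?_
    simp [hN]
  rw [C, nab_apply, Pi.sub_apply, nab_apply]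
  simp only [Finset.sum_apply, Pi.smul_apply]
  rw [proj_sub, proj_sub, h _ _ fun l m => S.ip_II_T _ _ _, h _ _ fun l m => S.ip_II_T _ _ _]
  abel

/-- The squared length of the second fundamental form for the negative of the scalar product. -/
def normSqII : A := ∑ i, ∑ j, ∑ i', ∑ j', S.s i i' * S.s j j' * (-S.b i j i' j')

theorem normSqII_eq :
    S.normSqII = -∑ i, ∑ i', S.s i i' * ∑ j, ∑ j', S.s j j' * S.b i j i' j' := by
  simp only [normSqII, Finset.mul_sum, ← Finset.sum_neg_distrib]
  refine Finset.sum_congr rfl fun i _ => ?_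
  rw [Finset.sum_comm]
  exact Finset.sum_congr rfl fun _ _ => Finset.sum_congr rfl fun _ _ =>
    Finset.sum_congr rfl fun _ _ => by ring

theorem map_lap_normSqII (f : A →+* ℝ) : f (lap S.d S.s S.Γ S.normSqII)
    = - (2 * ∑ k, ∑ l, f (S.s k l) * ∑ i, ∑ i', f (S.s i i') * ∑ j, ∑ j', f (S.s j j')
          * f (S.ip (S.C k i j) (S.C l i' j'))
        + 2 * ∑ i, ∑ i', f (S.s i i') * ∑ j, ∑ j', f (S.s j j')
          * f (S.ip (S.L i j) (S.II i' j'))) := by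
  have hl : ∀ u : A, lap S.d S.s S.Γ (-u) = - lap S.d S.s S.Γ u := fun u => by
    simp only [lap, ← Finset.sum_neg_distrib]
    refine Finset.sum_congr rfl fun i _ => Finset.sum_congr rfl fun j _ => ?_
    simp only [map_neg, mul_neg, Finset.sum_neg_distrib]
    ring
  rw [normSqII_eq, hl, lap_normSq, map_neg]
  simp only [map_add, map_mul, map_sum, map_ofNat]

end ImmersionCalculus

namespace IsImmersionOn

open smoothRing

variable {p n : ℕ} {U : Opens (Euc p)} {V : Opens (Euc n)}
  {G : Euc n → Matrix (Fin n) (Fin n) ℝ} {γ : Euc p → Matrix (Fin p) (Fin p) ℝ}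
  {F : Euc p → Euc n} {c : ℝ} (h : IsImmersionOn U V G γ F c)

/-- The value of a vector field at a point. -/
def evalVec (y : U) : (Fin n → smoothRing U) →+ (Fin n → ℝ) where
  toFun W a := W a y
  map_zero' := rfl
  map_add' _ _ := rfl

theorem evalVec_smul (y : U) (a : smoothRing U) (W : Fin n → smoothRing U) :
    evalVec y (a • W) = a y • evalVec y W := rfl

theorem ip_eval (W W' : Fin n → smoothRing U) (y : U) :
    h.toCalculus.ip W W' y = pair (G (F y)) (evalVec y W) (evalVec y W') :=
  h.bilin_apply_apply W W' y

theorem evalVec_T (i : Fin p) (y : U) : evalVec y (h.toCalculus.T i) = tangentVec F i y :=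
  h.T_apply i y

/-- The covariant derivative along the immersion is that of the calculus. The field `W` need only
agree on `U` with a smooth one. -/
theorem covDerivAlong_eq {W : Euc p → Fin n → ℝ} {W' : Fin n → smoothRing U}
    (hW : ∀ y : U, W y = evalVec y W') (i : Fin p) (y : U) :
    covDerivAlong G F i W y = evalVec y (h.toCalculus.D i W') := by
  funext a
  change pderiv i (fun z => W z a) y + ∑ b, ∑ d, christoffel G a b d (F y) * tangentVec F i y b
    * W y d = (partialD i (W' a)) y + (∑ e, connForm h.chrAlong h.T i a e * W' e) y
  rw [partialD_apply (v := fun z => W z a) (fun y => congrFun (hW y) a), sum_coe,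
    Finset.sum_comm]
  congr 1
  refine Finset.sum_congr rfl fun e _ => ?_
  change _ = (∑ b, h.chrAlong a b e * h.T i b) y * W' e y
  rw [sum_coe, Finset.sum_mul]
  refine Finset.sum_congr rfl fun b _ => ?_
  change _ = h.chrAlong a b e y * h.T i b y * W' e y
  rw [chrAlong, pullback_apply, ← h.T_apply, hW]
  rfl

theorem normalPart_eq (W : Fin n → smoothRing U) (y : U) :
    normalPart G γ F y (evalVec y W) = evalVec y (h.toCalculus.proj W) := by
  rw [normalPart, ImmersionCalculus.proj, map_sub, map_sum]
  congr 1
  refine Finset.sum_congr rfl fun k _ => ?_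
  rw [map_sum]
  refine Finset.sum_congr rfl fun l _ => ?_
  rw [evalVec_smul, evalVec_T]
  congr 1
  change _ = h.toCalculus.s k l y * h.toCalculus.ip W (h.toCalculus.T l) y
  rw [ip_eval, evalVec_T]
  rfl

theorem secondFF_eq (i j : Fin p) (y : U) :
    secondFF G γ F i j y = evalVec y (h.toCalculus.II i j) := by
  rw [secondFF, h.covDerivAlong_eq (W' := h.toCalculus.T j) (fun y => (h.evalVec_T j y).symm),
    h.normalPart_eq, ImmersionCalculus.D_T,
    h.toCalculus.proj_add_tangential (h.toCalculus.ip_II_T i j)]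

theorem meanCurvature_eq (y : U) : meanCurvature G γ F y = evalVec y h.toCalculus.mean := by
  rw [meanCurvature, ImmersionCalculus.mean, map_sum]
  refine Finset.sum_congr rfl fun i _ => ?_
  rw [map_sum]
  refine Finset.sum_congr rfl fun j _ => ?_
  rw [evalVec_smul, secondFF_eq]
  rfl

theorem mean_eq_zero (hH : ∀ y ∈ U, meanCurvature G γ F y = 0) : h.toCalculus.mean = 0 := by
  funext a
  refine smoothRing.ext fun y => ?_
  exact congrFun ((h.meanCurvature_eq y).symm.trans (hH y y.2)) a

theorem nablaSecondFF_eq (k i j : Fin p) (y : U) :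
    nablaSecondFF G γ F k i j y = evalVec y (h.toCalculus.proj (h.toCalculus.C k i j)) := by
  rw [nablaSecondFF, normalDeriv, h.covDerivAlong_eq (fun y => h.secondFF_eq i j y),
    h.normalPart_eq, ImmersionCalculus.proj_C, map_sub, map_sub, map_sum, map_sum]
  simp only [evalVec_smul, ← secondFF_eq]
  rfl

/-- Components `⟨II(∂_i, ∂_j), II(∂_k, ∂_l)⟩` at a point. -/
theorem b_eval (i j k l : Fin p) (y : U) : h.toCalculus.b i j k l y
    = pair (G (F y)) (secondFF G γ F i j y) (secondFF G γ F k l y) := by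
  rw [ImmersionCalculus.b, ip_eval, secondFF_eq, secondFF_eq]

theorem laplacian_eq {u : Euc p → ℝ} {u' : smoothRing U} (hu : ∀ y : U, u y = u' y) (y : U) :
    laplacian γ u y = lap partialD h.toCalculus.s h.toCalculus.Γ u' y := by
  rw [laplacian, lap, sum_coe]
  refine Finset.sum_congr rfl fun i _ => ?_
  rw [sum_coe]
  refine Finset.sum_congr rfl fun j _ => ?_
  have h1 : ∀ k, ∀ y : U, pderiv k u y = partialD k u' y := fun k y => (partialD_apply hu k y).symm
  change _ = (γ y)⁻¹ i j * (partialD i (partialD j u') y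
    - (∑ k, h.metric.chr k i j * partialD k u') y)
  rw [partialD_apply (h1 j), sum_coe]
  congr 2
  refine Finset.sum_congr rfl fun k _ => ?_
  rw [h1]
  rfl

/-- The Laplacian of `‖II‖²`, at a point, in terms of the full ambient derivatives of the second
fundamental form. -/
theorem laplacian_normSqSecondFF (y : U) :
    laplacian γ (normSqSecondFF G γ F) y
      = - (2 * ∑ k, ∑ l, (γ y)⁻¹ k l * ∑ i, ∑ i', (γ y)⁻¹ i i' * ∑ j, ∑ j', (γ y)⁻¹ j j'
          * h.toCalculus.ip (h.toCalculus.C k i j) (h.toCalculus.C l i' j') y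
        + 2 * ∑ i, ∑ i', (γ y)⁻¹ i i' * ∑ j, ∑ j', (γ y)⁻¹ j j'
          * h.toCalculus.ip (h.toCalculus.L i j) (h.toCalculus.II i' j') y) := by
  have hu : ∀ y : U, normSqSecondFF G γ F y = h.toCalculus.normSqII y := by
    intro y
    simp only [ImmersionCalculus.normSqII, sum_coe]
    refine Finset.sum_congr rfl fun i _ => Finset.sum_congr rfl fun j _ =>
      Finset.sum_congr rfl fun i' _ => Finset.sum_congr rfl fun j' _ => ?_
    rw [← b_eval]
    rfl
  rw [h.laplacian_eq hu]
  exact h.toCalculus.map_lap_normSqII (eval y)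

end IsImmersionOn

/-! ### The length of the derivative of the second fundamental form, and orthonormal bases -/

namespace ImmersionCalculus

variable {ι A E : Type*} [Fintype ι] [DecidableEq ι] [CommRing A] [Algebra ℝ A]
    [AddCommGroup E] [Module A E] (S : ImmersionCalculus ι A E)

/-- The squared length of the normal part of `∇II`, for the negative of the scalar product. -/
def normSqNablaII : A := ∑ k, ∑ i, ∑ j, ∑ k', ∑ i', ∑ j', S.s k k' * S.s i i' * S.s j j'
  * (-S.ip (S.proj (S.C k i j)) (S.proj (S.C k' i' j')))

/-- The squared length of `∇II` for the full ambient connection, corrected by its tangential part.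
-/
theorem normSqNablaII_eq : S.normSqNablaII
    = -∑ k, ∑ k', S.s k k' * ∑ i, ∑ i', S.s i i' * ∑ j, ∑ j', S.s j j'
        * S.ip (S.C k i j) (S.C k' i' j')
      + ∑ k, ∑ k', S.s k k' * ∑ i, ∑ i', S.s i i' * ∑ j, ∑ j', S.s j j'
        * ∑ m, ∑ m', S.s m m' * (S.b i j k m * S.b i' j' k' m') := by
  have h : ∀ k i j k' i' j', -S.ip (S.proj (S.C k i j)) (S.proj (S.C k' i' j'))
      = -S.ip (S.C k i j) (S.C k' i' j') + ∑ m, ∑ m', S.s m m' * (S.b i j k m * S.b i' j' k' m') :=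
    fun k i j k' i' j' => by
      rw [ip_proj_proj]
      simp only [ip_C_T, neg_mul_neg]
      ring
  have hsum : ∀ X : ι → ι → ι → ι → ι → ι → A,
      ∑ k, ∑ i, ∑ j, ∑ k', ∑ i', ∑ j', S.s k k' * S.s i i' * S.s j j' * X k i j k' i' j'
      = ∑ k, ∑ k', S.s k k' * ∑ i, ∑ i', S.s i i' * ∑ j, ∑ j', S.s j j' * X k i j k' i' j' := by
    intro X
    simp only [Finset.mul_sum]
    simp only [← Fintype.sum_prod_type']
    refine Fintype.sum_equiv ⟨fun ⟨k, i, j, k', i', j'⟩ => (k, k', i, i', j, j'),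
      fun ⟨k, k', i, i', j, j'⟩ => (k, i, j, k', i', j'), fun _ => rfl, fun _ => rfl⟩ _ _
          fun x => ?_
    simp only [Equiv.coe_fn_mk]
    ring
  rw [normSqNablaII]
  simp only [h]
  rw [hsum]
  simp only [mul_add, mul_neg, Finset.sum_add_distrib, Finset.sum_neg_distrib]

/-- The product of the rough Laplacian of the second fundamental form with the second fundamental
form, under a homomorphism to `ℝ` such as the evaluation at a point. -/
theorem map_ip_L (hS : S.mean = 0) (f : A →+* ℝ) (i j i' j' : ι) :
    f (S.ip (S.L i j) (S.II i' j')) = f S.c * Fintype.card ι * f (S.b i j i' j')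
      - (2 * ∑ k, ∑ l, f (S.s k l) * ∑ m, ∑ n, f (S.s m n) *
            (f (S.b i j k m) * f (S.b l n i' j'))
        - 2 * ∑ k, ∑ l, f (S.s k l) * ∑ m, ∑ n, f (S.s m n) *
            (f (S.b l j i n) * f (S.b k m i' j'))
        + ∑ k, ∑ l, f (S.s k l) * ∑ m, ∑ n, f (S.s m n) * (f (S.b i l k n) * f (S.b m j i' j'))
        + ∑ k, ∑ l, f (S.s k l) * ∑ m, ∑ n, f (S.s m n) *
            (f (S.b j l k n) * f (S.b i m i' j'))) := by
  rw [S.ip_L hS (fun m => S.ip_T_II _ _ _) i j]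
  simp only [quad, map_sub, map_add, map_mul, map_sum, map_ofNat, map_natCast]
  rfl

end ImmersionCalculus

section Frame

theorem pair_eq_dotProduct {n : ℕ} (G : Matrix (Fin n) (Fin n) ℝ) (u w : Fin n → ℝ) :
    pair G u w = u ⬝ᵥ G.mulVec w := by
  simp only [pair, dotProduct, Matrix.mulVec, Finset.mul_sum]
  exact Finset.sum_congr rfl fun _ _ => Finset.sum_congr rfl fun _ _ => by ring

theorem pair_eq_toBilin' {n : ℕ} (G : Matrix (Fin n) (Fin n) ℝ) (u w : Fin n → ℝ) :
    pair G u w = Matrix.toBilin' G u w := by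
  rw [Matrix.toBilin'_apply]
  exact Finset.sum_congr rfl fun _ _ => Finset.sum_congr rfl fun _ _ => by ring

/-- The scalar product of two vectors `∑ A(∂_i, ∂_j) uⁱ vʲ` in terms of frame components. -/
theorem frameComp_pair {n : ℕ} {ι κ : Type*} [Fintype ι] [Fintype κ]
    (G : Matrix (Fin n) (Fin n) ℝ) (e : κ → ι → ℝ) (A : ι → ι → Fin n → ℝ) (a₁ a₂ a₃ a₄ : κ) :
    frameComp e (fun i j k l => pair G (A i j) (A k l)) a₁ a₂ a₃ a₄
      = pair G (∑ i, ∑ j, (e a₁ i * e a₂ j) • A i j) (∑ k, ∑ l, (e a₃ k * e a₄ l) • A k l) := by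
  simp only [pair_eq_toBilin', frameComp, map_sum, LinearMap.sum_apply, map_smul,
    LinearMap.smul_apply, smul_eq_mul, Finset.mul_sum]
  simp only [← Fintype.sum_prod_type']
  refine Fintype.sum_equiv ⟨fun ⟨i, j, k, l⟩ => (k, l, i, j), fun ⟨k, l, i, j⟩ => (i, j, k, l),
    fun _ => rfl, fun _ => rfl⟩ _ _ fun x => ?_
  simp only [Equiv.coe_fn_mk]
  ring

/-- The contraction by which the tangential part of `∇II` enters. -/
theorem sum_contract_self {ι κ : Type*} [Fintype ι] [Fintype κ] {s : ι → ι → ℝ} {e : κ → ι → ℝ}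
    (hs : ∀ i j, s i j = ∑ a, e a i * e a j) (b : ι → ι → ι → ι → ℝ) :
    ∑ k, ∑ k', s k k' * ∑ i, ∑ i', s i i' * ∑ j, ∑ j', s j j' * ∑ m, ∑ m', s m m' *
      (b i j k m * b i' j' k' m')
      = ∑ a₁, ∑ a₂, ∑ a₃, ∑ a₄, frameComp e b a₁ a₂ a₃ a₄ ^ 2 := by
  rw [sum_inverse_metric_four hs]
  have h : ∀ a₁ a₂ a₃ a₄, ∑ x : ι × ι × ι × ι, ∑ y : ι × ι × ι × ι,
        (e a₁ x.1 * e a₁ y.1) * (e a₂ x.2.1 * e a₂ y.2.1) * (e a₃ x.2.2.1 * e a₃ y.2.2.1)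
          * (e a₄ x.2.2.2 * e a₄ y.2.2.2)
              * (b x.2.1 x.2.2.1 x.1 x.2.2.2 * b y.2.1 y.2.2.1 y.1 y.2.2.2)
      = frameComp e b a₂ a₃ a₁ a₄ ^ 2 := by
    intro a₁ a₂ a₃ a₄
    simp only [frameComp, sq, Finset.sum_mul_sum]
    simp only [← Fintype.sum_prod_type']
    refine Fintype.sum_equiv ⟨fun ⟨(k, i, j, m), (k', i', j', m')⟩ =>
        ((i, j, k, m), (i', j', k', m')),
      fun ⟨(i, j, k, m), (i', j', k', m')⟩ => ((k, i, j, m), (k', i', j', m')),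
      fun _ => rfl, fun _ => rfl⟩ _ _ fun x => ?_
    simp only [Equiv.coe_fn_mk]
    ring
  simp only [h]
  rw [Finset.sum_comm]
  exact Finset.sum_congr rfl fun _ _ => Finset.sum_comm

/-- The matrix `∑ ε_s B_s ⊗ B_s` of an orthonormal basis `B` with signs `ε` is inverse to that of
the scalar product. -/
theorem mul_frame_eq_one {n : ℕ} {κ : Type*} [Fintype κ] [DecidableEq κ]
    (hκ : Fintype.card κ = n) {G : Matrix (Fin n) (Fin n) ℝ} {ε : κ → ℝ} (hε : ∀ s, ε s * ε s = 1)
    {B : κ → Fin n → ℝ} (hB : ∀ s t, pair G (B s) (B t) = if s = t then ε s else 0) :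
    G * (Matrix.of B).transpose * Matrix.diagonal ε * Matrix.of B = 1 := by
  set M : Matrix κ (Fin n) ℝ := Matrix.of B
  have h1 : M * (G * M.transpose * Matrix.diagonal ε) = 1 := by
    ext s t
    rw [← Matrix.mul_assoc, ← Matrix.mul_assoc, Matrix.mul_diagonal]
    have : (M * G * M.transpose) s t = pair G (B s) (B t) := by
      rw [pair_eq_dotProduct, Matrix.mul_assoc]
      rfl
    rw [this, hB, Matrix.one_apply]
    split_ifs with hst
    · rw [hst, hε]
    · rw [zero_mul]
  exact (Matrix.mul_eq_one_comm_of_card_eq κ (Fin n) ℝ (by simp [hκ])).1 h1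

/-- The scalar product in terms of an orthonormal basis. -/
theorem pair_eq_sum_orthonormal {n : ℕ} {κ : Type*} [Fintype κ] [DecidableEq κ]
    (hκ : Fintype.card κ = n) (G : Matrix (Fin n) (Fin n) ℝ) {ε : κ → ℝ} (hε : ∀ s, ε s * ε s = 1)
    {B : κ → Fin n → ℝ} (hB : ∀ s t, pair G (B s) (B t) = if s = t then ε s else 0)
    (u w : Fin n → ℝ) : pair G u w = ∑ s, ε s * (pair G u (B s) * pair G (B s) w) := by
  set M : Matrix κ (Fin n) ℝ := Matrix.of B
  have h2 : G * M.transpose * Matrix.diagonal ε * M = 1 := mul_frame_eq_one hκ hε hB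
  have h3 : G = G * M.transpose * Matrix.diagonal ε * (M * G) := by
    rw [← Matrix.mul_assoc, h2, Matrix.one_mul]
  have hl : ∀ s, pair G u (B s) = (Matrix.vecMul u (G * M.transpose)) s := fun s => by
    rw [pair_eq_dotProduct]
    rfl
  have hr : ∀ s, pair G (B s) w = ((M * G).mulVec w) s := fun s => by
    rw [pair_eq_dotProduct, ← Matrix.mulVec_mulVec]
    rfl
  have hs : ∀ s, ε s * (pair G u (B s) * pair G (B s) w)
      = Matrix.vecMul u (G * M.transpose) s * (Matrix.diagonal ε).mulVec ((M * G).mulVec w) s :=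
    fun s => by rw [hl, hr, Matrix.mulVec_diagonal]; ring
  simp only [hs]
  change _ = Matrix.vecMul u (G * M.transpose) ⬝ᵥ _
  conv_lhs => rw [h3, pair_eq_dotProduct]
  rw [← Matrix.dotProduct_mulVec, Matrix.mulVec_mulVec, Matrix.mulVec_mulVec, Matrix.mul_assoc]

/-- The inverse of a definite scalar product in terms of an orthonormal basis. -/
theorem inverse_eq_sum_frame {p : ℕ} {γ : Matrix (Fin p) (Fin p) ℝ} {e : Fin p → Fin p → ℝ}
    (he : ∀ a b, pair γ (e a) (e b) = if a = b then 1 else 0) (i j : Fin p) :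
    γ⁻¹ i j = ∑ a, e a i * e a j := by
  set M : Matrix (Fin p) (Fin p) ℝ := Matrix.of e
  have h1 : M * (γ * M.transpose) = 1 := by
    ext a b
    rw [Matrix.one_apply, ← he]
    simp only [pair, Matrix.mul_apply, Finset.mul_sum]
    exact Finset.sum_congr rfl fun _ _ => Finset.sum_congr rfl fun _ _ => by
      change e a _ * (γ _ _ * e b _) = _
      ring
  rw [mul_eq_one_comm, Matrix.mul_assoc] at h1
  rw [Matrix.inv_eq_right_inv h1, Matrix.mul_apply]
  rfl

end Frame

/-! ### Curvature in an orthonormal frame -/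

section FrameCurvature

variable {p : ℕ} {γ : Euc p → Matrix (Fin p) (Fin p) ℝ} {y : Euc p} {e : Fin p → Fin p → ℝ}

theorem ricci_eq_sum (he : ∀ a b, pair (γ y) (e a) (e b) = if a = b then 1 else 0)
    (hdet : IsUnit (γ y).det) (u v : Fin p → ℝ) :
    ricci γ y u v = ∑ a, curvature γ y (e a) u v (e a) := by
  have h1 : ∀ i m, ∑ l, γ y m l * ∑ a, e a i * e a l = if m = i then 1 else 0 := fun i m => by
    have := congrFun (congrFun (Matrix.mul_nonsing_inv (γ y) hdet) m) i
    rw [Matrix.mul_apply, Matrix.one_apply] at this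
    rw [← this]
    exact Finset.sum_congr rfl fun l _ => by
      rw [inverse_eq_sum_frame he]; simp only [mul_comm (e _ l)]
  have h2 : ∀ a, curvature γ y (e a) u v (e a) = ∑ j, ∑ k, (∑ i, ∑ m, riemann γ m i j k y
      * ∑ l, γ y m l * (e a i * e a l)) * u j * v k := by
    intro a
    rw [curvature_eq_sum]
    simp only [Finset.sum_mul, Finset.mul_sum]
    simp only [← Fintype.sum_prod_type']
    refine Fintype.sum_equiv ⟨fun ⟨i, j, k, l, m⟩ => (j, k, i, m, l),
      fun ⟨j, k, i, m, l⟩ => (i, j, k, l, m), fun _ => rfl, fun _ => rfl⟩ _ _ fun x => ?_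
    simp only [Equiv.coe_fn_mk]
    ring
  have h3 : ∀ j k, ∑ a, (∑ i, ∑ m, riemann γ m i j k y * ∑ l, γ y m l * (e a i * e a l))
      = ∑ i, riemann γ i i j k y := by
    intro j k
    rw [Finset.sum_comm]
    refine Finset.sum_congr rfl fun i _ => ?_
    rw [Finset.sum_comm]
    simp only [← Finset.mul_sum]
    have : ∀ m, ∑ a, ∑ l, γ y m l * (e a i * e a l) = if m = i then 1 else 0 := fun m => by
      rw [Finset.sum_comm, ← h1]
      simp only [Finset.mul_sum]
    simp [this]
  simp only [h2]
  rw [Finset.sum_comm, ricci]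
  refine Finset.sum_congr rfl fun j _ => ?_
  rw [Finset.sum_comm]
  refine Finset.sum_congr rfl fun k _ => ?_
  rw [← h3]
  simp only [Finset.sum_mul]

theorem scalar_eq_sum (he : ∀ a b, pair (γ y) (e a) (e b) = if a = b then 1 else 0) :
    scalar γ y = ∑ b, ricci γ y (e b) (e b) := by
  simp only [scalar, ricci]
  rw [sum_inverse_metric (inverse_eq_sum_frame he)]
  exact Finset.sum_congr rfl fun _ _ => Finset.sum_congr rfl fun _ _ =>
    Finset.sum_congr rfl fun _ _ => by ring

theorem sectional_eq (he : ∀ a b, pair (γ y) (e a) (e b) = if a = b then 1 else 0) {i j : Fin p}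
    (hij : i ≠ j) : sectional γ y (e i) (e j) = curvature γ y (e i) (e j) (e j) (e i) := by
  simp [sectional, gram, he, hij]

end FrameCurvature

/-! ### The formula in coordinates -/

namespace IsImmersionOn

open smoothRing

variable {p q : ℕ} {U : Opens (Euc p)} {V : Opens (Euc (p + q))}
  {G : Euc (p + q) → Matrix (Fin (p + q)) (Fin (p + q)) ℝ} {γ : Euc p → Matrix (Fin p) (Fin p) ℝ}
  {F : Euc p → Euc (p + q)} {c : ℝ}

/-- The products `⟨II(∂_i, ∂_j), II(∂_k, ∂_l)⟩` at a point. -/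
def gramII (G : Euc (p + q) → Matrix (Fin (p + q)) (Fin (p + q)) ℝ)
    (γ : Euc p → Matrix (Fin p) (Fin p) ℝ) (F : Euc p → Euc (p + q)) (y : Euc p)
    (i j k l : Fin p) : ℝ :=
  pair (G (F y)) (secondFF G γ F i j y) (secondFF G γ F k l y)

theorem frameComp_gramII (e : Fin p → Fin p → ℝ) (y : Euc p) (a₁ a₂ a₃ a₄ : Fin p) :
    frameComp e (gramII G γ F y) a₁ a₂ a₃ a₄ = pair (G (F y))
      (secondFFVec G γ F y (e a₁) (e a₂)) (secondFFVec G γ F y (e a₃) (e a₄)) :=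
  frameComp_pair _ _ _ _ _ _ _

theorem ip_T_T (h : IsImmersionOn U V G γ F c) (i j : Fin p) (y : U) :
    h.toCalculus.ip (h.toCalculus.T i) (h.toCalculus.T j) y = γ y i j := by
  rw [ip_eval, evalVec_T, evalVec_T, h.induced y y.2]

/-- The Gauss equation at a point. -/
theorem gauss_eval (h : IsImmersionOn U V G γ F c) (k i j l : Fin p) (y : U) :
    ∑ m, riemann γ m k i j y * γ y m l
    = c * (γ y i j * γ y k l - γ y k j * γ y i l)
      + gramII G γ F y i j k l - gramII G γ F y k j i l := by
  have h0 := congrArg (eval y) (h.toCalculus.gauss_lowered k i j l)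
  simp only [map_sum, map_sub, map_add, map_mul, eval_apply, ip_T_T, b_eval] at h0
  have hR : ∀ m, riem h.toCalculus.d h.toCalculus.Γ m k i j y = riemann γ m k i j y :=
    fun m => h.metric.riem_apply m k i j y
  have hc : h.toCalculus.c y = c := rfl
  simp only [hR, hc] at h0
  rw [h0, gramII, gramII]
  ring

/-- The Gauss equation in an orthonormal frame. -/
theorem curvature_frame (h : IsImmersionOn U V G γ F c) (y : U) {e : Fin p → Fin p → ℝ}
    (he : ∀ a b, pair (γ y) (e a) (e b) = if a = b then 1 else 0) (i j k l : Fin p) :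
    PseudoRiemannian.curvature γ y (e i) (e j) (e k) (e l)
      = c * ((if j = k then 1 else 0) * (if i = l then 1 else 0)
        - (if i = k then 1 else 0) * (if j = l then 1 else 0))
        + frameComp e (gramII G γ F y) j k i l - frameComp e (gramII G γ F y) i k j l := by
  have h1 : ∀ u v w z : Fin p → ℝ, pair (γ y) v w * pair (γ y) u z
      = ∑ i, ∑ j, ∑ k, ∑ l, γ y j k * γ y i l * (u i * v j * w k * z l) := by
    intro u v w z
    simp only [pair, Finset.sum_mul_sum]
    simp only [← Fintype.sum_prod_type']
    refine Fintype.sum_equiv ⟨fun ⟨j, i, k, l⟩ => (i, j, k, l), fun ⟨i, j, k, l⟩ => (j, i, k, l),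
      fun _ => rfl, fun _ => rfl⟩ _ _ fun x => ?_
    simp only [Equiv.coe_fn_mk]
    ring
  have h2 : ∀ u v w z : Fin p → ℝ, pair (γ y) u w * pair (γ y) v z
      = ∑ i, ∑ j, ∑ k, ∑ l, γ y i k * γ y j l * (u i * v j * w k * z l) := by
    intro u v w z
    simp only [pair, Finset.sum_mul_sum]
    simp only [← Fintype.sum_prod_type']
    refine Fintype.sum_equiv ⟨fun ⟨i, j, k, l⟩ => (i, j, k, l), fun ⟨i, j, k, l⟩ => (i, j, k, l),
      fun _ => rfl, fun _ => rfl⟩ _ _ fun x => ?_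
    simp only [Equiv.coe_fn_mk]
    ring
  have h3 : frameComp e (gramII G γ F y) j k i l = ∑ i', ∑ j', ∑ k', ∑ l',
      gramII G γ F y j' k' i' l' * (e i i' * e j j' * e k k' * e l l') := by
    rw [frameComp]
    simp only [← Fintype.sum_prod_type']
    refine Fintype.sum_equiv ⟨fun ⟨j, k, i, l⟩ => (i, j, k, l), fun ⟨i, j, k, l⟩ => (j, k, i, l),
      fun _ => rfl, fun _ => rfl⟩ _ _ fun x => ?_
    simp only [Equiv.coe_fn_mk]
    ring
  have h4 : frameComp e (gramII G γ F y) i k j l = ∑ i', ∑ j', ∑ k', ∑ l',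
      gramII G γ F y i' k' j' l' * (e i i' * e j j' * e k k' * e l l') := by
    rw [frameComp]
    simp only [← Fintype.sum_prod_type']
    refine Fintype.sum_equiv ⟨fun ⟨i, k, j, l⟩ => (i, j, k, l), fun ⟨i, j, k, l⟩ => (i, k, j, l),
      fun _ => rfl, fun _ => rfl⟩ _ _ fun x => ?_
    simp only [Equiv.coe_fn_mk]
    ring
  rw [curvature_eq_sum, ← he j k, ← he i l, ← he i k, ← he j l, h1, h2, h3, h4]
  simp only [h.gauss_eval, ← Finset.sum_sub_distrib, ← Finset.sum_add_distrib, Finset.mul_sum]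
  exact Finset.sum_congr rfl fun _ _ => Finset.sum_congr rfl fun _ _ =>
    Finset.sum_congr rfl fun _ _ => Finset.sum_congr rfl fun _ _ => by ring

theorem trace_frameComp (h : IsImmersionOn U V G γ F c)
    (hH : ∀ y ∈ U, meanCurvature G γ F y = 0) (y : U) {e : Fin p → Fin p → ℝ}
    (he : ∀ a b, pair (γ y) (e a) (e b) = if a = b then 1 else 0) (i j : Fin p) :
    ∑ k, frameComp e (gramII G γ F y) k k i j = 0 := by
  have h0 : ∀ k l, ∑ i, ∑ j, (γ y)⁻¹ i j * gramII G γ F y i j k l = 0 := fun k l => by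
    have := congrArg (eval y) (h.toCalculus.trace_b (h.mean_eq_zero hH) k l)
    simp only [map_sum, map_mul, map_zero, eval_apply, b_eval] at this
    exact this
  have h1 : ∀ k, frameComp e (gramII G γ F y) k k i j = ∑ i', ∑ j', ∑ k', ∑ l',
      (e i i' * e j j') * (e k k' * e k l' * gramII G γ F y k' l' i' j') := fun k => by
    rw [frameComp]
    simp only [← Fintype.sum_prod_type']
    refine Fintype.sum_equiv ⟨fun ⟨k', l', i', j'⟩ => (i', j', k', l'),
      fun ⟨i', j', k', l'⟩ => (k', l', i', j'), fun _ => rfl, fun _ => rfl⟩ _ _ fun x => ?_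
    simp only [Equiv.coe_fn_mk]
    ring
  simp only [h1]
  rw [Finset.sum_comm]
  refine Finset.sum_eq_zero fun i' _ => ?_
  rw [Finset.sum_comm]
  refine Finset.sum_eq_zero fun j' _ => ?_
  simp only [← Finset.mul_sum]
  rw [← sum_inverse_metric (inverse_eq_sum_frame he), h0, mul_zero]

theorem pair_secondFF_tangentVec (h : IsImmersionOn U V G γ F c) (i j k : Fin p) (y : U) :
    pair (G (F y)) (secondFF G γ F i j y) (tangentVec F k y) = 0 := by
  rw [h.secondFF_eq, ← h.evalVec_T k y, ← h.ip_eval, ImmersionCalculus.ip_II_T]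
  rfl

/-- The products of the values of the second fundamental form in terms of an orthonormal basis of
the normal space: the values are normal, so only the normal half of the adapted basis contributes.
-/
theorem frameComp_eq_neg_sum (h : IsImmersionOn U V G γ F c) (y : U) {e : Fin p → Fin p → ℝ}
    (he : ∀ a b, pair (γ y) (e a) (e b) = if a = b then 1 else 0) {ν : Fin q → Fin (p + q) → ℝ}
    (hν : ∀ α β, pair (G (F y)) (ν α) (ν β) = if α = β then -1 else 0)
    (heν : ∀ a α, pair (G (F y)) (∑ i, e a i • tangentVec F i y) (ν α) = 0) (i j k l : Fin p) :
    frameComp e (gramII G γ F y) i j k l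
      = -∑ α, (-pair (G (F y)) (secondFFVec G γ F y (e i) (e j)) (ν α))
        * (-pair (G (F y)) (secondFFVec G γ F y (e k) (e l)) (ν α)) := by
  set t : Fin p → Fin (p + q) → ℝ := fun a => ∑ i, e a i • tangentVec F i y with ht
  have hsymm : ∀ u v, pair (G (F y)) u v = pair (G (F y)) v u := fun u v => by
    rw [pair, pair, Finset.sum_comm]
    exact Finset.sum_congr rfl fun a _ => Finset.sum_congr rfl fun b _ => by
      rw [h.ambient.symm (F y) b a]; ring
  have htt : ∀ a b, pair (G (F y)) (t a) (t b) = if a = b then 1 else 0 := by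
    intro a b
    rw [← he]
    simp only [ht, pair_eq_toBilin', map_sum, LinearMap.sum_apply, map_smul, LinearMap.smul_apply,
      smul_eq_mul]
    simp only [← pair_eq_toBilin', ← h.induced y y.2, Finset.mul_sum]
    rw [Finset.sum_comm, pair]
    exact Finset.sum_congr rfl fun _ _ => Finset.sum_congr rfl fun _ _ => by ring
  have heν' : ∀ a α, pair (G (F y)) (t a) (ν α) = 0 := heν
  have hIIt : ∀ u v a, pair (G (F y)) (secondFFVec G γ F y u v) (t a) = 0 := by
    intro u v a
    simp only [ht, secondFFVec, pair_eq_toBilin', map_sum, LinearMap.sum_apply, map_smul,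
      LinearMap.smul_apply, smul_eq_mul]
    simp only [← pair_eq_toBilin', h.pair_secondFF_tangentVec]
    simp
  rw [frameComp_gramII, pair_eq_sum_orthonormal (κ := Fin p ⊕ Fin q) (by simp) (G (F y))
    (ε := Sum.elim (fun _ => 1) (fun _ => -1)) (B := Sum.elim t ν)]
  · simp only [Fintype.sum_sum_type, Sum.elim_inl, Sum.elim_inr, hIIt, zero_mul, mul_zero,
      Finset.sum_const_zero, zero_add, hsymm (ν _), neg_mul, mul_neg, neg_neg,
      one_mul, Finset.sum_neg_distrib]
  · rintro (a | a) <;> simp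
  · rintro (a | a) (b | b) <;> simp [htt, hν, hsymm (ν _), heν']

theorem normSqNablaSecondFF_eq (h : IsImmersionOn U V G γ F c) (y : U) :
    normSqNablaSecondFF G γ F y = h.toCalculus.normSqNablaII y := by
  simp only [ImmersionCalculus.normSqNablaII, sum_coe, normSqNablaSecondFF]
  refine Finset.sum_congr rfl fun k _ => Finset.sum_congr rfl fun i _ =>
    Finset.sum_congr rfl fun j _ => Finset.sum_congr rfl fun k' _ =>
    Finset.sum_congr rfl fun i' _ => Finset.sum_congr rfl fun j' _ => ?_
  rw [h.nablaSecondFF_eq, h.nablaSecondFF_eq, ← h.ip_eval]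
  rfl

/-- The formula before the curvature of the immersed manifold is brought in. -/
theorem half_laplacian (h : IsImmersionOn U V G γ F c)
    (hH : ∀ y ∈ U, meanCurvature G γ F y = 0) (y : U) {e : Fin p → Fin p → ℝ}
    (he : ∀ a b, pair (γ y) (e a) (e b) = if a = b then 1 else 0)
    {b : Fin p → Fin p → Fin p → Fin p → ℝ}
    (hb : frameComp e (gramII G γ F y) = b) :
    1 / 2 * laplacian γ (normSqSecondFF G γ F) y = normSqNablaSecondFF G γ F y
      + (∑ i, ∑ j, ∑ k, ∑ l, b i j k l ^ 2 - c * Fintype.card (Fin p) * ∑ i, ∑ j, b i j i j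
      - 2 * ∑ i, ∑ j, ∑ k, ∑ l, b k j i l * b k l i j
      + ∑ i, ∑ j, ∑ k, ∑ l, b i k k l * b l j i j + ∑ i, ∑ j, ∑ k, ∑ l, b j k k l * b i l i j) := by
  have hs := inverse_eq_sum_frame he
  have hN := congrArg (eval y) h.toCalculus.normSqNablaII_eq
  simp only [map_sum, map_add, map_neg, map_mul, eval_apply, b_eval] at hN
  have hS : ∀ i j, h.toCalculus.s i j y = (γ y)⁻¹ i j := fun _ _ => rfl
  have hc : h.toCalculus.c y = c := rfl
  have hL : ∀ i j i' j', h.toCalculus.ip (h.toCalculus.L i j) (h.toCalculus.II i' j') y = _ :=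
    h.toCalculus.map_ip_L (h.mean_eq_zero hH) (eval y)
  simp only [eval_apply, b_eval, hS, hc] at hN hL
  have h0 := sum_contract_self hs (gramII G γ F y)
  have h1 := sum_contract_one hs (gramII G γ F y) (gramII G γ F y)
  have h2 := sum_contract_two hs (gramII G γ F y) (gramII G γ F y)
  have h3 := sum_contract_three hs (gramII G γ F y) (gramII G γ F y)
  have h4 := sum_contract_four hs (gramII G γ F y) (gramII G γ F y)
  have h5 := sum_inverse_metric_two hs (gramII G γ F y)
  rw [hb] at h0 h1 h2 h3 h4 h5
  -- linearity of the double contraction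
  have hlin : ∀ (K : ℝ) (f₀ f₁ f₂ f₃ f₄ : Fin p → Fin p → Fin p → Fin p → ℝ),
      ∑ i, ∑ i', (γ y)⁻¹ i i' * ∑ j, ∑ j', (γ y)⁻¹ j j' * (K * f₀ i i' j j'
          - (2 * f₁ i i' j j' - 2 * f₂ i i' j j' + f₃ i i' j j' + f₄ i i' j j'))
        = K * (∑ i, ∑ i', (γ y)⁻¹ i i' * ∑ j, ∑ j', (γ y)⁻¹ j j' * f₀ i i' j j')
          - (2 * (∑ i, ∑ i', (γ y)⁻¹ i i' * ∑ j, ∑ j', (γ y)⁻¹ j j' * f₁ i i' j j')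
            - 2 * (∑ i, ∑ i', (γ y)⁻¹ i i' * ∑ j, ∑ j', (γ y)⁻¹ j j' * f₂ i i' j j')
            + (∑ i, ∑ i', (γ y)⁻¹ i i' * ∑ j, ∑ j', (γ y)⁻¹ j j' * f₃ i i' j j')
            + (∑ i, ∑ i', (γ y)⁻¹ i i' * ∑ j, ∑ j', (γ y)⁻¹ j j' * f₄ i i' j j')) := by
    intro K f₀ f₁ f₂ f₃ f₄
    simp only [Finset.mul_sum, ← Finset.sum_sub_distrib, ← Finset.sum_add_distrib]
    exact Finset.sum_congr rfl fun _ _ => Finset.sum_congr rfl fun _ _ =>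
      Finset.sum_congr rfl fun _ _ => Finset.sum_congr rfl fun _ _ => by ring
  have hY : ∑ i, ∑ i', (γ y)⁻¹ i i' * ∑ j, ∑ j', (γ y)⁻¹ j j'
        * h.toCalculus.ip (h.toCalculus.L i j) (h.toCalculus.II i' j') y
      = c * Fintype.card (Fin p) * ∑ i, ∑ j, b i j i j
        - (2 * ∑ i, ∑ j, ∑ k, ∑ l, b i j k l * b k l i j
          - 2 * ∑ i, ∑ j, ∑ k, ∑ l, b k j i l * b k l i j
          + ∑ i, ∑ j, ∑ k, ∑ l, b i k k l * b l j i j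
          + ∑ i, ∑ j, ∑ k, ∑ l, b j k k l * b i l i j) := by
    simp only [hL]
    refine (hlin _ _ _ _ _ _).trans ?_
    rw [← h1, ← h2, ← h3, ← h4, ← h5]
    rfl
  have hsw : ∀ i j k l, b k l i j = b i j k l := fun i j k l => by
    rw [← hb, frameComp_gramII, frameComp_gramII, pair, pair, Finset.sum_comm]
    exact Finset.sum_congr rfl fun _ _ => Finset.sum_congr rfl fun _ _ => by
      rw [h.ambient.symm (F y)]; ring
  have hsq : ∑ i, ∑ j, ∑ k, ∑ l, b i j k l * b k l i j = ∑ i, ∑ j, ∑ k, ∑ l, b i j k l ^ 2 := by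
    simp only [hsw, sq]
  rw [h.laplacian_normSqSecondFF, h.normSqNablaSecondFF_eq, hY, hN, hsq, ← h0]
  simp only [gramII]
  ring

/-- The formula for `Δ‖II‖²` in coordinates, at a point of the coordinate domain. -/
theorem simons_formula (h : IsImmersionOn U V G γ F c)
    (hH : ∀ y ∈ U, meanCurvature G γ F y = 0) {y : Euc p} (hy : y ∈ U) {e : Fin p → Fin p → ℝ}
    (he : ∀ a b, pair (γ y) (e a) (e b) = if a = b then 1 else 0) {ν : Fin q → Fin (p + q) → ℝ}
    (hν : ∀ α β, pair (G (F y)) (ν α) (ν β) = if α = β then -1 else 0)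
    (heν : ∀ a α, pair (G (F y)) (∑ i, e a i • tangentVec F i y) (ν α) = 0)
    (H : Fin q → Matrix (Fin p) (Fin p) ℝ)
    (hHν : ∀ α i j, H α i j = -pair (G (F y)) (secondFFVec G γ F y (e i) (e j)) (ν α)) :
    1 / 2 * laplacian γ (normSqSecondFF G γ F) y
      = normSqNablaSecondFF G γ F y + 1 / 2 * ∑ α, ∑ β, Metric.frobSq ⁅H α, H β⁆
        + ∑ i, ∑ j, (if i ≠ j then sectional γ y (e i) (e j) ^ 2 else 0)
        - c * p * scalar γ y
        + ∑ i, ∑ j, ricci γ y (e i) (e j) ^ 2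
        + 1 / 2 * ∑ i, ∑ j, ∑ k, ∑ l,
            (if (i, j) ≠ (l, k) ∧ (i, j) ≠ (k, l)
              then PseudoRiemannian.curvature γ y (e i) (e j) (e k) (e l) ^ 2 else 0) := by
  set b := frameComp e (gramII G γ F y) with hb
  set R : Fin p → Fin p → Fin p → Fin p → ℝ := fun i j k l =>
    PseudoRiemannian.curvature γ y (e i) (e j) (e k) (e l) with hR
  have hbH : ∀ i j k l, b i j k l = -∑ α, H α i j * H α k l := fun i j k l => by
    simp only [hHν]
    exact h.frameComp_eq_neg_sum ⟨y, hy⟩ he hν heν i j k l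
  have hsec : ∀ i j, secondFF G γ F i j y = secondFF G γ F j i y := fun i j => by
    rw [h.secondFF_eq i j ⟨y, hy⟩, h.secondFF_eq j i ⟨y, hy⟩, ImmersionCalculus.II_symm]
  have hHsymm : ∀ α i j, H α i j = H α j i := fun α i j => by
    rw [hHν, hHν, secondFFVec, secondFFVec, Finset.sum_comm]
    simp only [hsec, mul_comm (e i _)]
  have hsw : ∀ i j k l, b i j k l = b k l i j := fun i j k l => by
    simp only [hbH, mul_comm]
  have hl : ∀ i j k l, b i j k l = b j i k l := fun i j k l => by
    simp only [hbH, hHsymm _ i j]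
  have hRb := h.curvature_frame ⟨y, hy⟩ he
  have hskew : ∀ i j k l, R i j k l = - R j i k l := fun i j k l => by
    simp only [hR, hRb]; ring
  have hskew' : ∀ i j k l, R i j k l = - R i j l k := fun i j k l => by
    simp only [hR, hRb]
    rw [← hb, hsw j k i l, hsw i k j l]
    ring
  have hdet := h.metric.isUnit_det y hy
  have hric : ∀ i j, ricci γ y (e i) (e j) = ∑ a, R a i j a := fun i j => ricci_eq_sum he hdet _ _
  have hscal : scalar γ y = ∑ i, ∑ j, R i j j i := by
    rw [scalar_eq_sum he, Finset.sum_comm]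
    simp only [hric]
  have hsecR : ∀ i j, (if i ≠ j then sectional γ y (e i) (e j) ^ 2 else 0)
      = if i ≠ j then R i j j i ^ 2 else 0 := fun i j => by
    split_ifs with hij
    · rw [sectional_eq he hij]
    · rfl
  have h1 := frame_algebra c b R hl hsw (h.trace_frameComp hH ⟨y, hy⟩ he) hRb
  have h2 := half_sum_riemann_sq R hskew hskew'
  have h3 := half_sum_frobSq_commutator H hHsymm b hbH
  have h4 := h.half_laplacian hH ⟨y, hy⟩ he hb.symm
  rw [h4, h1, h3, hscal]
  simp only [hric, hsecR, Fintype.card_fin]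
  linarith

end IsImmersionOn

/-! ### Tensors in charts -/

section Charts

variable {n : ℕ} {X : Type*} [TopologicalSpace X] [ChartedSpace (Euc n) X]
  {ψ : OpenPartialHomeomorph X (Euc n)}

theorem mdifferentiable_of_mem_maximalAtlas (hψ : ψ ∈ IsManifold.maximalAtlas (𝓡 n) ∞ X) :
    ψ.MDifferentiable (𝓡 n) (𝓡 n) :=
  ⟨(contMDiffOn_of_mem_maximalAtlas hψ).mdifferentiableOn (by simp),
    (contMDiffOn_symm_of_mem_maximalAtlas hψ).mdifferentiableOn (by simp)⟩

theorem mfderiv_symm_eq_sum (y : Euc n) (w : Fin n → ℝ) :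
    (mfderiv (𝓡 n) (𝓡 n) ψ.symm y (WithLp.toLp 2 w : Euc n) : Euc n)
      = ∑ a, w a • (coordVec ψ y a : Euc n) := by
  have h : (WithLp.toLp 2 w : Euc n) = ∑ a, w a • (EuclideanSpace.single a (1 : ℝ) : Euc n) :=
    euc_eq_sum _
  rw [h]
  exact (map_sum (mfderiv (𝓡 n) (𝓡 n) ψ.symm y) _ _).trans
    (Finset.sum_congr rfl fun a _ => map_smul (mfderiv (𝓡 n) (𝓡 n) ψ.symm y) _ _)

/-- A tangent vector is the combination of the coordinate vectors with its components. -/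
theorem sum_components (hψ : ψ ∈ IsManifold.maximalAtlas (𝓡 n) ∞ X) {x : X} (hx : x ∈ ψ.source)
    (v : TangentSpace (𝓡 n) x) :
    ∑ a, components ψ x v a • (coordVec ψ (ψ x) a : Euc n) = (v : Euc n) := by
  rw [← mfderiv_symm_eq_sum]
  exact congrArg (fun L => L v)
    ((mdifferentiable_of_mem_maximalAtlas hψ).symm_comp_deriv hx)

/-- Evaluation of a field of bilinear forms in a chart. The field is given on the model space, with
which every tangent space is identified. -/
theorem pair_coordMatrix (hψ : ψ ∈ IsManifold.maximalAtlas (𝓡 n) ∞ X)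
    (B : X → Euc n →L[ℝ] Euc n →L[ℝ] ℝ) {x : X} (hx : x ∈ ψ.source) (v w : Euc n) :
    pair (coordMatrix (fun x u v => B x u v) ψ (ψ x)) (components ψ x v) (components ψ x w)
      = B x v w := by
  let C : Fin n → Euc n := coordVec ψ (ψ x)
  have hexp : ∀ (B : Euc n →L[ℝ] Euc n →L[ℝ] ℝ) (u u' : Fin n → ℝ),
      B (∑ a, u a • C a) (∑ b, u' b • C b) = ∑ a, ∑ b, B (C a) (C b) * u a * u' b := by
    intro B u u'
    simp only [map_sum, map_smul, sum_apply, smul_apply, smul_eq_mul, Finset.mul_sum]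
    rw [Finset.sum_comm]
    exact Finset.sum_congr rfl fun a _ => Finset.sum_congr rfl fun b _ => by ring
  have h : ∀ v' w' : Euc n, v' = v → w' = w → B (ψ.symm (ψ x)) v' w' = B x v w := by
    rintro _ _ rfl rfl
    rw [ψ.left_inv hx]
  exact (hexp (B (ψ.symm (ψ x))) _ _).symm.trans
    (h _ _ (sum_components hψ hx v) (sum_components hψ hx w))

/-- The coordinate vector fields are smooth sections of the tangent bundle. -/
theorem contMDiffOn_coordVec [IsManifold (𝓡 n) ∞ X]
    (hψ : ψ ∈ IsManifold.maximalAtlas (𝓡 n) ∞ X) (a : Fin n) :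
    ContMDiffOn (𝓡 n) (𝓡 n).tangent ∞
      (fun y => (⟨ψ.symm y, coordVec ψ y a⟩ : TangentBundle (𝓡 n) X)) ψ.target := by
  have h1 := (contMDiffOn_symm_of_mem_maximalAtlas hψ).contMDiffOn_tangentMapWithin (m := ∞)
    (by simp) ψ.open_target.uniqueMDiffOn
  have h2 : ContMDiff (𝓡 n) (𝓡 n).tangent ∞ (fun y : Euc n =>
      (⟨y, (EuclideanSpace.single a (1 : ℝ) : Euc n)⟩ : TangentBundle (𝓡 n) (Euc n))) :=
    contMDiff_vectorSpace_iff_contDiff.2 contDiff_const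
  refine (h1.comp h2.contMDiffOn fun y hy => hy).congr fun y hy => ?_
  simp only [tangentMapWithin, Function.comp]
  rw [mfderivWithin_of_isOpen ψ.open_target hy]
  rfl

end Charts

namespace Metric

variable {p q : ℕ} {X : Type*} [TopologicalSpace X] [ChartedSpace (Euc (p + q)) X]
  [IsManifold (𝓡 (p + q)) ∞ X] (g : Metric p q X) {ψ : OpenPartialHomeomorph X (Euc (p + q))}

theorem contDiffOn_coordMatrix (hψ : ψ ∈ IsManifold.maximalAtlas (𝓡 (p + q)) ∞ X)
    (a b : Fin (p + q)) : ContDiffOn ℝ ∞ (fun y => coordMatrix g.form ψ y a b) ψ.target := by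
  intro y hy
  have h : ContMDiffWithinAt (𝓡 (p + q)) ((𝓡 (p + q)).prod 𝓘(ℝ)) ∞
      (fun y => Bundle.TotalSpace.mk' ℝ (E := Bundle.Trivial X ℝ) (ψ.symm y)
        (g.val (ψ.symm y) (coordVec ψ y a) (coordVec ψ y b))) ψ.target y := by
    apply ContMDiffWithinAt.clm_bundle_apply₂ (F₁ := Euc (p + q)) (F₂ := Euc (p + q))
    · exact ContMDiffAt.comp_contMDiffWithinAt y g.contMDiff.contMDiffAt
        (contMDiffOn_symm_of_mem_maximalAtlas hψ y hy)
    · exact contMDiffOn_coordVec hψ a y hy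
    · exact contMDiffOn_coordVec hψ b y hy
  simp only [Bundle.contMDiffWithinAt_totalSpace] at h
  exact contMDiffWithinAt_iff_contDiffWithinAt.1 h.2

/-- Coordinate form of the signature condition. -/
theorem exists_orthonormal_components (hψ : ψ ∈ IsManifold.maximalAtlas (𝓡 (p + q)) ∞ X)
    {y : Euc (p + q)} (hy : y ∈ ψ.target) : ∃ B : Fin p ⊕ Fin q → Fin (p + q) → ℝ,
      ∀ s t, pair (coordMatrix g.form ψ y) (B s) (B t)
        = if s = t then Sum.elim (fun _ => 1) (fun _ => -1) s else 0 := by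
  obtain ⟨b, hb⟩ := g.signature (ψ.symm y)
  refine ⟨fun s => components ψ (ψ.symm y) (b s), fun s t => ?_⟩
  have h := pair_coordMatrix hψ g.val (ψ.map_target hy) (b s) (b t)
  rw [ψ.right_inv hy] at h
  exact h.trans (hb s t)

theorem sign_mul_sign (s : Fin p ⊕ Fin q) : (Sum.elim (fun _ => 1) (fun _ => -1) s : ℝ)
    * Sum.elim (fun _ => 1) (fun _ => -1) s = 1 := by
  rcases s with _ | _ <;> simp

theorem isMetricOn_coordMatrix (hψ : ψ ∈ IsManifold.maximalAtlas (𝓡 (p + q)) ∞ X) :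
    IsMetricOn ⟨ψ.target, ψ.open_target⟩ (coordMatrix g.form ψ) where
  smooth := g.contDiffOn_coordMatrix hψ
  symm y i j := g.symm _ _ _
  isUnit_det y hy := by
    obtain ⟨B, hB⟩ := g.exists_orthonormal_components hψ hy
    have h := mul_frame_eq_one (by simp) sign_mul_sign hB
    rw [Matrix.mul_assoc, Matrix.mul_assoc] at h
    exact Matrix.isUnit_det_of_right_inverse h

/-- The curvature tensor of a metric of constant curvature, in a chart. -/
theorem riemann_of_hasConstantCurvature {c : ℝ} (hc : g.HasConstantCurvature c)
    (hψ : ψ ∈ IsManifold.maximalAtlas (𝓡 (p + q)) ∞ X) {z : Euc (p + q)} (hz : z ∈ ψ.target)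
    (l i j k : Fin (p + q)) : riemann (coordMatrix g.form ψ) l i j k z
      = c * (coordMatrix g.form ψ z j k * (if l = i then 1 else 0)
        - coordMatrix g.form ψ z i k * (if l = j then 1 else 0)) := by
  refine (g.isMetricOn_coordMatrix hψ).riemann_eq hz ?_ (hc ψ hψ z hz) l i j k
  obtain ⟨B, hB⟩ := g.exists_orthonormal_components hψ hz
  rcases subsingleton_or_nontrivial (Fin p ⊕ Fin q) with h | h
  · exact Or.inl (finSumFinEquiv (m := p) (n := q)).symm.subsingleton
  · obtain ⟨s, t, hst⟩ := exists_pair_ne (Fin p ⊕ Fin q)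
    -- Two distinct vectors of an orthonormal basis span a nondegenerate plane.
    refine Or.inr ⟨B s, B t, ?_⟩
    simp only [gram, hB, if_true, hst, if_false]
    rcases s with _ | _ <;> rcases t with _ | _ <;> norm_num

end Metric

/-! ### The immersion in charts -/

section Immersion

variable {p n : ℕ} {X : Type*} [TopologicalSpace X] [ChartedSpace (Euc n) X]
  {M : Type*} [TopologicalSpace M] [ChartedSpace (Euc p) M] {f : M → X}
  {φ : OpenPartialHomeomorph M (Euc p)} {ψ : OpenPartialHomeomorph X (Euc n)}

/-- The set of coordinates `φ x` of points `x` at which `f` can be expressed in the charts `φ`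
and `ψ`. -/
def chartDomain (hf : Continuous f) (φ : OpenPartialHomeomorph M (Euc p))
    (ψ : OpenPartialHomeomorph X (Euc n)) : Opens (Euc p) :=
  ⟨φ.target ∩ φ.symm ⁻¹' (f ⁻¹' ψ.source),
    φ.symm.isOpen_inter_preimage (ψ.open_source.preimage hf)⟩

theorem contDiffOn_chart_comp (hf : ContMDiff (𝓡 p) (𝓡 n) ∞ f)
    (hφ : φ ∈ IsManifold.maximalAtlas (𝓡 p) ∞ M) (hψ : ψ ∈ IsManifold.maximalAtlas (𝓡 n) ∞ X) :
    ContDiffOn ℝ ∞ (fun y => ψ (f (φ.symm y))) (chartDomain hf.continuous φ ψ) := by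
  rw [← contMDiffOn_iff_contDiffOn]
  exact (contMDiffOn_of_mem_maximalAtlas hψ).comp (hf.comp_contMDiffOn
    ((contMDiffOn_symm_of_mem_maximalAtlas hφ).mono Set.inter_subset_left)) fun y hy => hy.2

/-- The coordinate expression of the differential of `f` on the coordinate vectors. -/
theorem tangentVec_eq (hf : ContMDiff (𝓡 p) (𝓡 n) ∞ f)
    (hφ : φ ∈ IsManifold.maximalAtlas (𝓡 p) ∞ M) (hψ : ψ ∈ IsManifold.maximalAtlas (𝓡 n) ∞ X)
    {y : Euc p} (hy : y ∈ chartDomain hf.continuous φ ψ) (i : Fin p) :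
    tangentVec (fun y => ψ (f (φ.symm y))) i y
      = components ψ (f (φ.symm y)) (mfderiv (𝓡 p) (𝓡 n) f (φ.symm y) (coordVec φ y i)) := by
  have hφd := mdifferentiable_of_mem_maximalAtlas hφ
  have hψd := mdifferentiable_of_mem_maximalAtlas hψ
  have h1 : MDifferentiableAt (𝓡 p) (𝓡 p) φ.symm y := hφd.mdifferentiableAt_symm hy.1
  have h2 : MDifferentiableAt (𝓡 p) (𝓡 n) f (φ.symm y) := hf.mdifferentiable (by simp) _
  have h3 : MDifferentiableAt (𝓡 n) (𝓡 n) ψ (f (φ.symm y)) := hψd.mdifferentiableAt hy.2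
  have h4 : MDifferentiableAt (𝓡 p) (𝓡 n) (ψ ∘ f ∘ φ.symm) y := h3.comp y (h2.comp y h1)
  have h5 : fderiv ℝ (ψ ∘ f ∘ φ.symm) y = (mfderiv (𝓡 n) (𝓡 n) ψ (f (φ.symm y))).comp
      ((mfderiv (𝓡 p) (𝓡 n) f (φ.symm y)).comp (mfderiv (𝓡 p) (𝓡 p) φ.symm y)) := by
    rw [← mfderiv_eq_fderiv, mfderiv_comp y h3 (h2.comp y h1), mfderiv_comp y h2 h1]
    rfl
  funext a
  have h6 : HasFDerivAt (fun z => (ψ ∘ f ∘ φ.symm) z a)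
      ((EuclideanSpace.proj a : Euc n →L[ℝ] ℝ).comp (fderiv ℝ (ψ ∘ f ∘ φ.symm) y)) y :=
    (EuclideanSpace.proj a : Euc n →L[ℝ] ℝ).hasFDerivAt.comp y
      h4.differentiableAt.hasFDerivAt
  change fderiv ℝ (fun z => (ψ ∘ f ∘ φ.symm) z a) y _ = _
  rw [h6.fderiv, h5]
  rfl

theorem sum_components_tangentVec (hf : ContMDiff (𝓡 p) (𝓡 n) ∞ f)
    (hφ : φ ∈ IsManifold.maximalAtlas (𝓡 p) ∞ M) (hψ : ψ ∈ IsManifold.maximalAtlas (𝓡 n) ∞ X)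
    {x : M} (hx : x ∈ φ.source) (hfx : f x ∈ ψ.source) (v : TangentSpace (𝓡 p) x) :
    ∑ i, components φ x v i • tangentVec (fun y => ψ (f (φ.symm y))) i (φ x)
      = components ψ (f x) (mfderiv (𝓡 p) (𝓡 n) f x v) := by
  have hy : φ x ∈ chartDomain hf.continuous φ ψ :=
    ⟨φ.map_source hx, by simpa [φ.left_inv hx] using hfx⟩
  -- `v` is based at `φ.symm (φ x)` as well, since all tangent spaces are the model space.
  have hbase : ∀ x₁ x₂ : M, x₁ = x₂ → ∀ v : Euc p,
      components ψ (f x₁) (mfderiv (𝓡 p) (𝓡 n) f x₁ v)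
        = components ψ (f x₂) (mfderiv (𝓡 p) (𝓡 n) f x₂ v) := by
    rintro x₁ _ rfl v
    rfl
  rw [← hbase _ _ (φ.left_inv hx) v]
  conv_rhs => rw [← sum_components hφ hx v]
  simp only [tangentVec_eq hf hφ hψ hy]
  funext a
  rw [Finset.sum_apply]
  let L : Euc p →L[ℝ] ℝ := (EuclideanSpace.proj a : Euc n →L[ℝ] ℝ).comp
    ((mfderiv (𝓡 n) (𝓡 n) ψ (f (φ.symm (φ x)))).comp (mfderiv (𝓡 p) (𝓡 n) f (φ.symm (φ x))))
  change ∑ i, components φ x v i • L (coordVec φ (φ x) i)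
    = L (∑ i, components φ x v i • coordVec φ (φ x) i)
  exact ((map_sum L _ _).trans (Finset.sum_congr rfl fun i _ => map_smul L _ _)).symm

end Immersion

namespace Metric

variable {p q : ℕ} {X : Type*} [TopologicalSpace X] [ChartedSpace (Euc (p + q)) X]
  [IsManifold (𝓡 (p + q)) ∞ X] (g : Metric p q X)
  {M : Type*} [TopologicalSpace M] [ChartedSpace (Euc p) M] {f : M → X}
  {φ : OpenPartialHomeomorph M (Euc p)} {ψ : OpenPartialHomeomorph X (Euc (p + q))}

/-- Evaluation of the induced metric in a chart. -/
theorem pair_coordMatrix_induced (hφ : φ ∈ IsManifold.maximalAtlas (𝓡 p) ∞ M) {x : M}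
    (hx : x ∈ φ.source) (v w : TangentSpace (𝓡 p) x) :
    pair (coordMatrix (g.induced f) φ (φ x)) (components φ x v) (components φ x w)
      = g.induced f x v w :=
  let A : M → Euc (p + q) →L[ℝ] Euc (p + q) →L[ℝ] ℝ := fun x => g.val (f x)
  let D : M → Euc p →L[ℝ] Euc (p + q) := fun x => mfderiv (𝓡 p) (𝓡 (p + q)) f x
  pair_coordMatrix hφ (fun x => (A x).bilinearComp (D x) (D x)) hx v w

/-- A spacelike immersion induces a nondegenerate metric. -/
theorem isUnit_det_induced (hs : g.IsSpacelike f) (hφ : φ ∈ IsManifold.maximalAtlas (𝓡 p) ∞ M)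
    {y : Euc p} (hy : y ∈ φ.target) : IsUnit (coordMatrix (g.induced f) φ y).det := by
  rw [isUnit_iff_ne_zero]
  intro h0
  obtain ⟨u, hu, hu0⟩ := Matrix.exists_mulVec_eq_zero_iff.2 h0
  set v : TangentSpace (𝓡 p) (φ.symm y) := mfderiv (𝓡 p) (𝓡 p) φ.symm y (WithLp.toLp 2 u : Euc p)
    with hv
  have hc : components φ (φ.symm y) v = u := by
    have h := congrArg (fun L => L (WithLp.toLp 2 u : Euc p))
      ((mdifferentiable_of_mem_maximalAtlas hφ).comp_symm_deriv hy)
    funext a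
    exact congrArg (fun w : Euc p => w a) h
  have hv0 : v ≠ 0 := by
    rintro h
    rw [h] at hc
    refine hu (hc.symm.trans ?_)
    funext a
    exact congrArg (fun w : Euc p => w a) (map_zero (mfderiv (𝓡 p) (𝓡 p) φ (φ.symm y)))
  have h := hs _ v hv0
  rw [← g.pair_coordMatrix_induced hφ (φ.map_target hy), hc, φ.right_inv hy, pair_eq_dotProduct,
    hu0, dotProduct_zero] at h
  exact lt_irrefl _ h

/-- A spacelike immersion into a space of constant curvature satisfies, in charts, the hypotheses
of the coordinate calculus. -/
theorem isImmersionOn {c : ℝ} (hc : g.HasConstantCurvature c)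
    (hf : ContMDiff (𝓡 p) (𝓡 (p + q)) ∞ f) (hs : g.IsSpacelike f)
    (hφ : φ ∈ IsManifold.maximalAtlas (𝓡 p) ∞ M)
    (hψ : ψ ∈ IsManifold.maximalAtlas (𝓡 (p + q)) ∞ X) :
    IsImmersionOn (chartDomain hf.continuous φ ψ) ⟨ψ.target, ψ.open_target⟩
      (coordMatrix g.form ψ) (coordMatrix (g.induced f) φ) (inCharts f φ ψ) c := by
  have hF : ContDiffOn ℝ ∞ (inCharts f φ ψ) (chartDomain hf.continuous φ ψ) :=
    contDiffOn_chart_comp hf hφ hψ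
  have hmaps : Set.MapsTo (inCharts f φ ψ) (chartDomain hf.continuous φ ψ) ψ.target :=
    fun y hy => ψ.map_source hy.2
  have hind : ∀ y ∈ chartDomain hf.continuous φ ψ, ∀ i j, coordMatrix (g.induced f) φ y i j
      = pair (coordMatrix g.form ψ (inCharts f φ ψ y)) (tangentVec (inCharts f φ ψ) i y)
        (tangentVec (inCharts f φ ψ) j y) := fun y hy i j => by
    refine (pair_coordMatrix hψ g.val hy.2 _ _).symm.trans ?_
    rw [← tangentVec_eq hf hφ hψ hy, ← tangentVec_eq hf hφ hψ hy]
    rfl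
  have hcomp : ∀ a, ContDiffOn ℝ ∞ (fun z => inCharts f φ ψ z a)
      (chartDomain hf.continuous φ ψ) :=
    fun a => (EuclideanSpace.proj a : Euc (p + q) →L[ℝ] ℝ).contDiff.comp_contDiffOn hF
  have hT : ∀ i a, ContDiffOn ℝ ∞ (fun y => tangentVec (inCharts f φ ψ) i y a)
      (chartDomain hf.continuous φ ψ) := fun i a => smoothRing.contDiffOn_pderiv (hcomp a) i
  exact
    { ambient := g.isMetricOn_coordMatrix hψ
      metric :=
        { smooth := fun i j => by
            refine ContDiffOn.congr ?_ fun y hy => hind y hy i j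
            refine ContDiffOn.sum fun a _ => ContDiffOn.sum fun b _ => ?_
            exact (((g.contDiffOn_coordMatrix hψ a b).comp hF hmaps).mul (hT i a)).mul (hT j b)
          symm := fun y i j => g.symm _ _ _
          isUnit_det := fun y hy => g.isUnit_det_induced hs hφ hy.1 }
      smooth := hF
      mapsTo := hmaps
      induced := hind
      curvature := fun z hz l i j k => g.riemann_of_hasConstantCurvature hc hψ hz l i j k }

theorem meanCurvature_eq_zero (hf : ContMDiff (𝓡 p) (𝓡 (p + q)) ∞ f) (hmax : g.IsMaximal f)
    (hφ : φ ∈ IsManifold.maximalAtlas (𝓡 p) ∞ M)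
    (hψ : ψ ∈ IsManifold.maximalAtlas (𝓡 (p + q)) ∞ X) {y : Euc p}
    (hy : y ∈ chartDomain hf.continuous φ ψ) :
    meanCurvature (coordMatrix g.form ψ) (coordMatrix (g.induced f) φ) (inCharts f φ ψ) y = 0 := by
  have h := hmax φ hφ ψ hψ (φ.symm y) (φ.map_target hy.1) hy.2
  rwa [φ.right_inv hy.1] at h

end Metric

end PseudoRiemannian

end

theorem mainTheorem10 (p q : ℕ) (c : ℝ)
    {X : Type*} [TopologicalSpace X] [ChartedSpace (PseudoRiemannian.Euc (p + q)) X]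
    [IsManifold (𝓡 (p + q)) ∞ X]
    {M : Type*} [TopologicalSpace M] [ChartedSpace (PseudoRiemannian.Euc p) M]
    [IsManifold (𝓡 p) ∞ M]
    -- the ambient metric, of constant sectional curvature `c`
    (g : PseudoRiemannian.Metric p q X) (hc : g.HasConstantCurvature c)
    -- a maximal spacelike `p`-submanifold
    (f : M → X) (hf : ContMDiff (𝓡 p) (𝓡 (p + q)) ∞ f)
    (hs : g.IsSpacelike f) (hmax : g.IsMaximal f)
    -- a point, charts around it, and an adapted orthonormal frame at it
    (x : M)
    (φ : OpenPartialHomeomorph M (PseudoRiemannian.Euc p))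
    (hφ : φ ∈ IsManifold.maximalAtlas (𝓡 p) ∞ M) (hxφ : x ∈ φ.source)
    (ψ : OpenPartialHomeomorph X (PseudoRiemannian.Euc (p + q)))
    (hψ : ψ ∈ IsManifold.maximalAtlas (𝓡 (p + q)) ∞ X) (hxψ : f x ∈ ψ.source)
    (e : Fin p → TangentSpace (𝓡 p) x) (ν : Fin q → TangentSpace (𝓡 (p + q)) (f x))
    (hframe : g.IsAdaptedFrame f x e ν) :
    (1 / 2 * g.laplacianNormSqII f φ ψ x
      = g.normSqNablaII f φ ψ x
        + 1 / 2 * ∑ α, ∑ β, PseudoRiemannian.Metric.frobSq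
            ⁅g.shapeMatrix f φ ψ x e ν α, g.shapeMatrix f φ ψ x e ν β⁆
        + ∑ i, ∑ j, (if i ≠ j then g.sec f φ x (e i) (e j) ^ 2 else 0)
        - c * p * g.scal f φ x
        + ∑ i, ∑ j, g.ric f φ x (e i) (e j) ^ 2
        + 1 / 2 * ∑ i, ∑ j, ∑ k, ∑ l,
            (if (i, j) ≠ (l, k) ∧ (i, j) ≠ (k, l)
              then g.rm f φ x (e i) (e j) (e k) (e l) ^ 2 else 0))
    ∧ ((∀ i j, i ≠ j → g.ric f φ x (e i) (e j) = 0) →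
      1 / 2 * g.laplacianNormSqII f φ ψ x
      = g.normSqNablaII f φ ψ x
        + 1 / 2 * ∑ α, ∑ β, PseudoRiemannian.Metric.frobSq
            ⁅g.shapeMatrix f φ ψ x e ν α, g.shapeMatrix f φ ψ x e ν β⁆
        + ∑ i, ∑ j, (if i ≠ j then g.sec f φ x (e i) (e j) ^ 2 else 0)
        - c * p * g.scal f φ x
        + ∑ i, g.ric f φ x (e i) (e i) ^ 2
        + 1 / 2 * ∑ i, ∑ j, ∑ k, ∑ l,
            (if (i, j) ≠ (l, k) ∧ (i, j) ≠ (k, l)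
              then g.rm f φ x (e i) (e j) (e k) (e l) ^ 2 else 0)) := by
  have hFx : PseudoRiemannian.Metric.inCharts f φ ψ (φ x) = ψ (f x) := by
    rw [PseudoRiemannian.Metric.inCharts, φ.left_inv hxφ]
  have hy : φ x ∈ PseudoRiemannian.chartDomain hf.continuous φ ψ :=
    ⟨φ.map_source hxφ, by simpa [φ.left_inv hxφ] using hxψ⟩
  have hν : ∀ v w, PseudoRiemannian.pair (PseudoRiemannian.coordMatrix g.form ψ
      (PseudoRiemannian.Metric.inCharts f φ ψ (φ x))) (PseudoRiemannian.components ψ (f x) v)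
      (PseudoRiemannian.components ψ (f x) w) = g.val (f x) v w := fun v w => by
    rw [hFx]
    exact PseudoRiemannian.pair_coordMatrix hψ g.val hxψ v w
  have key := (g.isImmersionOn hc hf hs hφ hψ).simons_formula
    (fun y hy => g.meanCurvature_eq_zero hf hmax hφ hψ hy) hy
    (e := fun a => PseudoRiemannian.components φ x (e a))
    (fun a b => (g.pair_coordMatrix_induced hφ hxφ _ _).trans (hframe.tangent a b))
    (ν := fun α => PseudoRiemannian.components ψ (f x) (ν α))
    (fun α β => (hν _ _).trans (hframe.normal α β))
    (fun a α => by
      have h := PseudoRiemannian.sum_components_tangentVec hf hφ hψ hxφ hxψ (e a)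
      exact (congrArg (fun t => PseudoRiemannian.pair _ t _) h).trans
        ((hν _ _).trans (hframe.orthogonal a α)))
    (g.shapeMatrix f φ ψ x e ν) (fun α i j => by rw [hFx]; rfl)
  refine ⟨key, fun hric => ?_⟩
  have hdiag : ∑ i, ∑ j, g.ric f φ x (e i) (e j) ^ 2 = ∑ i, g.ric f φ x (e i) (e i) ^ 2 :=
    Finset.sum_congr rfl fun i _ => Finset.sum_eq_single i
      (fun j _ hj => by rw [hric i j hj.symm, zero_pow two_ne_zero]) (by simp)
  rw [← hdiag]
  exact key
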